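/- Let $T>0$, $J=(0,T)$, and let $V,H$ be complex Hilbert spaces with $V$ densely and continuously embedded in $H$. Let $V^*$ be the space of bounded antilinear functionals on $V$ with the dual norm, and embed $V\hookrightarrow H\hookrightarrow V^*$ by $\psi\mapsto(\psi,\cdot)_H$. For every $t\in J$ let $\mathfrak s_t$ be a sesquilinear form on $V$ such that $t\mapsto\mathfrak s_t[\varphi,\psi]$ is measurable for all $\varphi,\psi\in V$. Let $c_\bullet,c^\bullet>0$ be such that $$\operatorname{Re}\mathfrak s_t[\psi,\psi]\ge c_\bullet\|\psi\|_V^2,\qquad |\mathfrak s_t[\psi,\varphi]|\le c^\bullet\|\psi\|_V\|\varphi\|_V\qquad(\varphi,\psi\in V,\ t\in J),$$ and let $\mathcal B(t)\colon V\to V^*$, $\langle\mathcal B(t)\psi,\varphi\rangle=\mathfrak s_t[\psi,\varphi]$, be the induced operators. Assume that for every $\psi\in V$ the set $\{\mathcal B(t)\psi:t\in J\}$ is separable in $V^*$ (this is automatic if $V$ is separable). Let $\mathcal J\colon V\to V^*$, $\langle\mathcal J\psi,\varphi\rangle=(\psi,\varphi)_V$, be the duality map. For $r\in(1,\infty)$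 let $\mathrm{MR}^r_0(J;V,V^*)$ be the space of all $u\in L^r(J;V)$ whose distributional derivative $u'$ lies in $L^r(J;V^*)$ and whose continuous representative $\overline J\to V^*$ satisfies $u(0)=0$, with norm $\|u\|_{L^r(J;V)}+\|u'\|_{L^r(J;V^*)}$. Write $\mathrm{MR}^r_0(J;V,V^*)^{\sim}$ for the same space with the norm $\|u'+\mathcal J u\|_{L^r(J;V^*)}$. A family $\{\mathcal A(t)\}_{t\in J}$ of bounded operators $V\to V^*$ satisfies maximal $L^r(J;V^*)$-regularity if for every $f\in L^r(J;V^*)$ there is a unique $u\in\mathrm{MR}^r_0(J;V,V^*)$ with $u'(t)+\mathcal A(t)u(t)=f(t)$ for a.e. $t\in J$; the map $f\mapsto u$ is then denoted by $(\frac{\partial}{\partial t}+\mathcal A(\cdot))^{-1}$. Let $r_0\in(2,\infty)$, $r_1\in(1,2)$, let $\theta\in(0,1)$ be defined by $\frac12=\frac{1-\theta}{r_0}+\frac{\theta}{r_1}$, and set $$C_{\mathcal J}=\max_{i\in\{0,1\}}\Big\|\Big(\frac{\partial}{\partial t}+\mathcal J\Big)^{-1}\Big\|_{L^{r_i}(J;V^*)\to\mathrm{MR}^{r_i}_0(J;V,V^*)}\in[0,\infty],$$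 where the norm of an inverse that does not exist on the whole space or is unbounded is read as $\infty$, and $x/\infty=0$. Let $\tilde\theta\in(0,1)$ and let $r\in(1,\infty)$ be such that $\frac1r=\frac{1-\tilde\theta}{r_0}+\frac{\tilde\theta}{r_1}$. Then the following holds. (i) If $$|\theta-\tilde\theta|<\frac{\min(\theta,1-\theta)}{1+\big(1+\frac{1+c^\bullet}{c_\bullet}\big)\max(1,c^\bullet)\,C_{\mathcal J}},$$ then $\{\mathcal B(t)\}_{t\in J}$ satisfies maximal $L^r(J;V^*)$-regularity. (ii) If $$|\theta-\tilde\theta|\le\frac16\,\frac{\min(\theta,1-\theta)}{1+2\big(1+\frac{1+c^\bullet}{c_\bullet}\big)\max(1,c^\bullet)\,C_{\mathcal J}},$$ then $\{\mathcal B(t)\}_{t\in J}$ satisfies maximal $L^r(J;V^*)$-regularity and $$\Big\|\Big(\frac{\partial}{\partial t}+\mathcal B(\cdot)\Big)^{-1}\Big\|_{L^r(J;V^*)\to\mathrm{MR}^r_0(J;V,V^*)^{\sim}}\le 8\,\frac{1+c_\bullet+c^\bullet}{c_\bullet}.$$ -/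

import Mathlib

open MeasureTheory Set Topology
open scoped ENNReal ContDiff

noncomputable section

namespace NonautMaxReg

/-- The space `V^*` of bounded antilinear functionals on `V`, with the dual norm. -/
abbrev AntiDual (V : Type*) [NormedAddCommGroup V] [InnerProductSpace ℂ V] : Type _ :=
  V →L⋆[ℂ] ℂ

/-- Lebesgue measure on the time interval `J = (0,T)`. -/
abbrev volJ (T : ℝ) : Measure ℝ := volume.restrict (Ioo 0 T)

/-- The Bochner space `L^r(J;X)`. -/
abbrev LpJ (T r : ℝ) (X : Type*) [NormedAddCommGroup X] : Type _ :=
  Lp X (ENNReal.ofReal r) (volJ T)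

section MaxReg

variable {D X : Type*} [NormedAddCommGroup D] [NormedSpace ℂ D]
  [NormedAddCommGroup X] [NormedSpace ℂ X]

/-- `g` is the time derivative of `u` on `J = (0,T)` in the sense of `X`-valued distributions. -/
def HasWeakDeriv (T : ℝ) (u g : ℝ → X) : Prop :=
  ∀ φ : ℝ → ℝ, ContDiff ℝ ∞ φ → HasCompactSupport φ → tsupport φ ⊆ Ioo 0 T →
    ∫ t in Ioo 0 T, deriv φ t • u t = -∫ t in Ioo 0 T, φ t • g t

/-- The initial value of `u : J → X` is `0`, read off its continuous representative. -/
def InitialZero (T : ℝ) (u : ℝ → X) : Prop :=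
  ∃ v : ℝ → X, ContinuousOn v (Icc 0 T) ∧ u =ᵐ[volJ T] v ∧ v 0 = 0

/-- `MR^r_0(J;D,X) = L^r(J;D) ∩ W_0^{1,r}(J;X)`, where `ι` is the embedding of `D` in `X`. An
element carries its (unique) time derivative. -/
@[ext] structure MR (ι : D →L[ℂ] X) (T r : ℝ) where
  /-- the function itself, in `L^r(J;D)` -/
  fn : LpJ T r D
  /-- its distributional time derivative, in `L^r(J;X)` -/
  dt : LpJ T r X
  hasWeakDeriv : HasWeakDeriv T (fun t => ι (fn t)) dt
  initialZero : InitialZero T (fun t => ι (fn t))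

/-- The norm `‖u‖_{L^r(J;D)} + ‖u'‖_{L^r(J;X)}` of `MR^r_0(J;D,X)`. -/
def MR.enorm {ι : D →L[ℂ] X} {T r : ℝ} (u : MR ι T r) : ℝ≥0∞ :=
  ‖u.fn‖ₑ + ‖u.dt‖ₑ

/-- The norm `‖u' + K u‖_{L^r(J;X)}` on `MR^r_0(J;D,X)`, for a fixed operator `K : D → X`. -/
def MR.tildeEnorm {ι : D →L[ℂ] X} {T r : ℝ} (K : D →L[ℂ] X) (u : MR ι T r) : ℝ≥0∞ :=
  ‖u.dt + K.compLp u.fn‖ₑ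

/-- `u'(t) + A(t) u(t) = f(t)` for almost all `t ∈ J`. -/
def MR.Solves {ι : D →L[ℂ] X} {T r : ℝ} (u : MR ι T r) (A : ℝ → D →L[ℂ] X)
    (f : LpJ T r X) : Prop :=
  ∀ᵐ t ∂(volJ T), u.dt t + A t (u.fn t) = f t

/-- Maximal parabolic `L^r(J;X)`-regularity of the family `(A(t))_{t ∈ J}`. -/
def MaximalRegularity (ι : D →L[ℂ] X) (A : ℝ → D →L[ℂ] X) (T r : ℝ) : Prop :=
  ∀ f : LpJ T r X, ∃! u : MR ι T r, u.Solves A f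

/-- The operator norm of the solution operator `(∂_t + A(·))⁻¹`, from `L^r(J;X)` to
`MR^r_0(J;D,X)` with the norm `N`: the least `C` with `N u ≤ C ‖f‖` whenever `u' + A u = f`.
It is `∞` if the inverse does not exist on the whole of `L^r(J;X)`, or is unbounded. -/
def inverseNorm (ι : D →L[ℂ] X) (A : ℝ → D →L[ℂ] X) (T r : ℝ)
    (N : MR ι T r → ℝ≥0∞) : ℝ≥0∞ :=
  sInf {C : ℝ≥0∞ | MaximalRegularity ι A T r ∧
    ∀ (f : LpJ T r X) (u : MR ι T r), u.Solves A f → N u ≤ C * ‖f‖ₑ}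

end MaxReg

section Forms

variable {V H : Type*} [NormedAddCommGroup V] [InnerProductSpace ℂ V]
  [NormedAddCommGroup H] [InnerProductSpace ℂ H]

/-- The embedding `V ↪ H ↪ V^*`, `ψ ↦ (φ ↦ (ψ, φ)_H)`, induced by an embedding `j : V ↪ H`. -/
def gelfand (j : V →L[ℂ] H) : V →L[ℂ] AntiDual V :=
  ContinuousLinearMap.bilinearComp (innerSLFlip ℂ) j j

/-- Mathlib's `inner ℂ` is antilinear in its first argument, so `inner ℂ (j φ) (j ψ)` is the
scalar product `(ψ, φ)_H` that is linear in `ψ`. -/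
theorem gelfand_apply (j : V →L[ℂ] H) (ψ φ : V) :
    gelfand j ψ φ = inner ℂ (j φ) (j ψ) := rfl

/-- The duality map `V → V^*`, `⟨𝒥 ψ, φ⟩ = (ψ, φ)_V`. -/
def dualityMap (V : Type*) [NormedAddCommGroup V] [InnerProductSpace ℂ V] :
    V →L[ℂ] AntiDual V :=
  innerSLFlip ℂ

theorem dualityMap_apply (ψ φ : V) : dualityMap V ψ φ = inner ℂ φ ψ := rfl

open Classical in
/-- The operator `V → V^*`, `⟨B ψ, φ⟩ = a[ψ, φ]`, induced by a bounded sesquilinear form `a`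
(linear in the first, antilinear in the second argument); `0` if `a` is unbounded. -/
def inducedOperator (a : V →ₗ[ℂ] V →ₗ⋆[ℂ] ℂ) : V →L[ℂ] AntiDual V :=
  if h : ∃ C : ℝ, ∀ ψ φ, ‖a ψ φ‖ ≤ C * ‖ψ‖ * ‖φ‖ then
    LinearMap.mkContinuous₂ a h.choose h.choose_spec
  else 0

theorem inducedOperator_apply {a : V →ₗ[ℂ] V →ₗ⋆[ℂ] ℂ} {C : ℝ}
    (h : ∀ ψ φ, ‖a ψ φ‖ ≤ C * ‖ψ‖ * ‖φ‖) (ψ φ : V) : inducedOperator a ψ φ = a ψ φ := by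
  have h' : ∃ C : ℝ, ∀ ψ φ, ‖a ψ φ‖ ≤ C * ‖ψ‖ * ‖φ‖ := ⟨C, h⟩
  simp [inducedOperator, dif_pos h']

/-- The larger of the norms of `(∂_t + 𝒥)⁻¹ : L^r(J;V^*) → MR^r_0(J;V,V^*)` for the exponents
`r = r₀` and `r = r₁`. -/
def dualityConst (j : V →L[ℂ] H) (T r₀ r₁ : ℝ) : ℝ≥0∞ :=
  max (inverseNorm (gelfand j) (fun _ => dualityMap V) T r₀ MR.enorm)
    (inverseNorm (gelfand j) (fun _ => dualityMap V) T r₁ MR.enorm)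

end Forms

end NonautMaxReg

end

/-!
Compose `∂_t + B` with the solution operator of the duality map, and consider the quotient
`S = (∂_t + B)(∂_t + 𝒥)⁻¹ = (I - R) + B R`, `R = (∂_t + 𝒥)⁻¹`, as an operator on `L^p(J;V^*)`.
Maximal `L^r`-regularity of `B` amounts to the bijectivity of `S` on `L^r`, and the norm of
`u' + 𝒥 u` in terms of `u' + B u` is the norm of `S⁻¹`.

At the exponent `2` the operator `S` is invertible by Lions' theorem. Existence of solutions comes
from Lions' projection lemma (`CoerciveFamily.exists_traj`), uniqueness from the accretivity of
the time derivative with initial value zero (`Traj.re_integral_inner_nonneg`), and the energy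
estimate gives `‖S⁻¹‖ ≤ K = 1 + (1 + C) / c` (`CoerciveFamily.norm_sum_le_of_traj`). At the exponents
`r₀` and `r₁` the norm of `S` is at most `β = max 1 C * C_𝒥` (`CoerciveFamily.eLpNorm_quotOp_le`).

Invertibility is carried over to nearby exponents by a quantitative form of Šneĭberg's theorem.
For simple functions `g` the families `|g|^{k-1} g`, with `k` affine in a complex parameter `z`, run
through the unit spheres of the `L^p` scale over the strip `0 ≤ Re z ≤ 1`. The difference of
`K ⟨w, S x⟩` and `⟨w', x'⟩`, evaluated along such families, is entire, and bounded by `1 + K β` on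
the strip by the principle of Phragmén and Lindelöf. The families are chosen such that the difference
is small at `θ`, the parameter of the exponent `2`; Schwarz' lemma on the disc of radius
`min θ (1 - θ)` about `θ` then bounds it at `θ'` by `q = (1 + K β) |θ' - θ| / min θ (1 - θ)`
(`SneibergData.compare`). Testing against a norming functional, this gives the lower bound
`(1 - q) ‖x‖ ≤ K ‖S x‖` (`SneibergData.lower_bound`), and starting from the preimage of a given right
hand side at `θ` it gives `‖S x - y‖ ≤ (q + δ) ‖y‖` for some `x`
(`SneibergData.exists_near_preimage`). If `q < 1`, the second property and the lemma of Riesz exclude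
a proper closed range (`surjective_of_near_preimage`), so that `S` is bijective, with
`‖S⁻¹‖ ≤ K / (1 - q)`. Under the hypothesis of the first assertion `q < 1`, and under that of the
second `q ≤ 1 / 6`. If `C_𝒥 = ∞`, then the first hypothesis is never satisfied, and the second one
only for `θ' = θ`, where Lions' theorem applies.

All analysis takes place in `L^p(J;V)`: the Riesz isomorphism identifies `V^*` with `V`, and the
relation `u' = v`, `u(0) = 0`, in its integrated form, becomes `Traj`; this is justified by
`hasWeakDeriv_initialZero_iff`. Operators on `L^p` are first studied on simple functions with values
in `L²`, so that one operator serves all exponents.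
-/

noncomputable section

set_option linter.unusedSectionVars false

namespace NonautMaxReg

/-! ### Bounded analytic functions on the strip and analytic families -/

section StripFunctions

/-- `F` is entire and bounded on the strip `0 ≤ Re z ≤ 1`. -/
def BddStrip (F : ℂ → ℂ) : Prop :=
  Differentiable ℂ F ∧ ∃ C, ∀ z : ℂ, 0 ≤ z.re → z.re ≤ 1 → ‖F z‖ ≤ C

theorem BddStrip.const (c : ℂ) : BddStrip fun _ => c :=
  ⟨differentiable_const _, ‖c‖, fun _ _ _ => le_rfl⟩

theorem BddStrip.add {F G : ℂ → ℂ} (hF : BddStrip F) (hG : BddStrip G) :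
    BddStrip fun z => F z + G z := by
  obtain ⟨C, hC⟩ := hF.2
  obtain ⟨D, hD⟩ := hG.2
  exact ⟨hF.1.add hG.1, C + D, fun z h0 h1 =>
    (norm_add_le _ _).trans (add_le_add (hC z h0 h1) (hD z h0 h1))⟩

theorem BddStrip.mul {F G : ℂ → ℂ} (hF : BddStrip F) (hG : BddStrip G) :
    BddStrip fun z => F z * G z := by
  obtain ⟨C, hC⟩ := hF.2
  obtain ⟨D, hD⟩ := hG.2
  refine ⟨hF.1.mul hG.1, C * D, fun z h0 h1 => ?_⟩
  rw [norm_mul]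
  exact mul_le_mul (hC z h0 h1) (hD z h0 h1) (norm_nonneg _) ((norm_nonneg _).trans (hC z h0 h1))

theorem BddStrip.sum {ι : Type*} (s : Finset ι) {F : ι → ℂ → ℂ} (h : ∀ i ∈ s, BddStrip (F i)) :
    BddStrip fun z => ∑ i ∈ s, F i z := by
  classical
  induction s using Finset.induction_on with
  | empty => simpa using BddStrip.const 0
  | insert a s ha ih =>
    simp only [Finset.sum_insert ha]
    exact (h a (Finset.mem_insert_self a s)).add
      (ih fun i hi => h i (Finset.mem_insert_of_mem hi))

theorem BddStrip.exp_affine (a b : ℝ) : BddStrip fun z => Complex.exp (a + b * z) := by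
  refine ⟨by fun_prop, Real.exp (|a| + |b|), fun z h0 h1 => ?_⟩
  rw [Complex.norm_exp]
  refine Real.exp_le_exp.mpr ?_
  have h : (a + b * z : ℂ).re = a + b * z.re := by simp
  rw [h]
  have h2 : b * z.re ≤ |b| * 1 :=
    (mul_le_mul_of_nonneg_right (le_abs_self b) h0).trans
      (mul_le_mul_of_nonneg_left h1 (abs_nonneg b))
  linarith [le_abs_self a]

/-- The maximum principle of Phragmén and Lindelöf. -/
theorem BddStrip.norm_le {F : ℂ → ℂ} (hF : BddStrip F) {M : ℝ}
    (h0 : ∀ z : ℂ, z.re = 0 → ‖F z‖ ≤ M) (h1 : ∀ z : ℂ, z.re = 1 → ‖F z‖ ≤ M)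
    {z : ℂ} (hz0 : 0 ≤ z.re) (hz1 : z.re ≤ 1) : ‖F z‖ ≤ M := by
  obtain ⟨hd, C, hC⟩ := hF
  refine PhragmenLindelof.vertical_strip (a := 0) (b := 1) hd.diffContOnCl
    ⟨0, by simp [Real.pi_pos], 0, ?_⟩ h0 h1 hz0 hz1
  refine Asymptotics.IsBigO.of_bound C ?_
  refine Filter.eventually_inf_principal.mpr (Filter.Eventually.of_forall fun w hw => ?_)
  simpa using hC w hw.1.le hw.2.le

/-- The disc of radius `min θ (1 - θ)` about `θ` lies in the strip, so that Schwarz' lemma, applied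
to `F - F θ`, controls the values of `F` at nearby points `θ'` of the real axis. -/
theorem BddStrip.norm_le_schwarz {F : ℂ → ℂ} (hF : BddStrip F) {M : ℝ}
    (h0 : ∀ z : ℂ, z.re = 0 → ‖F z‖ ≤ M) (h1 : ∀ z : ℂ, z.re = 1 → ‖F z‖ ≤ M)
    {θ θ' : ℝ} (hθθ : |θ' - θ| < min θ (1 - θ)) :
    ‖F θ'‖ ≤ ‖F θ‖ + (M + ‖F θ‖) * (|θ' - θ| / min θ (1 - θ)) := by
  set m := min θ (1 - θ)
  have hball : ∀ z ∈ Metric.ball (θ : ℂ) m, 0 ≤ z.re ∧ z.re ≤ 1 := by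
    intro z hz
    have h : |z.re - θ| < m := by
      refine lt_of_le_of_lt ?_ (mem_ball_iff_norm.mp hz)
      simpa using Complex.abs_re_le_norm (z - θ)
    have h3 := abs_lt.mp h
    have h4 : m ≤ θ := min_le_left _ _
    have h5 : m ≤ 1 - θ := min_le_right _ _
    constructor <;> linarith
  have hd : dist (θ' : ℂ) (θ : ℂ) = |θ' - θ| := by
    rw [dist_eq_norm, ← Complex.ofReal_sub, Complex.norm_real, Real.norm_eq_abs]
  have key := Complex.dist_le_div_mul_dist_of_mapsTo_ball (f := F) (c := (θ : ℂ)) (R₁ := m)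
    (R₂ := M + ‖F θ‖) (z := θ') hF.1.differentiableOn (fun z hz => ?_)
    (by rw [Metric.mem_ball, hd]; exact hθθ)
  · rw [hd, dist_eq_norm] at key
    have := norm_le_norm_add_norm_sub (F θ) (F θ')
    rw [norm_sub_rev] at this
    calc ‖F θ'‖ ≤ _ := this
      _ ≤ _ := by
        gcongr
        refine key.trans (le_of_eq ?_)
        ring
  · rw [mem_closedBall_iff_norm]
    refine (norm_sub_le _ _).trans ?_
    gcongr
    exact hF.norm_le h0 h1 (hball z hz).1 (hball z hz).2

end StripFunctions

section PowFamily

variable {α E : Type*} [MeasurableSpace α] [NormedAddCommGroup E] [InnerProductSpace ℂ E]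
  {μ : Measure α}

/-- The exponent `1 / s` of an `L^p` space; exponents are parametrised by their reciprocals since
these depend affinely on the interpolation parameter. -/
def recipExp (s : ℝ) : ℝ≥0∞ := ENNReal.ofReal s⁻¹

theorem recipExp_ne_top (s : ℝ) : recipExp s ≠ ⊤ := ENNReal.ofReal_ne_top

theorem recipExp_ne_zero {s : ℝ} (hs : 0 < s) : recipExp s ≠ 0 := by
  simp [recipExp, hs]

theorem recipExp_toReal {s : ℝ} (hs : 0 < s) : (recipExp s).toReal = s⁻¹ :=
  ENNReal.toReal_ofReal (inv_nonneg.mpr hs.le)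

/-- The simple function `|g|^{k-1} g`, for a complex exponent `k`. It is entire in `k`, also where
`g` vanishes, because of `Real.log 0 = 0`. -/
def powFam (g : SimpleFunc α E) (k : ℂ) : SimpleFunc α E :=
  g.map fun v => Complex.exp ((k - 1) * Real.log ‖v‖) • v

theorem powFam_apply (g : SimpleFunc α E) (k : ℂ) (t : α) :
    powFam g k t = Complex.exp ((k - 1) * Real.log ‖g t‖) • g t := rfl

theorem powFam_one (g : SimpleFunc α E) : powFam g 1 = g := by
  ext t
  simp [powFam_apply]

theorem norm_powFam (g : SimpleFunc α E) {k : ℂ} (hk : 0 < k.re) (t : α) :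
    ‖powFam g k t‖ = ‖g t‖ ^ k.re := by
  rw [powFam_apply, norm_smul, Complex.norm_exp]
  rcases eq_or_ne (g t) 0 with h | h
  · simp [h, Real.zero_rpow hk.ne']
  · have hpos : 0 < ‖g t‖ := norm_pos_iff.mpr h
    have h1 : ((k - 1) * (Real.log ‖g t‖ : ℂ)).re = Real.log ‖g t‖ * (k.re - 1) := by
      rw [Complex.re_mul_ofReal]; simp [mul_comm]
    rw [h1, ← Real.rpow_def_of_pos hpos, Real.rpow_sub_one hpos.ne', div_mul_cancel₀ _ hpos.ne']

theorem eLpNorm_le_one_iff {s : ℝ} (hs : 0 < s) (f : α → E) :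
    eLpNorm f (recipExp s) μ ≤ 1 ↔ ∫⁻ t, ‖f t‖ₑ ^ s⁻¹ ∂μ ≤ 1 := by
  rw [eLpNorm_eq_lintegral_rpow_enorm_toReal (recipExp_ne_zero hs) (recipExp_ne_top s),
    recipExp_toReal hs, one_div, inv_inv]
  constructor
  · intro h
    have := ENNReal.rpow_le_rpow h (inv_nonneg.mpr hs.le)
    rwa [← ENNReal.rpow_mul, mul_inv_cancel₀ hs.ne', ENNReal.rpow_one, ENNReal.one_rpow] at this
  · intro h
    simpa using ENNReal.rpow_le_rpow h hs.le

theorem eLpNorm_powFam_le_one (g : SimpleFunc α E) {s s' : ℝ} (hs : 0 < s) (hs' : 0 < s')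
    (hg : eLpNorm g (recipExp s) μ ≤ 1) {k : ℂ} (hk : k.re = s' / s) :
    eLpNorm (powFam g k) (recipExp s') μ ≤ 1 := by
  rw [eLpNorm_le_one_iff hs] at hg
  rw [eLpNorm_le_one_iff hs']
  convert hg using 3 with t
  have hkpos : 0 < k.re := by rw [hk]; positivity
  have h : ‖powFam g k t‖ₑ = ‖g t‖ₑ ^ k.re := by
    rw [← ofReal_norm, norm_powFam g hkpos, ← ofReal_norm,
      ENNReal.ofReal_rpow_of_nonneg (norm_nonneg _) hkpos.le]
  rw [h, ← ENNReal.rpow_mul, hk]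
  congr 1
  field_simp

open Classical in
/-- The part of a simple function on the set where it takes the value `v`. -/
def piece (g : SimpleFunc α E) (v : E) : SimpleFunc α E := g.map fun u => if u = v then v else 0

theorem powFam_eq_sum (g : SimpleFunc α E) (k : ℂ) :
    powFam g k = ∑ v ∈ g.range, Complex.exp ((k - 1) * Real.log ‖v‖) • piece g v := by
  classical
  ext t
  have h : ∀ s : Finset E, (∑ v ∈ s, Complex.exp ((k - 1) * Real.log ‖v‖) • piece g v) t =
      ∑ v ∈ s, Complex.exp ((k - 1) * Real.log ‖v‖) • piece g v t := by
    intro s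
    induction s using Finset.induction_on with
    | empty => simp
    | insert a s ha ih => rw [Finset.sum_insert ha, Finset.sum_insert ha, SimpleFunc.add_apply, ih,
        SimpleFunc.smul_apply]
  rw [h, Finset.sum_eq_single (g t)]
  · simp [powFam_apply, piece]
  · intro v _ hv
    simp [piece, Ne.symm hv]
  · intro hv
    exact absurd (SimpleFunc.mem_range_self g t) hv

/-- Sesquilinear forms on simple functions, antilinear in the first argument. -/
abbrev SimpleForm (α E : Type*) [MeasurableSpace α] [NormedAddCommGroup E]
    [InnerProductSpace ℂ E] : Type _ :=
  SimpleFunc α E →ₗ⋆[ℂ] SimpleFunc α E →ₗ[ℂ] ℂ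

/-- Evaluation of a sesquilinear form along the families `powFam`, where the conjugation in the
antilinear argument makes the result holomorphic. The exponents `1 / (s₀ + (s₁ - s₀) τ)` of `g` and
`1 / (1 - (s₀ + (s₁ - s₀) σ))` of `w` are those at which the families reproduce `g` and `w`. -/
def familyEval (b : SimpleForm α E) (s₀ s₁ σ τ : ℝ) (w g : SimpleFunc α E) (z : ℂ) : ℂ :=
  b (powFam w ((1 - (s₀ + (s₁ - s₀) * starRingEnd ℂ z)) / (1 - (s₀ + (s₁ - s₀) * σ) : ℝ)))
    (powFam g ((s₀ + (s₁ - s₀) * z) / (s₀ + (s₁ - s₀) * τ : ℝ)))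

theorem bddStrip_familyEval (b : SimpleForm α E) (s₀ s₁ σ τ : ℝ) (w g : SimpleFunc α E) :
    BddStrip (familyEval b s₀ s₁ σ τ w g) := by
  have h : familyEval b s₀ s₁ σ τ w g = fun z => ∑ u ∈ w.range, ∑ v ∈ g.range,
      Complex.exp (((((1 - s₀) / (1 - (s₀ + (s₁ - s₀) * σ)) - 1) * Real.log ‖u‖ : ℝ) : ℂ) +
        ((-(s₁ - s₀) / (1 - (s₀ + (s₁ - s₀) * σ)) * Real.log ‖u‖ : ℝ) : ℂ) * z) *
      (Complex.exp ((((s₀ / (s₀ + (s₁ - s₀) * τ) - 1) * Real.log ‖v‖ : ℝ) : ℂ) +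
        (((s₁ - s₀) / (s₀ + (s₁ - s₀) * τ) * Real.log ‖v‖ : ℝ) : ℂ) * z) *
        b (piece w u) (piece g v)) := by
    funext z
    simp only [familyEval, powFam_eq_sum w, powFam_eq_sum g, map_sum, LinearMap.map_smulₛₗ,
      LinearMap.sum_apply, LinearMap.smul_apply, smul_eq_mul, RingHom.id_apply, Finset.mul_sum]
    rw [Finset.sum_comm]
    refine Finset.sum_congr rfl fun u _ => Finset.sum_congr rfl fun v _ => ?_
    have e1 : (starRingEnd ℂ) (Complex.exp (((1 - (s₀ + (s₁ - s₀) * starRingEnd ℂ z)) /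
        (1 - (s₀ + (s₁ - s₀) * σ) : ℝ) - 1) * Real.log ‖u‖)) =
        Complex.exp (((((1 - s₀) / (1 - (s₀ + (s₁ - s₀) * σ)) - 1) * Real.log ‖u‖ : ℝ) : ℂ) +
        ((-(s₁ - s₀) / (1 - (s₀ + (s₁ - s₀) * σ)) * Real.log ‖u‖ : ℝ) : ℂ) * z) := by
      rw [← Complex.exp_conj]
      congr 1
      simp only [map_mul, map_sub, map_div₀, map_add, map_one, Complex.conj_ofReal,
        Complex.conj_conj]
      push_cast
      ring
    have e2 : Complex.exp (((s₀ + (s₁ - s₀) * z) /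
        (s₀ + (s₁ - s₀) * τ : ℝ) - 1) * Real.log ‖v‖) =
        Complex.exp ((((s₀ / (s₀ + (s₁ - s₀) * τ) - 1) * Real.log ‖v‖ : ℝ) : ℂ) +
        (((s₁ - s₀) / (s₀ + (s₁ - s₀) * τ) * Real.log ‖v‖ : ℝ) : ℂ) * z) := by
      congr 1
      push_cast
      ring
    rw [e1, e2]
    ring
  rw [h]
  exact BddStrip.sum _ fun u _ => BddStrip.sum _ fun v _ =>
    (BddStrip.exp_affine _ _).mul ((BddStrip.exp_affine _ _).mul (BddStrip.const _))

/-- The form `b` is bounded by `M` on `L^{q'} × L^q`, where `s = 1 / q`. -/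
def FormBound (μ : Measure α) (b : SimpleForm α E) (s M : ℝ) : Prop :=
  ∀ w g : SimpleFunc α E, eLpNorm w (recipExp (1 - s)) μ ≤ 1 → eLpNorm g (recipExp s) μ ≤ 1 →
    ‖b w g‖ ≤ M

theorem affine_mem_Ioo {s₀ s₁ τ : ℝ} (h0 : s₀ ∈ Ioo (0 : ℝ) 1) (h1 : s₁ ∈ Ioo (0 : ℝ) 1)
    (hτ : τ ∈ Icc (0 : ℝ) 1) : s₀ + (s₁ - s₀) * τ ∈ Ioo (0 : ℝ) 1 := by
  obtain ⟨a, b⟩ := h0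
  obtain ⟨c, d⟩ := h1
  obtain ⟨e, f⟩ := hτ
  have h : s₀ + (s₁ - s₀) * τ = s₀ * (1 - τ) + s₁ * τ := by ring
  rw [h]
  constructor <;> rcases eq_or_lt_of_le e with rfl | e'
  · simpa using a
  · nlinarith [mul_nonneg a.le (sub_nonneg.mpr f), mul_pos c e']
  · simpa using b
  · nlinarith [mul_nonneg (sub_nonneg.mpr b.le) (sub_nonneg.mpr f), mul_pos (sub_pos.mpr d) e']

theorem familyEval_le {b : SimpleForm α E} {s₀ s₁ σ τ M ρ : ℝ} (h0 : s₀ ∈ Ioo (0 : ℝ) 1)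
    (h1 : s₁ ∈ Ioo (0 : ℝ) 1) (hσ : σ ∈ Icc (0 : ℝ) 1) (hτ : τ ∈ Icc (0 : ℝ) 1)
    (hρ : ρ ∈ Icc (0 : ℝ) 1)
    (hb : FormBound μ b (s₀ + (s₁ - s₀) * ρ) M) {w g : SimpleFunc α E}
    (hw : eLpNorm w (recipExp (1 - (s₀ + (s₁ - s₀) * σ))) μ ≤ 1)
    (hg : eLpNorm g (recipExp (s₀ + (s₁ - s₀) * τ)) μ ≤ 1) {z : ℂ} (hz : z.re = ρ) :
    ‖familyEval b s₀ s₁ σ τ w g z‖ ≤ M := by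
  have hs := affine_mem_Ioo h0 h1 hσ
  have ht := affine_mem_Ioo h0 h1 hτ
  have hr := affine_mem_Ioo h0 h1 hρ
  refine hb _ _ (eLpNorm_powFam_le_one w (sub_pos.mpr hs.2) (sub_pos.mpr hr.2) hw ?_)
    (eLpNorm_powFam_le_one g ht.1 hr.1 hg ?_)
  · rw [Complex.div_ofReal_re]; simp [hz]
  · rw [Complex.div_ofReal_re]; simp [hz]

theorem familyEval_left {b : SimpleForm α E} {s₀ s₁ σ τ : ℝ} (h0 : s₀ ∈ Ioo (0 : ℝ) 1)
    (h1 : s₁ ∈ Ioo (0 : ℝ) 1) (hσ : σ ∈ Icc (0 : ℝ) 1) (w g : SimpleFunc α E) :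
    familyEval b s₀ s₁ σ τ w g σ =
      b w (powFam g ((s₀ + (s₁ - s₀) * σ) / (s₀ + (s₁ - s₀) * τ : ℝ))) := by
  have hs : (1 - (s₀ + (s₁ - s₀) * σ) : ℝ) ≠ 0 := (sub_pos.mpr (affine_mem_Ioo h0 h1 hσ).2).ne'
  have h : ((1 - (s₀ + (s₁ - s₀) * starRingEnd ℂ σ)) / (1 - (s₀ + (s₁ - s₀) * σ) : ℝ) : ℂ)
      = 1 := by
    rw [Complex.conj_ofReal, div_eq_one_iff_eq (Complex.ofReal_ne_zero.mpr hs)]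
    push_cast; ring
  rw [familyEval, h, powFam_one]

theorem familyEval_right {b : SimpleForm α E} {s₀ s₁ σ τ : ℝ} (h0 : s₀ ∈ Ioo (0 : ℝ) 1)
    (h1 : s₁ ∈ Ioo (0 : ℝ) 1) (hτ : τ ∈ Icc (0 : ℝ) 1) (w g : SimpleFunc α E) :
    familyEval b s₀ s₁ σ τ w g τ =
      b (powFam w ((1 - (s₀ + (s₁ - s₀) * τ)) / (1 - (s₀ + (s₁ - s₀) * σ) : ℝ))) g := by
  have hs : (s₀ + (s₁ - s₀) * τ : ℝ) ≠ 0 := (affine_mem_Ioo h0 h1 hτ).1.ne'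
  have h : ((s₀ + (s₁ - s₀) * τ) / (s₀ + (s₁ - s₀) * τ : ℝ) : ℂ) = 1 := by
    rw [div_eq_one_iff_eq (Complex.ofReal_ne_zero.mpr hs)]
    push_cast; ring
  rw [familyEval, h, powFam_one, Complex.conj_ofReal]

/-- The Riesz-Thorin theorem, for forms on simple functions. -/
theorem FormBound.interpolate {b : SimpleForm α E} {s₀ s₁ τ M : ℝ} (h0 : s₀ ∈ Ioo (0 : ℝ) 1)
    (h1 : s₁ ∈ Ioo (0 : ℝ) 1) (hτ : τ ∈ Icc (0 : ℝ) 1) (hb0 : FormBound μ b s₀ M)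
    (hb1 : FormBound μ b s₁ M) : FormBound μ b (s₀ + (s₁ - s₀) * τ) M := by
  intro w g hw hg
  have h := familyEval_right (b := b) (σ := τ) h0 h1 hτ w g
  have hs : (1 - (s₀ + (s₁ - s₀) * τ) : ℝ) ≠ 0 := (sub_pos.mpr (affine_mem_Ioo h0 h1 hτ).2).ne'
  have h' : ((1 - (s₀ + (s₁ - s₀) * τ)) / (1 - (s₀ + (s₁ - s₀) * τ) : ℝ) : ℂ) = 1 := by
    rw [div_eq_one_iff_eq (Complex.ofReal_ne_zero.mpr hs)]
    push_cast; ring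
  rw [h', powFam_one] at h
  rw [← h]
  refine (bddStrip_familyEval b s₀ s₁ τ τ w g).norm_le (fun z hz => ?_) (fun z hz => ?_)
    (by simpa using hτ.1) (by simpa using hτ.2)
  · exact familyEval_le (ρ := 0) h0 h1 hτ hτ (by simp) (by simpa using hb0) hw hg hz
  · exact familyEval_le (ρ := 1) h0 h1 hτ hτ (by simp) (by simpa using hb1) hw hg hz

end PowFamily

/-! ### Pairings and duality in Bochner spaces -/

section Duality

variable {α E : Type*} [MeasurableSpace α] [NormedAddCommGroup E] [InnerProductSpace ℂ E]
  {μ : Measure α} [IsFiniteMeasure μ]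

theorem recipExp_half : recipExp (1 / 2) = 2 := by
  simp [recipExp]

/-- Simple functions as elements of the Hilbert space `L²`. -/
def toL2 (μ : Measure α) [IsFiniteMeasure μ] : SimpleFunc α E →ₗ[ℂ] Lp E 2 μ where
  toFun g := (g.memLp_of_isFiniteMeasure 2 μ).toLp g
  map_add' _ _ := rfl
  map_smul' _ _ := rfl

theorem coeFn_toL2 (g : SimpleFunc α E) : toL2 μ g =ᵐ[μ] g :=
  (g.memLp_of_isFiniteMeasure 2 μ).coeFn_toLp

theorem eLpNorm_toL2 (g : SimpleFunc α E) (p : ℝ≥0∞) : eLpNorm (toL2 μ g) p μ = eLpNorm g p μ :=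
  eLpNorm_congr_ae (coeFn_toL2 g)

theorem norm_toL2_le_one {g : SimpleFunc α E} (hg : eLpNorm g (recipExp (1 / 2)) μ ≤ 1) :
    ‖toL2 μ g‖ ≤ 1 := by
  rw [recipExp_half] at hg
  rw [Lp.norm_def, eLpNorm_toL2]
  exact ENNReal.toReal_mono ENNReal.one_ne_top hg

theorem eLpNorm_le_one_of_norm_toL2 {g : SimpleFunc α E} (hg : ‖toL2 μ g‖ ≤ 1) :
    eLpNorm g (recipExp (1 / 2)) μ ≤ 1 := by
  rw [recipExp_half, ← eLpNorm_toL2 (μ := μ), ← Lp.enorm_def, ← ofReal_norm]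
  exact ENNReal.ofReal_le_one.mpr hg

/-- The sesquilinear form of an operator that is defined on simple functions. -/
def formOf (S : SimpleFunc α E →ₗ[ℂ] Lp E 2 μ) : SimpleForm α E :=
  LinearMap.mk₂'ₛₗ (starRingEnd ℂ) (RingHom.id ℂ) (fun w g => inner ℂ (toL2 μ w) (S g))
    (fun w w' g => by simp [inner_add_left]) (fun c w g => by simp [inner_smul_left])
    (fun w g g' => by simp [inner_add_right]) (fun c w g => by simp [inner_smul_right])

theorem formOf_apply (S : SimpleFunc α E →ₗ[ℂ] Lp E 2 μ) (w g : SimpleFunc α E) :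
    formOf S w g = inner ℂ (toL2 μ w) (S g) := rfl

theorem holder_inner {s : ℝ} (hs : s ∈ Ioo (0 : ℝ) 1) (f g : Lp E 2 μ) :
    ‖(inner ℂ f g : ℂ)‖ₑ ≤ eLpNorm f (recipExp (1 - s)) μ * eLpNorm g (recipExp s) μ := by
  have hH : ENNReal.HolderConjugate (recipExp (1 - s)) (recipExp s) := by
    have h : (1 - s)⁻¹.HolderConjugate s⁻¹ := by
      refine (Real.holderConjugate_iff).mpr ⟨?_, by simp⟩
      rw [one_lt_inv₀ (sub_pos.mpr hs.2)]
      linarith [hs.1]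
    exact h.ennrealOfReal
  rw [L2.inner_def]
  refine (enorm_integral_le_lintegral_enorm _).trans ?_
  rw [← eLpNorm_one_eq_lintegral_enorm]
  have := eLpNorm_le_eLpNorm_mul_eLpNorm'_of_norm (p := recipExp (1 - s)) (q := recipExp s)
    (r := 1) (μ := μ) (Lp.aestronglyMeasurable f) (Lp.aestronglyMeasurable g)
    (fun a b => (inner ℂ a b : ℂ)) 1
    (Filter.Eventually.of_forall fun x => by simpa using norm_inner_le_norm (f x) (g x))
  simpa using this

theorem norm_inner_le_of_eLpNorm {s : ℝ} (hs : s ∈ Ioo (0 : ℝ) 1) {f g : Lp E 2 μ} {M : ℝ}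
    (hf : eLpNorm f (recipExp (1 - s)) μ ≤ 1) (hg : eLpNorm g (recipExp s) μ ≤ ENNReal.ofReal M)
    (hM : 0 ≤ M) : ‖(inner ℂ f g : ℂ)‖ ≤ M := by
  have h := (holder_inner hs f g).trans (mul_le_mul' hf hg)
  rw [one_mul, ← ofReal_norm] at h
  exact (ENNReal.ofReal_le_ofReal_iff hM).mp h

theorem formBound_formOf {S : SimpleFunc α E →ₗ[ℂ] Lp E 2 μ} {s M : ℝ} (hs : s ∈ Ioo (0 : ℝ) 1)
    (hM : 0 ≤ M) (hS : ∀ g : SimpleFunc α E,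
      eLpNorm (S g) (recipExp s) μ ≤ ENNReal.ofReal M * eLpNorm g (recipExp s) μ) :
    FormBound μ (formOf S) s M := by
  intro w g hw hg
  refine norm_inner_le_of_eLpNorm hs ((eLpNorm_toL2 w _).trans_le hw) ((hS g).trans ?_) hM
  simpa using mul_le_mul_right hg (ENNReal.ofReal M)

theorem eLpNorm_simple_ne_top (g : SimpleFunc α E) (p : ℝ≥0∞) : eLpNorm g p μ ≠ ⊤ :=
  (g.memLp_of_isFiniteMeasure p μ).2.ne

theorem eLpNorm_smul_inv_le_one {g : α → E} {p : ℝ≥0∞} {N : ℝ} (hN : 0 < N)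
    (h : eLpNorm g p μ ≤ ENNReal.ofReal N) :
    eLpNorm (((N⁻¹ : ℝ) : ℂ) • g) p μ ≤ 1 := by
  rw [eLpNorm_const_smul, ← ofReal_norm, Complex.norm_real, Real.norm_eq_abs,
    abs_of_pos (inv_pos.mpr hN)]
  calc _ ≤ ENNReal.ofReal N⁻¹ * ENNReal.ofReal N := by gcongr
    _ = 1 := by rw [← ENNReal.ofReal_mul (inv_nonneg.mpr hN.le), inv_mul_cancel₀ hN.ne']; simp

/-- The norm of a simple function in `L^q`, `q = 1 / s`, is attained on the unit ball of `L^{q'}`,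
at a multiple of `|x|^{q-2} x`. -/
theorem exists_norming {s : ℝ} (hs : s ∈ Ioo (0 : ℝ) 1) (x : SimpleFunc α E) :
    ∃ w : SimpleFunc α E, eLpNorm w (recipExp (1 - s)) μ ≤ 1 ∧
      (eLpNorm x (recipExp s) μ).toReal ≤ ‖(inner ℂ (toL2 μ w) (toL2 μ x) : ℂ)‖ := by
  set N := (eLpNorm x (recipExp s) μ).toReal with hNdef
  have hNtop := eLpNorm_simple_ne_top (μ := μ) x (recipExp s)
  have hN0 : 0 ≤ N := ENNReal.toReal_nonneg
  rcases hN0.eq_or_lt with h | hN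
  · exact ⟨0, by simp, by rw [← h]; positivity⟩
  set x1 : SimpleFunc α E := ((N⁻¹ : ℝ) : ℂ) • x with hx1
  have hx1n : eLpNorm x1 (recipExp s) μ = 1 := by
    rw [hx1, SimpleFunc.coe_smul, eLpNorm_const_smul, ← ofReal_norm, Complex.norm_real,
      Real.norm_eq_abs, abs_of_pos (inv_pos.mpr hN), (ENNReal.ofReal_toReal hNtop).symm, ← hNdef,
      ← ENNReal.ofReal_mul (inv_nonneg.mpr hN.le), inv_mul_cancel₀ hN.ne', ENNReal.ofReal_one]
  have hpos : 0 < (1 - s) / s := div_pos (sub_pos.mpr hs.2) hs.1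
  set w := powFam x1 (((1 - s) / s : ℝ) : ℂ) with hw
  refine ⟨w, eLpNorm_powFam_le_one x1 hs.1 (sub_pos.mpr hs.2) hx1n.le
    (Complex.ofReal_re _), ?_⟩
  have hint : ∫ t, ‖x1 t‖ ^ s⁻¹ ∂μ = 1 := by
    have h1 : ∫⁻ t, ‖x1 t‖ₑ ^ s⁻¹ ∂μ = 1 := by
      rw [eLpNorm_eq_lintegral_rpow_enorm_toReal (recipExp_ne_zero hs.1) (recipExp_ne_top s),
        recipExp_toReal hs.1, one_div, inv_inv] at hx1n
      have := congrArg (fun a => a ^ s⁻¹) hx1n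
      simpa [← ENNReal.rpow_mul, mul_inv_cancel₀ hs.1.ne'] using this
    rw [integral_eq_lintegral_of_nonneg_ae
      (Filter.Eventually.of_forall fun t => by positivity)
      (by
        have : (fun t => ‖x1 t‖ ^ s⁻¹) = (x1.map fun v => ‖v‖ ^ s⁻¹) := rfl
        rw [this]; exact SimpleFunc.aestronglyMeasurable _)]
    have h2 : ∀ t, ENNReal.ofReal (‖x1 t‖ ^ s⁻¹) = ‖x1 t‖ₑ ^ s⁻¹ := fun t => by
      rw [← ofReal_norm, ENNReal.ofReal_rpow_of_nonneg (norm_nonneg _) (inv_nonneg.mpr hs.1.le)]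
    simp [h2, h1]
  have hin : (inner ℂ (toL2 μ w) (toL2 μ x1) : ℂ) = 1 := by
    rw [L2.inner_def]
    have : ∀ᵐ t ∂μ, (inner ℂ (toL2 μ w t) (toL2 μ x1 t) : ℂ) = ((‖x1 t‖ ^ s⁻¹ : ℝ) : ℂ) := by
      filter_upwards [coeFn_toL2 (μ := μ) w, coeFn_toL2 (μ := μ) x1] with t h1 h2
      rw [h1, h2, hw, powFam_apply, inner_smul_left, inner_self_eq_norm_sq_to_K,
        ← Complex.exp_conj]
      rcases eq_or_ne (x1 t) 0 with h | h
      · simp [h, Real.zero_rpow (inv_pos.mpr hs.1).ne']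
      · have hp : 0 < ‖x1 t‖ := norm_pos_iff.mpr h
        have e : (starRingEnd ℂ) ((((1 - s) / s : ℝ) - 1 : ℂ) * (Real.log ‖x1 t‖ : ℂ)) =
            ((Real.log ‖x1 t‖ * ((1 - s) / s - 1) : ℝ) : ℂ) := by
          simp only [map_mul, map_sub, map_one, Complex.conj_ofReal]
          push_cast; ring
        rw [e, ← Complex.ofReal_exp, ← Real.rpow_def_of_pos hp]
        have : (‖x1 t‖ ^ s⁻¹ : ℝ) = ‖x1 t‖ ^ ((1 - s) / s - 1) * ‖x1 t‖ ^ 2 := by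
          rw [← Real.rpow_natCast, ← Real.rpow_add hp]
          congr 1
          have := hs.1.ne'
          field_simp
          push_cast
          ring
        rw [this]
        push_cast
        rfl
    rw [integral_congr_ae this, integral_complex_ofReal, hint, Complex.ofReal_one]
  have hx : x = (N : ℂ) • x1 := by
    rw [hx1, smul_smul, ← Complex.ofReal_mul, mul_inv_cancel₀ hN.ne', Complex.ofReal_one, one_smul]
  rw [hx, map_smul, inner_smul_right, hin, mul_one, Complex.norm_real, Real.norm_eq_abs]
  exact le_abs_self N

theorem eLpNorm_le_of_forall_inner {s : ℝ} (hs : s ∈ Ioo (0 : ℝ) 1) {g : Lp E 2 μ}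
    (hg : eLpNorm g (recipExp s) μ ≠ ⊤) {M : ℝ} (hM : 0 ≤ M)
    (h : ∀ w : SimpleFunc α E, eLpNorm w (recipExp (1 - s)) μ ≤ 1 →
      ‖(inner ℂ (toL2 μ w) g : ℂ)‖ ≤ M) :
    eLpNorm g (recipExp s) μ ≤ ENNReal.ofReal M := by
  have hp1 : 1 ≤ recipExp s := by
    rw [recipExp, ENNReal.one_le_ofReal, one_le_inv₀ hs.1]; exact hs.2.le
  have hmem : MemLp g (recipExp s) μ := ⟨Lp.aestronglyMeasurable g, lt_top_iff_ne_top.mpr hg⟩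
  refine ENNReal.le_of_forall_pos_le_add fun ε hε _ => ?_
  have hε2 : (0 : ℝ) < ε / 2 := by positivity
  obtain ⟨x, hx, -⟩ := hmem.exists_simpleFunc_eLpNorm_sub_lt (recipExp_ne_top s)
    (ε := ENNReal.ofReal (ε / 2)) (by simpa using hε2)
  obtain ⟨w, hw, hwx⟩ := exists_norming (μ := μ) hs x
  have hsub : eLpNorm (toL2 μ x - g : Lp E 2 μ) (recipExp s) μ ≤ ENNReal.ofReal (ε / 2) := by
    have h1 : (toL2 μ x - g : Lp E 2 μ) =ᵐ[μ] ⇑x - ⇑g := by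
      filter_upwards [Lp.coeFn_sub (toL2 μ x) g, coeFn_toL2 (μ := μ) x] with t h1 h2
      rw [h1, Pi.sub_apply, h2, Pi.sub_apply]
    rw [eLpNorm_congr_ae h1, eLpNorm_sub_comm]
    exact hx.le
  have h3 : ‖(inner ℂ (toL2 μ w) (toL2 μ x) : ℂ)‖ ≤ M + ε / 2 := by
    have e : toL2 μ x = g + (toL2 μ x - g) := by abel
    rw [e, inner_add_right]
    exact (norm_add_le _ _).trans (add_le_add (h w hw)
      (norm_inner_le_of_eLpNorm hs ((eLpNorm_toL2 w _).trans_le hw) hsub hε2.le))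
  have h4 : eLpNorm x (recipExp s) μ ≤ ENNReal.ofReal (M + ε / 2) := by
    rw [← ENNReal.ofReal_toReal (eLpNorm_simple_ne_top (μ := μ) x (recipExp s))]
    exact ENNReal.ofReal_le_ofReal (hwx.trans h3)
  calc eLpNorm g (recipExp s) μ = eLpNorm (⇑x + (⇑g - ⇑x)) (recipExp s) μ := by simp
    _ ≤ eLpNorm x (recipExp s) μ + eLpNorm (⇑g - ⇑x) (recipExp s) μ :=
      eLpNorm_add_le x.aestronglyMeasurable
        ((Lp.aestronglyMeasurable g).sub x.aestronglyMeasurable) hp1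
    _ ≤ ENNReal.ofReal (M + ε / 2) + ENNReal.ofReal (ε / 2) := add_le_add h4 hx.le
    _ = ENNReal.ofReal M + ε := by
      rw [← ENNReal.ofReal_add (by positivity) hε2.le, add_assoc, add_halves,
        ENNReal.ofReal_add hM ε.coe_nonneg, ENNReal.ofReal_coe_nnreal]

/-- A scale-invariant reading of a bound on the unit ball of `L^q`. It also covers functions of
norm zero. -/
theorem eLpNorm_map_le {S : SimpleFunc α E →ₗ[ℂ] Lp E 2 μ} {s M : ℝ} (hs : s ∈ Ioo (0 : ℝ) 1)
    (hM : 0 ≤ M) (hfin : ∀ g, eLpNorm (S g) (recipExp s) μ ≠ ⊤) (hb : FormBound μ (formOf S) s M)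
    (g : SimpleFunc α E) :
    eLpNorm (S g) (recipExp s) μ ≤ ENNReal.ofReal M * eLpNorm g (recipExp s) μ := by
  set N := (eLpNorm g (recipExp s) μ).toReal with hN
  have hgN : eLpNorm g (recipExp s) μ = ENNReal.ofReal N :=
    (ENNReal.ofReal_toReal (eLpNorm_simple_ne_top g _)).symm
  rw [hgN, ← ENNReal.ofReal_mul hM]
  have hN0 : 0 ≤ N := ENNReal.toReal_nonneg
  refine eLpNorm_le_of_forall_inner hs (hfin g) (by positivity) fun w hw => ?_
  refine le_of_forall_pos_le_add fun ε hε => ?_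
  set δ := N + ε / (M + 1) with hδdef
  have hδ : 0 < δ := by positivity
  have h1 : eLpNorm ((((δ⁻¹ : ℝ) : ℂ) • g : SimpleFunc α E)) (recipExp s) μ ≤ 1 := by
    rw [SimpleFunc.coe_smul]
    refine eLpNorm_smul_inv_le_one hδ ?_
    rw [hgN]
    exact ENNReal.ofReal_le_ofReal (by rw [hδdef]; linarith [show 0 < ε / (M + 1) by positivity])
  have h2 := hb w _ hw h1
  rw [formOf_apply, map_smul, inner_smul_right, norm_mul, Complex.norm_real, Real.norm_eq_abs,
    abs_of_pos (inv_pos.mpr hδ), inv_mul_le_iff₀ hδ] at h2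
  refine h2.trans ?_
  have : M * (ε / (M + 1)) ≤ ε := by
    rw [mul_div_assoc', div_le_iff₀ (by positivity)]
    nlinarith
  rw [hδdef]
  nlinarith

theorem exists_simple_unitBall_near {f : Lp E 2 μ} (hf : ‖f‖ ≤ 1) {ε : ℝ} (hε : 0 < ε) :
    ∃ g : SimpleFunc α E, ‖toL2 μ g‖ ≤ 1 ∧ ‖toL2 μ g - f‖ ≤ ε := by
  set η := min (ε / 2) 1
  have hη : 0 < η := by positivity
  have hη1 : η ≤ 1 := min_le_right _ _
  have hη2 : η ≤ ε / 2 := min_le_left _ _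
  set f1 : Lp E 2 μ := ((1 - η : ℝ) : ℂ) • f with hf1
  obtain ⟨g, hg, -⟩ := (Lp.memLp f1).exists_simpleFunc_eLpNorm_sub_lt (by simp)
    (ε := ENNReal.ofReal η) (by simpa using hη)
  have hg1 : ‖toL2 μ g - f1‖ ≤ η := by
    rw [Lp.norm_def]
    have h1 : (toL2 μ g - f1 : Lp E 2 μ) =ᵐ[μ] ⇑g - ⇑f1 := by
      filter_upwards [Lp.coeFn_sub (toL2 μ g) f1, coeFn_toL2 (μ := μ) g] with t h1 h2
      rw [h1, Pi.sub_apply, h2, Pi.sub_apply]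
    rw [eLpNorm_congr_ae h1, eLpNorm_sub_comm]
    exact ENNReal.toReal_le_of_le_ofReal hη.le hg.le
  have hn : ‖((1 - η : ℝ) : ℂ)‖ = 1 - η := by
    rw [Complex.norm_real, Real.norm_eq_abs, abs_of_nonneg (sub_nonneg.mpr hη1)]
  have hf1n : ‖f1‖ ≤ 1 - η := by
    rw [hf1, norm_smul, hn]
    exact mul_le_of_le_one_right (sub_nonneg.mpr hη1) hf
  refine ⟨g, ?_, ?_⟩
  · have := norm_le_norm_add_norm_sub' (toL2 μ g) f1
    linarith
  · have h2 : ‖f1 - f‖ ≤ η := by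
      have : f1 - f = ((-η : ℝ) : ℂ) • f := by
        rw [hf1, Complex.ofReal_sub, sub_smul, Complex.ofReal_one, one_smul, Complex.ofReal_neg,
          neg_smul]
        abel
      rw [this, norm_smul, Complex.norm_real, Real.norm_eq_abs, abs_neg, abs_of_pos hη]
      exact mul_le_of_le_one_right hη.le hf
    calc ‖toL2 μ g - f‖ = ‖(toL2 μ g - f1) + (f1 - f)‖ := by congr 1; abel
      _ ≤ η + η := (norm_add_le _ _).trans (add_le_add hg1 h2)
      _ ≤ ε := by linarith

end Duality

/-! ### Interpolation of forms and the quantitative Šneĭberg theorem -/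

section Sneiberg

variable {α E : Type*} [MeasurableSpace α] [NormedAddCommGroup E] [InnerProductSpace ℂ E]
  {μ : Measure α} [IsFiniteMeasure μ]

/-- On a finite measure space the norm at an intermediate exponent is finite if the norms at both
end points are. -/
theorem eLpNorm_interp_ne_top {f : α → E} (hf : AEStronglyMeasurable f μ) {s₀ s₁ τ : ℝ}
    (h0 : s₀ ∈ Ioo (0 : ℝ) 1) (h1 : s₁ ∈ Ioo (0 : ℝ) 1) (hτ : τ ∈ Icc (0 : ℝ) 1)
    (hf0 : eLpNorm f (recipExp s₀) μ ≠ ⊤) (hf1 : eLpNorm f (recipExp s₁) μ ≠ ⊤) :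
    eLpNorm f (recipExp (s₀ + (s₁ - s₀) * τ)) μ ≠ ⊤ := by
  have key : ∀ s s' : ℝ, 0 < s → s ≤ s' → eLpNorm f (recipExp s) μ ≠ ⊤ →
      eLpNorm f (recipExp s') μ ≠ ⊤ := by
    intro s s' hs hss h
    have hm : MemLp f (recipExp s) μ := ⟨hf, lt_top_iff_ne_top.mpr h⟩
    exact (hm.mono_exponent (ENNReal.ofReal_le_ofReal (inv_anti₀ hs hss))).2.ne
  rcases le_total s₀ s₁ with h | h
  · exact key s₀ _ h0.1 (by nlinarith [mul_nonneg (sub_nonneg.mpr h) hτ.1]) hf0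
  · refine key s₁ _ h1.1 ?_ hf1
    nlinarith [mul_nonneg (sub_nonneg.mpr h) (sub_nonneg.mpr hτ.2)]

/-- The Riesz-Thorin theorem for operators that are defined on simple functions. -/
theorem riesz_thorin {S : SimpleFunc α E →ₗ[ℂ] Lp E 2 μ} {s₀ s₁ τ M : ℝ}
    (h0 : s₀ ∈ Ioo (0 : ℝ) 1) (h1 : s₁ ∈ Ioo (0 : ℝ) 1) (hτ : τ ∈ Icc (0 : ℝ) 1) (hM : 0 ≤ M)
    (hS0 : ∀ g : SimpleFunc α E,
      eLpNorm (S g) (recipExp s₀) μ ≤ ENNReal.ofReal M * eLpNorm g (recipExp s₀) μ)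
    (hS1 : ∀ g : SimpleFunc α E,
      eLpNorm (S g) (recipExp s₁) μ ≤ ENNReal.ofReal M * eLpNorm g (recipExp s₁) μ)
    (g : SimpleFunc α E) :
    eLpNorm (S g) (recipExp (s₀ + (s₁ - s₀) * τ)) μ ≤
      ENNReal.ofReal M * eLpNorm g (recipExp (s₀ + (s₁ - s₀) * τ)) μ := by
  refine eLpNorm_map_le (affine_mem_Ioo h0 h1 hτ) hM (fun g => ?_)
    (FormBound.interpolate h0 h1 hτ (formBound_formOf h0 hM hS0) (formBound_formOf h1 hM hS1)) g
  exact eLpNorm_interp_ne_top (Lp.aestronglyMeasurable _) h0 h1 hτ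
    ((hS0 g).trans_lt (ENNReal.mul_lt_top ENNReal.ofReal_lt_top
      (eLpNorm_simple_ne_top g _).lt_top)).ne
    ((hS1 g).trans_lt (ENNReal.mul_lt_top ENNReal.ofReal_lt_top
      (eLpNorm_simple_ne_top g _).lt_top)).ne

/-- The hypotheses of the quantitative Šneĭberg theorem on the `L^p` scale. The operator `S` has
norm at most `β` for the reciprocal exponents `s₀` and `s₁`, and at the intermediate exponent `2`,
which belongs to the parameter `θ`, it is invertible, the inverse `Q` having norm at most `K`. -/
structure SneibergData (S : SimpleFunc α E →ₗ[ℂ] Lp E 2 μ) (Q : Lp E 2 μ →L[ℂ] Lp E 2 μ)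
    (s₀ s₁ θ β K : ℝ) : Prop where
  h0 : s₀ ∈ Ioo (0 : ℝ) 1
  h1 : s₁ ∈ Ioo (0 : ℝ) 1
  hθ : θ ∈ Ioo (0 : ℝ) 1
  hβ : 0 ≤ β
  hK : 0 < K
  half : s₀ + (s₁ - s₀) * θ = 1 / 2
  bound0 : ∀ g : SimpleFunc α E,
    eLpNorm (S g) (recipExp s₀) μ ≤ ENNReal.ofReal β * eLpNorm g (recipExp s₀) μ
  bound1 : ∀ g : SimpleFunc α E,
    eLpNorm (S g) (recipExp s₁) μ ≤ ENNReal.ofReal β * eLpNorm g (recipExp s₁) μ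
  leftInv : ∀ g, Q (S g) = toL2 μ g
  dense : DenseRange S
  norm_le : ‖Q‖ ≤ K

namespace SneibergData

variable {S : SimpleFunc α E →ₗ[ℂ] Lp E 2 μ} {Q : Lp E 2 μ →L[ℂ] Lp E 2 μ} {s₀ s₁ θ β K : ℝ}

theorem pairing_bound {s : ℝ} (hs : s ∈ Ioo (0 : ℝ) 1) :
    FormBound μ (formOf (toL2 μ : SimpleFunc α E →ₗ[ℂ] Lp E 2 μ)) s 1 :=
  formBound_formOf hs zero_le_one fun g => by simp [eLpNorm_toL2]

theorem map_ne_top (D : SneibergData S Q s₀ s₁ θ β K) {τ : ℝ} (hτ : τ ∈ Icc (0 : ℝ) 1)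
    (g : SimpleFunc α E) : eLpNorm (S g) (recipExp (s₀ + (s₁ - s₀) * τ)) μ ≠ ⊤ :=
  ((riesz_thorin D.h0 D.h1 hτ D.hβ D.bound0 D.bound1 g).trans_lt
    (ENNReal.mul_lt_top ENNReal.ofReal_lt_top (eLpNorm_simple_ne_top g _).lt_top)).ne

/-- The comparison, at `θ'`, of the form `K • S` along families through `w₁, g₁` with the pairing
along families through `w₂, g₂`, when the two agree at `θ` up to `δ`. -/
theorem compare (D : SneibergData S Q s₀ s₁ θ β K) {θ' : ℝ}
    (hθθ : |θ' - θ| < min θ (1 - θ)) {σ₁ τ₁ σ₂ τ₂ δ : ℝ} (hσ₁ : σ₁ ∈ Icc (0 : ℝ) 1)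
    (hτ₁ : τ₁ ∈ Icc (0 : ℝ) 1) (hσ₂ : σ₂ ∈ Icc (0 : ℝ) 1) (hτ₂ : τ₂ ∈ Icc (0 : ℝ) 1)
    {w₁ g₁ w₂ g₂ : SimpleFunc α E}
    (hw₁ : eLpNorm w₁ (recipExp (1 - (s₀ + (s₁ - s₀) * σ₁))) μ ≤ 1)
    (hg₁ : eLpNorm g₁ (recipExp (s₀ + (s₁ - s₀) * τ₁)) μ ≤ 1)
    (hw₂ : eLpNorm w₂ (recipExp (1 - (s₀ + (s₁ - s₀) * σ₂))) μ ≤ 1)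
    (hg₂ : eLpNorm g₂ (recipExp (s₀ + (s₁ - s₀) * τ₂)) μ ≤ 1)
    (hδ : ‖K * familyEval (formOf S) s₀ s₁ σ₁ τ₁ w₁ g₁ θ -
      familyEval (formOf (toL2 μ)) s₀ s₁ σ₂ τ₂ w₂ g₂ θ‖ ≤ δ) :
    ‖K * familyEval (formOf S) s₀ s₁ σ₁ τ₁ w₁ g₁ θ' -
      familyEval (formOf (toL2 μ)) s₀ s₁ σ₂ τ₂ w₂ g₂ θ'‖ ≤
        (1 + K * β) * (|θ' - θ| / min θ (1 - θ)) + 2 * δ := by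
  set F : ℂ → ℂ := fun z => K * familyEval (formOf S) s₀ s₁ σ₁ τ₁ w₁ g₁ z +
    (-1) * familyEval (formOf (toL2 μ)) s₀ s₁ σ₂ τ₂ w₂ g₂ z with hF
  have hFs : BddStrip F := ((BddStrip.const _).mul (bddStrip_familyEval _ _ _ _ _ _ _)).add
    ((BddStrip.const _).mul (bddStrip_familyEval _ _ _ _ _ _ _))
  have hFe : ∀ z, F z = K * familyEval (formOf S) s₀ s₁ σ₁ τ₁ w₁ g₁ z -
      familyEval (formOf (toL2 μ)) s₀ s₁ σ₂ τ₂ w₂ g₂ z := fun z => by rw [hF]; ring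
  have edge : ∀ ρ ∈ Icc (0 : ℝ) 1, FormBound μ (formOf S) (s₀ + (s₁ - s₀) * ρ) β →
      ∀ z : ℂ, z.re = ρ → ‖F z‖ ≤ 1 + K * β := by
    intro ρ hρ hb z hz
    rw [hFe]
    refine (norm_sub_le _ _).trans ?_
    rw [norm_mul, Complex.norm_real, Real.norm_eq_abs, abs_of_pos D.hK, add_comm]
    have := familyEval_le D.h0 D.h1 hσ₁ hτ₁ hρ hb hw₁ hg₁ hz
    have := familyEval_le D.h0 D.h1 hσ₂ hτ₂ hρ
      (pairing_bound (affine_mem_Ioo D.h0 D.h1 hρ)) hw₂ hg₂ hz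
    have := D.hK
    gcongr
  have key := hFs.norm_le_schwarz (M := 1 + K * β)
    (edge 0 (by simp) (by simpa using formBound_formOf D.h0 D.hβ D.bound0))
    (edge 1 (by simp) (by simpa using formBound_formOf D.h1 D.hβ D.bound1)) hθθ
  rw [← hFe] at hδ
  rw [← hFe]
  refine key.trans ?_
  have hm : 0 < min θ (1 - θ) := (abs_nonneg _).trans_lt hθθ
  have ht1 : |θ' - θ| / min θ (1 - θ) ≤ 1 := (div_le_one hm).mpr hθθ.le
  have ht0 : 0 ≤ |θ' - θ| / min θ (1 - θ) := by positivity
  nlinarith [norm_nonneg (F θ)]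

theorem norm_inner_toL2_le {w : SimpleFunc α E} {f : Lp E 2 μ} {δ : ℝ}
    (hw : eLpNorm w (recipExp (1 / 2)) μ ≤ 1) (hf : ‖f‖ ≤ δ) :
    ‖(inner ℂ (toL2 μ w) f : ℂ)‖ ≤ δ :=
  (norm_inner_le_norm _ _).trans <|
    (mul_le_of_le_one_left (norm_nonneg _) (norm_toL2_le_one hw)).trans hf

/-- The family through `x` is tested at `θ` with `(Q† w) / K`, where `w` is the value at `θ` of
the family through a functional that norms `x` at `θ'`. -/
theorem exists_test_functional [CompleteSpace E] (D : SneibergData S Q s₀ s₁ θ β K) {θ' : ℝ}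
    (hθ' : θ' ∈ Icc (0 : ℝ) 1)
    (hθθ : |θ' - θ| < min θ (1 - θ)) {x w : SimpleFunc α E}
    (hx : eLpNorm x (recipExp (s₀ + (s₁ - s₀) * θ')) μ ≤ 1)
    (hw : eLpNorm w (recipExp (1 - (s₀ + (s₁ - s₀) * θ'))) μ ≤ 1) {δ : ℝ} (hδ : 0 < δ) :
    ∃ v : SimpleFunc α E, eLpNorm v (recipExp (1 - (s₀ + (s₁ - s₀) * θ'))) μ ≤ 1 ∧
      ‖K * (inner ℂ (toL2 μ v) (S x) : ℂ) - inner ℂ (toL2 μ w) (toL2 μ x)‖ ≤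
        (1 + K * β) * (|θ' - θ| / min θ (1 - θ)) + 2 * δ := by
  have hθI : θ ∈ Icc (0 : ℝ) 1 := ⟨D.hθ.1.le, D.hθ.2.le⟩
  have hs := affine_mem_Ioo D.h0 D.h1 hθ'
  have hhalf : (1 : ℝ) - 1 / 2 = 1 / 2 := by norm_num
  have hK := D.hK
  set xθ := powFam x ((s₀ + (s₁ - s₀) * θ) / (s₀ + (s₁ - s₀) * θ' : ℝ)) with hxθ
  set wθ := powFam w ((1 - (s₀ + (s₁ - s₀) * θ)) / (1 - (s₀ + (s₁ - s₀) * θ') : ℝ)) with hwθ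
  have hwθ1 : ‖toL2 μ wθ‖ ≤ 1 := by
    refine norm_toL2_le_one (eLpNorm_powFam_le_one w (sub_pos.mpr hs.2) (by norm_num) hw ?_)
    rw [Complex.div_ofReal_re, ← hhalf, ← D.half]
    simp
  set f : Lp E 2 μ := ((K⁻¹ : ℝ) : ℂ) • ContinuousLinearMap.adjoint Q (toL2 μ wθ) with hf
  have hf1 : ‖f‖ ≤ 1 := by
    rw [hf, norm_smul, Complex.norm_real, Real.norm_eq_abs, abs_of_pos (inv_pos.mpr hK),
      inv_mul_le_iff₀ hK, mul_one]
    refine (ContinuousLinearMap.le_opNorm _ _).trans ?_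
    rw [LinearIsometryEquiv.norm_map]
    exact (mul_le_mul D.norm_le hwθ1 (norm_nonneg _) hK.le).trans (mul_one K).le
  set η := δ / (K * (‖S xθ‖ + 1)) with hη
  have hηpos : 0 < η := by positivity
  obtain ⟨v0, hv0, hv0f⟩ := exists_simple_unitBall_near hf1 hηpos
  have hv0' := eLpNorm_le_one_of_norm_toL2 hv0
  have hv0'' : eLpNorm v0 (recipExp (1 - (s₀ + (s₁ - s₀) * θ))) μ ≤ 1 := by
    rwa [D.half, hhalf]
  refine ⟨powFam v0 ((1 - (s₀ + (s₁ - s₀) * θ')) / (1 - (s₀ + (s₁ - s₀) * θ) : ℝ)),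
    eLpNorm_powFam_le_one v0 (by rw [D.half]; norm_num) (sub_pos.mpr hs.2) hv0''
      (by rw [Complex.div_ofReal_re]; simp), ?_⟩
  have key := D.compare hθθ (δ := δ) hθI hθ' hθ' hθ' hv0'' hx hw hx ?_
  · rw [familyEval_right D.h0 D.h1 hθ', familyEval_right D.h0 D.h1 hθ'] at key
    have h' : ((1 - (s₀ + (s₁ - s₀) * θ')) / (1 - (s₀ + (s₁ - s₀) * θ') : ℝ) : ℂ) = 1 := by
      rw [div_eq_one_iff_eq (Complex.ofReal_ne_zero.mpr (sub_pos.mpr hs.2).ne')]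
      push_cast; ring
    rw [h', powFam_one] at key
    exact key
  · rw [familyEval_left D.h0 D.h1 hθI]
    have e2 : familyEval (formOf (toL2 μ)) s₀ s₁ θ' θ' w x θ =
        inner ℂ (toL2 μ wθ) (toL2 μ xθ) := by
      rw [familyEval, Complex.conj_ofReal, formOf_apply]
    rw [e2, formOf_apply, ← D.leftInv xθ, ← ContinuousLinearMap.adjoint_inner_left]
    have e3 : ContinuousLinearMap.adjoint Q (toL2 μ wθ) = (K : ℂ) • f := by
      rw [hf, smul_smul, ← Complex.ofReal_mul, mul_inv_cancel₀ hK.ne', Complex.ofReal_one, one_smul]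
    rw [e3, inner_smul_left, Complex.conj_ofReal, ← mul_sub, ← inner_sub_left, norm_mul,
      Complex.norm_real, Real.norm_eq_abs, abs_of_pos hK]
    calc K * ‖(inner ℂ (toL2 μ v0 - f) (S xθ) : ℂ)‖ ≤ K * (η * (‖S xθ‖ + 1)) := by
          gcongr
          refine (norm_inner_le_norm _ _).trans ?_
          gcongr
          linarith
      _ = δ := by rw [hη]; field_simp

/-- The family through `y` is inverted at `θ`; the family through the result is evaluated at
`θ'`. -/
theorem exists_near_preimage_unitBall (D : SneibergData S Q s₀ s₁ θ β K) {θ' : ℝ}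
    (hθ' : θ' ∈ Icc (0 : ℝ) 1)
    (hθθ : |θ' - θ| < min θ (1 - θ)) {y : SimpleFunc α E}
    (hy : eLpNorm y (recipExp (s₀ + (s₁ - s₀) * θ')) μ ≤ 1) {δ : ℝ} (hδ : 0 < δ) :
    ∃ x : SimpleFunc α E, ∀ w : SimpleFunc α E,
      eLpNorm w (recipExp (1 - (s₀ + (s₁ - s₀) * θ'))) μ ≤ 1 →
      ‖(inner ℂ (toL2 μ w) (S x - toL2 μ y) : ℂ)‖ ≤
        (1 + K * β) * (|θ' - θ| / min θ (1 - θ)) + 2 * δ := by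
  have hθI : θ ∈ Icc (0 : ℝ) 1 := ⟨D.hθ.1.le, D.hθ.2.le⟩
  have hs := affine_mem_Ioo D.h0 D.h1 hθ'
  have hhalf : (1 : ℝ) - 1 / 2 = 1 / 2 := by norm_num
  have hK := D.hK
  set yθ := powFam y ((s₀ + (s₁ - s₀) * θ) / (s₀ + (s₁ - s₀) * θ' : ℝ)) with hyθ
  have hyθ1 : ‖toL2 μ yθ‖ ≤ 1 := by
    refine norm_toL2_le_one (eLpNorm_powFam_le_one y hs.1 (by norm_num) hy ?_)
    rw [Complex.div_ofReal_re, ← D.half]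
    simp
  obtain ⟨x0, hx0, hx0y⟩ : ∃ x0 : SimpleFunc α E, ‖toL2 μ x0‖ ≤ 1 ∧
      ‖(K : ℂ) • S x0 - toL2 μ yθ‖ ≤ δ := by
    obtain ⟨y1, hy1, hy1y⟩ := exists_simple_unitBall_near hyθ1 (half_pos hδ)
    set η := min (δ / 4) 1
    have hη : 0 < η := by positivity
    have hη1 : η ≤ 1 := min_le_right _ _
    have hη4 : η ≤ δ / 4 := min_le_left _ _
    have hn : ‖((1 - η : ℝ) : ℂ)‖ = 1 - η := by
      rw [Complex.norm_real, Real.norm_eq_abs, abs_of_nonneg (sub_nonneg.mpr hη1)]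
    obtain ⟨x', hx'⟩ := Metric.denseRange_iff.mp D.dense (((1 - η : ℝ) : ℂ) • toL2 μ yθ) η hη
    rw [dist_comm, dist_eq_norm] at hx'
    have hSx' : ‖S x'‖ ≤ 1 := by
      have h1 : ‖((1 - η : ℝ) : ℂ) • toL2 μ yθ‖ ≤ 1 - η := by
        rw [norm_smul, hn]
        exact mul_le_of_le_one_right (sub_nonneg.mpr hη1) hyθ1
      have := norm_le_norm_add_norm_sub' (S x') (((1 - η : ℝ) : ℂ) • toL2 μ yθ)
      linarith
    refine ⟨((K⁻¹ : ℝ) : ℂ) • x', ?_, ?_⟩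
    · rw [map_smul, norm_smul, Complex.norm_real, Real.norm_eq_abs, abs_of_pos (inv_pos.mpr hK),
        inv_mul_le_iff₀ hK, mul_one, ← D.leftInv]
      refine (Q.le_opNorm _).trans ?_
      exact (mul_le_mul D.norm_le hSx' (norm_nonneg _) hK.le).trans (mul_one K).le
    · rw [map_smul, smul_smul, ← Complex.ofReal_mul, mul_inv_cancel₀ hK.ne', Complex.ofReal_one,
        one_smul]
      have e : S x' - toL2 μ yθ = (S x' - ((1 - η : ℝ) : ℂ) • toL2 μ yθ) +
          ((-η : ℝ) : ℂ) • toL2 μ yθ := by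
        rw [Complex.ofReal_sub, sub_smul, Complex.ofReal_one, one_smul, Complex.ofReal_neg,
          neg_smul]
        abel
      rw [e]
      refine (norm_add_le _ _).trans ?_
      have h2 : ‖((-η : ℝ) : ℂ) • toL2 μ yθ‖ ≤ η := by
        rw [norm_smul, Complex.norm_real, Real.norm_eq_abs, abs_neg, abs_of_pos hη]
        exact mul_le_of_le_one_right hη.le hyθ1
      linarith
  have hx0' : eLpNorm x0 (recipExp (s₀ + (s₁ - s₀) * θ)) μ ≤ 1 := by
    rw [D.half]; exact eLpNorm_le_one_of_norm_toL2 hx0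
  refine ⟨(K : ℂ) • powFam x0 ((s₀ + (s₁ - s₀) * θ') / (s₀ + (s₁ - s₀) * θ : ℝ)),
    fun w hw => ?_⟩
  rw [map_smul, inner_sub_right, inner_smul_right]
  have key := D.compare hθθ (δ := δ) hθ' hθI hθ' hθ' hw hx0' hw hy ?_
  · rw [familyEval_left D.h0 D.h1 hθ', familyEval_left D.h0 D.h1 hθ'] at key
    have h' : ((s₀ + (s₁ - s₀) * θ') / (s₀ + (s₁ - s₀) * θ' : ℝ) : ℂ) = 1 := by
      rw [div_eq_one_iff_eq (Complex.ofReal_ne_zero.mpr hs.1.ne')]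
      push_cast; ring
    rw [h', powFam_one] at key
    exact key
  · rw [familyEval_right D.h0 D.h1 hθI]
    have e2 : familyEval (formOf (toL2 μ)) s₀ s₁ θ' θ' w y θ =
        inner ℂ (toL2 μ (powFam w ((1 - (s₀ + (s₁ - s₀) * θ)) /
          (1 - (s₀ + (s₁ - s₀) * θ') : ℝ)))) (toL2 μ yθ) := by
      rw [familyEval, Complex.conj_ofReal, formOf_apply]
    rw [e2, formOf_apply, ← inner_smul_right, ← inner_sub_right]
    refine norm_inner_toL2_le ?_ hx0y
    refine eLpNorm_powFam_le_one w (sub_pos.mpr hs.2) (by norm_num) hw ?_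
    rw [Complex.div_ofReal_re, ← hhalf, ← D.half]
    simp

theorem eLpNorm_inv_norm_smul_le_one {x : SimpleFunc α E} {s : ℝ}
    (hN : 0 < (eLpNorm x (recipExp s) μ).toReal) :
    eLpNorm (((((eLpNorm x (recipExp s) μ).toReal⁻¹ : ℝ) : ℂ) • x : SimpleFunc α E))
      (recipExp s) μ ≤ 1 := by
  rw [SimpleFunc.coe_smul]
  refine eLpNorm_smul_inv_le_one hN ?_
  rw [ENNReal.ofReal_toReal (eLpNorm_simple_ne_top _ _)]

/-- The quantitative Šneĭberg theorem, lower bound: `S` stays injective, with closed range, near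
the exponent `2`. -/
theorem lower_bound [CompleteSpace E] (D : SneibergData S Q s₀ s₁ θ β K) {θ' : ℝ}
    (hθ' : θ' ∈ Icc (0 : ℝ) 1)
    (hθθ : |θ' - θ| < min θ (1 - θ)) (x : SimpleFunc α E) :
    ENNReal.ofReal (1 - (1 + K * β) * (|θ' - θ| / min θ (1 - θ))) *
      eLpNorm x (recipExp (s₀ + (s₁ - s₀) * θ')) μ ≤
      ENNReal.ofReal K * eLpNorm (S x) (recipExp (s₀ + (s₁ - s₀) * θ')) μ := by
  have hs := affine_mem_Ioo D.h0 D.h1 hθ'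
  have hK := D.hK
  set s := s₀ + (s₁ - s₀) * θ' with hsdef
  set q := (1 + K * β) * (|θ' - θ| / min θ (1 - θ)) with hq
  have hq0 : 0 ≤ q := by
    have := D.hβ
    have : 0 < min θ (1 - θ) := (abs_nonneg _).trans_lt hθθ
    positivity
  set N := (eLpNorm x (recipExp s) μ).toReal with hN
  set P := (eLpNorm (S x) (recipExp s) μ).toReal with hP
  have eN : eLpNorm x (recipExp s) μ = ENNReal.ofReal N :=
    (ENNReal.ofReal_toReal (eLpNorm_simple_ne_top _ _)).symm
  have eP : eLpNorm (S x) (recipExp s) μ = ENNReal.ofReal P :=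
    (ENNReal.ofReal_toReal (D.map_ne_top hθ' x)).symm
  have hN0 : 0 ≤ N := ENNReal.toReal_nonneg
  have hP0 : 0 ≤ P := ENNReal.toReal_nonneg
  rcases hN0.eq_or_lt with h | hNpos
  · rw [eN, ← h]; simp
  rw [eN, eP, ← ENNReal.ofReal_mul' hN0, ← ENNReal.ofReal_mul hK.le]
  refine ENNReal.ofReal_le_ofReal ?_
  set x1 : SimpleFunc α E := ((N⁻¹ : ℝ) : ℂ) • x with hx1
  have hx1n : eLpNorm x1 (recipExp s) μ ≤ 1 := eLpNorm_inv_norm_smul_le_one hNpos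
  have hx : x = (N : ℂ) • x1 := by
    rw [hx1, smul_smul, ← Complex.ofReal_mul, mul_inv_cancel₀ hNpos.ne', Complex.ofReal_one,
      one_smul]
  obtain ⟨w, hw, hwx⟩ := exists_norming (μ := μ) hs x
  have hSx1 : eLpNorm (S x1) (recipExp s) μ ≤ ENNReal.ofReal (N⁻¹ * P) := by
    rw [hx1, map_smul, eLpNorm_congr_ae (Lp.coeFn_smul _ _), eLpNorm_const_smul, ← ofReal_norm,
      Complex.norm_real, Real.norm_eq_abs, abs_of_pos (inv_pos.mpr hNpos), eP,
      ENNReal.ofReal_mul (inv_nonneg.mpr hN0)]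
  have hwx1 : N ≤ N * ‖(inner ℂ (toL2 μ w) (toL2 μ x1) : ℂ)‖ := by
    have e : ‖(inner ℂ (toL2 μ w) (toL2 μ x) : ℂ)‖ =
        N * ‖(inner ℂ (toL2 μ w) (toL2 μ x1) : ℂ)‖ := by
      rw [hx, map_smul, inner_smul_right, norm_mul, Complex.norm_real, Real.norm_eq_abs,
        abs_of_pos hNpos]
    rw [← e]; exact hwx
  have hone : 1 ≤ ‖(inner ℂ (toL2 μ w) (toL2 μ x1) : ℂ)‖ := by
    by_contra hlt
    push Not at hlt
    nlinarith
  have hfin : 1 ≤ q + K * (N⁻¹ * P) := by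
    refine le_of_forall_pos_le_add fun ε hε => ?_
    obtain ⟨v, hv, hvx⟩ := D.exists_test_functional hθ' hθθ hx1n hw (half_pos hε)
    have h1 : ‖(inner ℂ (toL2 μ v) (S x1) : ℂ)‖ ≤ N⁻¹ * P :=
      norm_inner_le_of_eLpNorm hs ((eLpNorm_toL2 v _).trans_le hv) hSx1 (by positivity)
    have h2 := norm_sub_norm_le (inner ℂ (toL2 μ w) (toL2 μ x1) : ℂ)
      (K * (inner ℂ (toL2 μ v) (S x1) : ℂ))
    rw [norm_sub_rev, norm_mul, Complex.norm_real, Real.norm_eq_abs, abs_of_pos hK] at h2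
    have h3 : K * ‖(inner ℂ (toL2 μ v) (S x1) : ℂ)‖ ≤ K * (N⁻¹ * P) := by gcongr
    linarith
  have h4 : K * (N⁻¹ * P) * N = K * P := by field_simp
  nlinarith

/-- The quantitative Šneĭberg theorem, density: near the exponent `2` the range of `S` comes
relatively close to each simple function. -/
theorem exists_near_preimage (D : SneibergData S Q s₀ s₁ θ β K) {θ' : ℝ}
    (hθ' : θ' ∈ Icc (0 : ℝ) 1)
    (hθθ : |θ' - θ| < min θ (1 - θ)) (y : SimpleFunc α E) {δ : ℝ} (hδ : 0 < δ) :
    ∃ x : SimpleFunc α E,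
      eLpNorm (S x - toL2 μ y : Lp E 2 μ) (recipExp (s₀ + (s₁ - s₀) * θ')) μ ≤
        ENNReal.ofReal ((1 + K * β) * (|θ' - θ| / min θ (1 - θ)) + δ) *
          eLpNorm y (recipExp (s₀ + (s₁ - s₀) * θ')) μ := by
  have hs := affine_mem_Ioo D.h0 D.h1 hθ'
  have hK := D.hK
  set s := s₀ + (s₁ - s₀) * θ' with hsdef
  set q := (1 + K * β) * (|θ' - θ| / min θ (1 - θ)) with hq
  have hq0 : 0 ≤ q := by
    have := D.hβ
    have : 0 < min θ (1 - θ) := (abs_nonneg _).trans_lt hθθ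
    positivity
  set N := (eLpNorm y (recipExp s) μ).toReal with hN
  have eN : eLpNorm y (recipExp s) μ = ENNReal.ofReal N :=
    (ENNReal.ofReal_toReal (eLpNorm_simple_ne_top _ _)).symm
  have hN0 : 0 ≤ N := ENNReal.toReal_nonneg
  rcases hN0.eq_or_lt with h | hNpos
  · refine ⟨0, ?_⟩
    rw [map_zero, zero_sub, eLpNorm_congr_ae (Lp.coeFn_neg _), eLpNorm_neg, eLpNorm_toL2, eN, ← h]
    simp
  obtain ⟨x, hx⟩ := D.exists_near_preimage_unitBall hθ' hθθ
    (eLpNorm_inv_norm_smul_le_one (x := y) hNpos) (half_pos hδ)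
  refine ⟨(N : ℂ) • x, ?_⟩
  have hyN : y = (N : ℂ) • ((((N⁻¹ : ℝ) : ℂ)) • y : SimpleFunc α E) := by
    rw [smul_smul, ← Complex.ofReal_mul, mul_inv_cancel₀ hNpos.ne', Complex.ofReal_one, one_smul]
  set y1 : SimpleFunc α E := (((N⁻¹ : ℝ) : ℂ)) • y with hy1
  have hfin : eLpNorm (S x - toL2 μ y1 : Lp E 2 μ) (recipExp s) μ ≠ ⊤ := by
    have h1 : MemLp (S x) (recipExp s) μ :=
      ⟨Lp.aestronglyMeasurable _, (D.map_ne_top hθ' x).lt_top⟩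
    have h2 : MemLp (toL2 μ y1) (recipExp s) μ :=
      ⟨Lp.aestronglyMeasurable _, by
        rw [eLpNorm_toL2]; exact (eLpNorm_simple_ne_top y1 _).lt_top⟩
    rw [eLpNorm_congr_ae (Lp.coeFn_sub _ _)]
    exact (h1.sub h2).2.ne
  have hle := eLpNorm_le_of_forall_inner hs hfin (M := q + δ) (by positivity) fun w hw => by
    have := hx w hw
    linarith
  rw [eN, hyN, map_smul, map_smul, ← smul_sub, eLpNorm_congr_ae (Lp.coeFn_smul _ _),
    eLpNorm_const_smul, ← ofReal_norm, Complex.norm_real, Real.norm_eq_abs, abs_of_pos hNpos,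
    mul_comm]
  gcongr

end SneibergData

end Sneiberg

/-! ### Measurable families of coercive operators -/

section OperatorFamilies

variable {α V : Type*} [MeasurableSpace α] [NormedAddCommGroup V] [InnerProductSpace ℂ V]
  [CompleteSpace V] {μ : Measure α}

/-- Pettis' theorem in a Hilbert space: a weakly measurable function with separable range is
strongly measurable. It is the limit of its projections to an increasing sequence of
finite-dimensional subspaces whose union is dense in the span of the range. -/
theorem aestronglyMeasurable_of_inner {f : α → V} {s : Set α} (hs : ∀ᵐ t ∂μ, t ∈ s)
    (hsep : TopologicalSpace.IsSeparable (f '' s))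
    (hf : ∀ φ : V, AEMeasurable (fun t => (inner ℂ φ (f t) : ℂ)) μ) :
    AEStronglyMeasurable f μ := by
  obtain ⟨c, hc, hfc⟩ := hsep
  rcases c.eq_empty_or_nonempty with rfl | hne
  · have : ∀ᵐ t ∂μ, False := hs.mono fun t ht => by
      simpa using hfc (mem_image_of_mem f ht)
    have h0 : μ = 0 := by simpa using this
    rw [h0]; exact aestronglyMeasurable_zero_measure f
  obtain ⟨d, hd⟩ := hc.exists_eq_range hne
  let U : ℕ → Submodule ℂ V := fun n => Submodule.span ℂ (d '' Iic n)
  have hUfin : ∀ n, FiniteDimensional ℂ (U n) := fun n =>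
    FiniteDimensional.span_of_finite ℂ ((finite_Iic n).image d)
  have hUmono : Monotone U := fun m n hmn => Submodule.span_mono (image_mono (Iic_subset_Iic.mpr hmn))
  have hcl : IsClosed ((⨆ n, U n).topologicalClosure : Set V) :=
    Submodule.isClosed_topologicalClosure _
  have : CompleteSpace (⨆ n, U n).topologicalClosure := hcl.completeSpace_coe
  refine aestronglyMeasurable_of_tendsto_ae Filter.atTop
    (f := fun n t => (U n).starProjection (f t)) (fun n => ?_) ?_
  · let b := stdOrthonormalBasis ℂ (U n)
    have h : (fun t => (U n).starProjection (f t)) =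
        fun t => ∑ i, (inner ℂ (b i : V) (f t) : ℂ) • (b i : V) := by
      funext t
      rw [b.starProjection_eq_sum_rankOne]
      simp
    rw [h]
    exact Finset.aestronglyMeasurable_fun_sum _ fun i _ =>
      (hf (b i)).aestronglyMeasurable.smul_const _
  · filter_upwards [hs] with t ht
    have h1 := Submodule.starProjection_tendsto_closure_iSup U hUmono (f t)
    have h2 : f t ∈ (⨆ n, U n).topologicalClosure := by
      have h3 : closure c ⊆ closure ((⨆ n, U n : Submodule ℂ V) : Set V) := by
        refine closure_mono ?_
        rw [hd]
        rintro _ ⟨n, rfl⟩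
        exact (le_iSup U n) (Submodule.subset_span (mem_image_of_mem d (mem_Iic.mpr le_rfl)))
      exact h3 (hfc (mem_image_of_mem f ht))
    rwa [Submodule.starProjection_eq_self_iff.mpr h2] at h1

/-- A strongly measurable family of operators is applied to strongly measurable functions with
strongly measurable result. -/
theorem aestronglyMeasurable_clm_apply {A : α → V →L[ℂ] V}
    (hA : ∀ ψ : V, AEStronglyMeasurable (fun t => A t ψ) μ) {u : α → V}
    (hu : AEStronglyMeasurable u μ) : AEStronglyMeasurable (fun t => A t (u t)) μ := by
  obtain ⟨u', hu', huu⟩ := hu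
  have h : AEStronglyMeasurable (fun t => A t (u' t)) μ := by
    refine aestronglyMeasurable_of_tendsto_ae Filter.atTop
      (f := fun n t => A t (hu'.approx n t)) (fun n => ?_)
      (Filter.Eventually.of_forall fun t => ((A t).continuous.tendsto _).comp (hu'.tendsto_approx t))
    have e : (fun t => A t (hu'.approx n t)) = fun t => ∑ v ∈ (hu'.approx n).range,
        ((hu'.approx n) ⁻¹' {v}).indicator (fun t => A t v) t := by
      classical
      funext t
      rw [Finset.sum_eq_single (hu'.approx n t)]
      · simp
      · intro v _ hv
        simp [Set.indicator, Ne.symm hv]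
      · intro hv
        exact absurd (SimpleFunc.mem_range_self _ t) hv
    rw [e]
    exact Finset.aestronglyMeasurable_fun_sum _ fun v _ =>
      (hA v).indicator (SimpleFunc.measurableSet_fiber _ _)
  refine h.congr ?_
  filter_upwards [huu] with t ht
  rw [ht]

/-- A family of operators, on a measure space, that is strongly measurable, uniformly bounded by
`C` and uniformly coercive with constant `c`. -/
structure CoerciveFamily (μ : Measure α) (A : α → V →L[ℂ] V) (c C : ℝ) : Prop where
  c_pos : 0 < c
  C_pos : 0 < C
  meas : ∀ ψ : V, AEStronglyMeasurable (fun t => A t ψ) μ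
  coer : ∀ᵐ t ∂μ, ∀ ψ : V, c * ‖ψ‖ ^ 2 ≤ (inner ℂ ψ (A t ψ) : ℂ).re
  bdd : ∀ᵐ t ∂μ, ∀ ψ : V, ‖A t ψ‖ ≤ C * ‖ψ‖

theorem CoerciveFamily.one : CoerciveFamily μ (fun _ => ContinuousLinearMap.id ℂ V) 1 1 where
  c_pos := one_pos
  C_pos := one_pos
  meas ψ := aestronglyMeasurable_const
  coer := Filter.Eventually.of_forall fun _ ψ => by
    rw [ContinuousLinearMap.id_apply, one_mul, ← inner_self_eq_norm_sq (𝕜 := ℂ)]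
    exact le_rfl
  bdd := Filter.Eventually.of_forall fun _ ψ => by simp

namespace CoerciveFamily

variable {A : α → V →L[ℂ] V} {c C : ℝ}

theorem eLpNorm_apply_le (hA : CoerciveFamily μ A c C) (u : α → V) (p : ℝ≥0∞) :
    eLpNorm (fun t => A t (u t)) p μ ≤ ENNReal.ofReal C * eLpNorm u p μ :=
  eLpNorm_le_mul_eLpNorm_of_ae_le_mul (hA.bdd.mono fun t ht => ht (u t)) p

theorem memLp_apply (hA : CoerciveFamily μ A c C) {u : α → V} {p : ℝ≥0∞} (hu : MemLp u p μ) :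
    MemLp (fun t => A t (u t)) p μ :=
  ⟨aestronglyMeasurable_clm_apply hA.meas hu.1, (hA.eLpNorm_apply_le u p).trans_lt
    (ENNReal.mul_lt_top ENNReal.ofReal_lt_top hu.2)⟩

variable {p : ℝ≥0∞} [Fact (1 ≤ p)]

/-- Multiplication with the family `A`, on `L^p`. -/
def mulOp (hA : CoerciveFamily μ A c C) : Lp V p μ →L[ℂ] Lp V p μ :=
  LinearMap.mkContinuous
    { toFun := fun u => (hA.memLp_apply (Lp.memLp u)).toLp _
      map_add' := fun u v => by
        rw [← MemLp.toLp_add]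
        refine MemLp.toLp_congr _ _ ?_
        filter_upwards [Lp.coeFn_add u v] with t ht
        rw [ht]; simp
      map_smul' := fun a u => by
        rw [RingHom.id_apply, ← MemLp.toLp_const_smul]
        refine MemLp.toLp_congr _ _ ?_
        filter_upwards [Lp.coeFn_smul a u] with t ht
        rw [ht]; simp } C
    fun u => by
      have h := ENNReal.toReal_mono
        (ENNReal.mul_ne_top ENNReal.ofReal_ne_top (Lp.eLpNorm_ne_top u))
        (hA.eLpNorm_apply_le u p)
      rw [ENNReal.toReal_mul, ENNReal.toReal_ofReal hA.C_pos.le] at h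
      rw [Lp.norm_def u]
      exact (Lp.norm_toLp _ (hA.memLp_apply (Lp.memLp u))).trans_le h

theorem coeFn_mulOp (hA : CoerciveFamily μ A c C) (u : Lp V p μ) :
    hA.mulOp u =ᵐ[μ] fun t => A t (u t) :=
  (hA.memLp_apply (Lp.memLp u)).coeFn_toLp

theorem norm_mulOp_le (hA : CoerciveFamily μ A c C) (u : Lp V p μ) : ‖hA.mulOp u‖ ≤ C * ‖u‖ :=
  (hA.mulOp.le_opNorm u).trans (mul_le_mul_of_nonneg_right
    (LinearMap.mkContinuous_norm_le _ hA.C_pos.le _) (norm_nonneg u))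

theorem re_inner_mulOp (hA : CoerciveFamily μ A c C) (u : Lp V 2 μ) :
    c * ‖u‖ ^ 2 ≤ (inner ℂ u (hA.mulOp u) : ℂ).re := by
  have h1 : ‖u‖ ^ 2 = ∫ t, ‖u t‖ ^ 2 ∂μ := by
    rw [← inner_self_eq_norm_sq (𝕜 := ℂ) u, L2.inner_def, ← integral_re (L2.integrable_inner (𝕜 := ℂ) u u)]
    exact integral_congr_ae (Filter.Eventually.of_forall fun t => inner_self_eq_norm_sq (𝕜 := ℂ) _)
  have h2 : (inner ℂ u (hA.mulOp u) : ℂ).re = ∫ t, (inner ℂ (u t) (hA.mulOp u t) : ℂ).re ∂μ := by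
    rw [L2.inner_def]
    exact (integral_re (L2.integrable_inner (𝕜 := ℂ) u (hA.mulOp u))).symm
  rw [h1, h2, ← integral_const_mul]
  refine integral_mono_ae ((Lp.memLp u).norm.integrable_sq.const_mul c)
    (L2.integrable_inner (𝕜 := ℂ) u (hA.mulOp u)).re ?_
  filter_upwards [hA.coer, hA.coeFn_mulOp u] with t ht htA
  rw [htA]
  exact ht (u t)

end CoerciveFamily

end OperatorFamilies

/-! ### Weak derivatives and primitives -/

section WeakDerivatives

variable {X : Type*} [NormedAddCommGroup X] [NormedSpace ℂ X] [CompleteSpace X] {T : ℝ}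

theorem intervalIntegrable_of_volJ {g : ℝ → X} (hg : Integrable g (volJ T)) {a b : ℝ}
    (ha : a ∈ Icc 0 T) (hb : b ∈ Icc 0 T) : IntervalIntegrable g volume a b := by
  have h : IntegrableOn g (Ioc 0 T) volume := by
    rw [IntegrableOn, ← restrict_Ioo_eq_restrict_Ioc]; exact hg
  rw [intervalIntegrable_iff]
  exact h.mono_set (Ioc_subset_Ioc (le_min ha.1 hb.1) (max_le ha.2 hb.2))

theorem continuousOn_primitive {g : ℝ → X} (hT : 0 < T) (hg : Integrable g (volJ T)) :
    ContinuousOn (fun t => ∫ s in 0..t, g s) (Icc 0 T) := by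
  have h : IntegrableOn g (uIcc 0 T) volume := by
    rw [uIcc_of_le hT.le, IntegrableOn, ← restrict_Ioo_eq_restrict_Icc]; exact hg
  simpa [uIcc_of_le hT.le] using intervalIntegral.continuousOn_primitive_interval h

theorem integrable_primitive {g : ℝ → X} (hT : 0 < T) (hg : Integrable g (volJ T)) :
    Integrable (fun t => ∫ s in 0..t, g s) (volJ T) :=
  ((continuousOn_primitive hT hg).integrableOn_Icc).mono_set Ioo_subset_Icc_self

theorem integrable_smul_of_continuous {g : ℝ → X} {φ : ℝ → ℝ} (hφ : Continuous φ)
    (hg : Integrable g (volJ T)) : Integrable (fun t => φ t • g t) (volJ T) := by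
  obtain ⟨C, hC⟩ := (isCompact_Icc (a := (0 : ℝ)) (b := T)).exists_bound_of_continuousOn
    hφ.continuousOn
  refine Integrable.bdd_smul (𝕜 := ℝ) (f := g) (φ := φ) hg C hφ.aestronglyMeasurable ?_
  filter_upwards [ae_restrict_mem measurableSet_Ioo] with t ht
  exact hC t (Ioo_subset_Icc_self ht)

/-- Integration by parts for a primitive of an integrable function. -/
theorem integral_deriv_smul_primitive {g : ℝ → X} (hg : Integrable g (volJ T))
    {φ ψ : ℝ → ℝ} (hφ : ∀ t, HasDerivAt φ (ψ t) t) (hψ : Continuous ψ) :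
    ∫ t in Ioo 0 T, ψ t • ∫ s in 0..t, g s =
      φ T • (∫ t in Ioo 0 T, g t) - ∫ t in Ioo 0 T, φ t • g t := by
  have hψi : Integrable ψ (volJ T) :=
    (hψ.integrableOn_Icc (a := 0) (b := T)).mono_set Ioo_subset_Icc_self
  have hφc : Continuous φ := continuous_iff_continuousAt.mpr fun t => (hφ t).continuousAt
  have hint := (hψi.smul_prod hg).indicator
    (measurableSet_le (measurable_snd (α := ℝ) (β := ℝ)) measurable_fst)
  have hswap := integral_integral_swap (μ := volJ T) (ν := volJ T)
    (f := fun t s => {p : ℝ × ℝ | p.2 ≤ p.1}.indicator (fun z => ψ z.1 • g z.2) (t, s)) hint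
  have hL : ∀ t ∈ Ioo 0 T, ∫ s in Ioo 0 T,
      {p : ℝ × ℝ | p.2 ≤ p.1}.indicator (fun z => ψ z.1 • g z.2) (t, s) =
      ψ t • ∫ s in 0..t, g s := by
    intro t ht
    have e : (fun s => {p : ℝ × ℝ | p.2 ≤ p.1}.indicator (fun z => ψ z.1 • g z.2) (t, s)) =
        (Iic t).indicator (fun s => ψ t • g s) := by
      funext s; simp [Set.indicator]
    rw [e, setIntegral_indicator measurableSet_Iic, integral_smul,
      intervalIntegral.integral_of_le ht.1.le]
    congr 3
    ext s
    simp only [mem_inter_iff, mem_Ioo, mem_Iic, mem_Ioc]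
    exact ⟨fun h => ⟨h.1.1, h.2⟩, fun h => ⟨⟨h.1, h.2.trans_lt ht.2⟩, h.2⟩⟩
  have hR : ∀ s ∈ Ioo 0 T, ∫ t in Ioo 0 T,
      {p : ℝ × ℝ | p.2 ≤ p.1}.indicator (fun z => ψ z.1 • g z.2) (t, s) =
      φ T • g s - φ s • g s := by
    intro s hs
    have e : (fun t => {p : ℝ × ℝ | p.2 ≤ p.1}.indicator (fun z => ψ z.1 • g z.2) (t, s)) =
        (Ici s).indicator (fun t => ψ t • g s) := by
      funext t; simp [Set.indicator]
    have hset : Ioo 0 T ∩ Ici s = Ico s T := by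
      ext t
      simp only [mem_inter_iff, mem_Ioo, mem_Ici, mem_Ico]
      exact ⟨fun h => ⟨h.2, h.1.2⟩, fun h => ⟨⟨hs.1.trans_le h.1, h.2⟩, h.1⟩⟩
    rw [e, setIntegral_indicator measurableSet_Ici, integral_smul_const, hset,
      integral_Ico_eq_integral_Ioc, ← intervalIntegral.integral_of_le hs.2.le,
      intervalIntegral.integral_eq_sub_of_hasDerivAt (fun t _ => hφ t)
        (hψ.intervalIntegrable _ _), sub_smul]
  rw [setIntegral_congr_fun measurableSet_Ioo hL, setIntegral_congr_fun measurableSet_Ioo hR]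
    at hswap
  rw [hswap, integral_sub (show Integrable (fun t => φ T • g t) (volJ T) from hg.smul (φ T))
    (integrable_smul_of_continuous hφc hg), integral_smul]

theorem eq_zero_of_tsupport_subset {φ : ℝ → ℝ} (h : tsupport φ ⊆ Ioo 0 T) : φ T = 0 := by
  by_contra hne
  exact lt_irrefl _ (h (subset_tsupport _ (Function.mem_support.mpr hne))).2

theorem contDiff_primitive {ψ : ℝ → ℝ} (hψ : ContDiff ℝ ∞ ψ) (a : ℝ) :
    ContDiff ℝ ∞ (fun t => ∫ s in a..t, ψ s) := by
  refine contDiff_infty_iff_deriv.mpr ⟨fun t =>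
    (hψ.continuous.integral_hasStrictDerivAt a t).hasDerivAt.differentiableAt, ?_⟩
  rwa [show deriv (fun t => ∫ s in a..t, ψ s) = ψ from
    funext fun t => hψ.continuous.deriv_integral _ _ _]

/-- The lemma of du Bois-Reymond. -/
theorem ae_const_of_integral_deriv_smul_eq_zero (hT : 0 < T) {w : ℝ → X}
    (hw : Integrable w (volJ T))
    (h : ∀ φ : ℝ → ℝ, ContDiff ℝ ∞ φ → HasCompactSupport φ → tsupport φ ⊆ Ioo 0 T →
      ∫ t in Ioo 0 T, deriv φ t • w t = 0) :
    ∃ x : X, ∀ᵐ t ∂(volJ T), w t = x := by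
  let b : ContDiffBump (T / 2) := ⟨T / 8, T / 4, by positivity, by linarith⟩
  set η := b.normed volume with hη
  have hηsm : ContDiff ℝ ∞ η := b.contDiff_normed
  have hηsupp : tsupport η ⊆ Ioo 0 T := by
    rw [hη, b.tsupport_normed_eq, Real.closedBall_eq_Icc]
    intro t ht
    have h1 : T / 2 - T / 4 ≤ t := ht.1
    have h2 : t ≤ T / 2 + T / 4 := ht.2
    constructor <;> linarith
  have hηc : HasCompactSupport η := b.hasCompactSupport_normed
  have hηint : ∫ t, η t = 1 := b.integral_normed
  refine ⟨∫ t in Ioo 0 T, η t • w t, ?_⟩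
  set x := ∫ t in Ioo 0 T, η t • w t with hx
  have key := isOpen_Ioo.ae_eq_zero_of_integral_contDiff_smul_eq_zero (μ := volume)
    (U := Ioo 0 T) (f := fun t => w t - x) (hf := ?_) ?_
  · rw [ae_restrict_iff' measurableSet_Ioo]
    filter_upwards [key] with t ht hmem
    exact sub_eq_zero.mp (ht hmem)
  · have : IntegrableOn (fun t => w t - x) (Ioo 0 T) := hw.sub (integrable_const x)
    exact this.locallyIntegrableOn
  · intro ψ hψ hψc hψs
    set m := ∫ t, ψ t with hm
    set ρ : ℝ → ℝ := fun t => ψ t - m * η t with hρ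
    have hρsm : ContDiff ℝ ∞ ρ := hψ.sub (contDiff_const.mul hηsm)
    have hψi : Integrable ψ := hψ.continuous.integrable_of_hasCompactSupport hψc
    have hηi : Integrable η := hηsm.continuous.integrable_of_hasCompactSupport hηc
    have hρint : ∫ t, ρ t = 0 := by
      rw [hρ, integral_sub hψi (hηi.const_mul m), integral_const_mul, hηint, ← hm]; ring
    set φ : ℝ → ℝ := fun t => ∫ s in 0..t, ρ s with hφ
    have hK : IsCompact (tsupport ψ ∪ tsupport η) := hψc.isCompact.union hηc.isCompact
    have hKne : (tsupport ψ ∪ tsupport η).Nonempty := by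
      rw [hη, b.tsupport_normed_eq]
      exact ⟨T / 2, Or.inr (Metric.mem_closedBall_self b.rOut_pos.le)⟩
    have hKs : tsupport ψ ∪ tsupport η ⊆ Ioo 0 T := union_subset hψs hηsupp
    obtain ⟨a, haK, ha⟩ := hK.exists_isLeast hKne
    obtain ⟨d, hdK, hd⟩ := hK.exists_isGreatest hKne
    have hρ0 : ∀ t, t ∉ Icc a d → ρ t = 0 := by
      intro t ht
      have h1 : t ∉ tsupport ψ ∪ tsupport η := fun h1 => ht ⟨ha h1, hd h1⟩
      rw [mem_union, not_or] at h1
      simp [hρ, image_eq_zero_of_notMem_tsupport h1.1, image_eq_zero_of_notMem_tsupport h1.2]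
    have ha0 := (hKs haK).1
    have hdT := (hKs hdK).2
    have hφsupp : Function.support φ ⊆ Icc a d := by
      intro t ht
      by_contra hnot
      apply ht
      rcases not_and_or.mp hnot with hlt | hgt
      · push Not at hlt
        refine intervalIntegral.integral_zero_ae (Filter.Eventually.of_forall fun s hs => ?_)
        refine hρ0 s fun hsI => ?_
        have h3 : s ≤ max 0 t := (mem_uIoc.mp hs).elim (fun h => h.2.trans (le_max_right _ _))
          (fun h => h.2.trans (le_max_left _ _))
        exact absurd (hsI.1.trans h3) (not_le.mpr (max_lt ha0 hlt))
      · push Not at hgt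
        have hd0 : 0 < d := (hKs hdK).1
        have h0t : 0 ≤ t := (hd0.trans hgt).le
        rw [hφ]
        simp only
        rw [intervalIntegral.integral_of_le h0t, setIntegral_eq_integral_of_forall_compl_eq_zero,
          hρint]
        intro s hs
        refine hρ0 s fun hsI => hs ⟨ha0.trans_le hsI.1, hsI.2.trans hgt.le⟩
    have hφts : tsupport φ ⊆ Icc a d := closure_minimal hφsupp isClosed_Icc
    have hder : deriv φ = ρ := by
      funext t
      exact hρsm.continuous.deriv_integral _ _ _
    have h0 := h φ (contDiff_primitive hρsm 0)
      (HasCompactSupport.of_support_subset_isCompact isCompact_Icc hφsupp)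
      (hφts.trans (Icc_subset_Ioo ha0 hdT))
    rw [hder] at h0
    have hsplit : ∫ t in Ioo 0 T, ρ t • w t = (∫ t in Ioo 0 T, ψ t • w t) - m • x := by
      rw [hx, ← integral_smul, ← integral_sub (integrable_smul_of_continuous hψ.continuous hw)
        (show Integrable (fun t => m • η t • w t) (volJ T) from
          (integrable_smul_of_continuous hηsm.continuous hw).smul m)]
      refine integral_congr_ae (Filter.Eventually.of_forall fun t => ?_)
      simp only [hρ, sub_smul, mul_smul]
    have hψJ : ∀ t, t ∉ Ioo 0 T → ψ t = 0 := fun t ht =>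
      image_eq_zero_of_notMem_tsupport fun h1 => ht (hψs h1)
    have hout : ∫ t, ψ t • (w t - x) = ∫ t in Ioo 0 T, ψ t • (w t - x) :=
      (setIntegral_eq_integral_of_forall_compl_eq_zero fun t ht => by
        rw [hψJ t ht, zero_smul]).symm
    have hmJ : ∫ t in Ioo 0 T, ψ t = m := setIntegral_eq_integral_of_forall_compl_eq_zero hψJ
    rw [hout]
    have : ∫ t in Ioo 0 T, ψ t • (w t - x) = (∫ t in Ioo 0 T, ψ t • w t) - m • x := by
      simp only [smul_sub]
      rw [integral_sub (integrable_smul_of_continuous hψ.continuous hw)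
        (integrable_smul_of_continuous hψ.continuous (integrable_const x)), integral_smul_const,
        hmJ]
    rw [this, ← hsplit, h0]

/-- A function has weak derivative `g` and initial value `0` if and only if it is the primitive of
`g` that vanishes at `0`. -/
theorem hasWeakDeriv_initialZero_iff (hT : 0 < T) {u g : ℝ → X} (hu : Integrable u (volJ T))
    (hg : Integrable g (volJ T)) :
    (HasWeakDeriv T u g ∧ InitialZero T u) ↔ ∀ᵐ t ∂(volJ T), u t = ∫ s in 0..t, g s := by
  constructor
  · rintro ⟨hw, v, hv, huv, hv0⟩
    have hGi := integrable_primitive hT hg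
    obtain ⟨x, hx⟩ := ae_const_of_integral_deriv_smul_eq_zero hT (hu.sub hGi)
      fun φ hφ hφc hφs => by
        have hdφ : ∀ t, HasDerivAt φ (deriv φ t) t := fun t =>
          (hφ.differentiable (by simp) t).hasDerivAt
        have hcont : Continuous (deriv φ) := hφ.continuous_deriv (by simp)
        simp only [Pi.sub_apply, smul_sub]
        rw [integral_sub (integrable_smul_of_continuous hcont hu)
          (integrable_smul_of_continuous hcont hGi), hw φ hφ hφc hφs,
          integral_deriv_smul_primitive hg hdφ hcont, eq_zero_of_tsupport_subset hφs]
        simp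
    have hae : v =ᵐ[volume.restrict (Icc 0 T)] fun t => (∫ s in 0..t, g s) + x := by
      rw [← restrict_Ioo_eq_restrict_Icc]
      filter_upwards [hx, huv] with t h1 h2
      rw [← h1, ← h2]; simp
    have heq := Measure.eqOn_Icc_of_ae_eq volume hT.ne hae hv
      ((continuousOn_primitive hT hg).add continuousOn_const)
    have hx0 : x = 0 := by
      have := heq (left_mem_Icc.mpr hT.le)
      simpa [hv0] using this.symm
    filter_upwards [hx] with t ht
    rw [hx0] at ht
    exact sub_eq_zero.mp ht
  · intro h
    refine ⟨fun φ hφ hφc hφs => ?_, fun t => ∫ s in 0..t, g s, continuousOn_primitive hT hg, h,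
      by simp⟩
    have hdφ : ∀ t, HasDerivAt φ (deriv φ t) t := fun t =>
      (hφ.differentiable (by simp) t).hasDerivAt
    have hcont : Continuous (deriv φ) := hφ.continuous_deriv (by simp)
    have e : ∫ t in Ioo 0 T, deriv φ t • u t = ∫ t in Ioo 0 T, deriv φ t • ∫ s in 0..t, g s := by
      refine integral_congr_ae ?_
      filter_upwards [h] with t ht
      rw [ht]
    rw [e, integral_deriv_smul_primitive hg hdφ hcont, eq_zero_of_tsupport_subset hφs]
    simp

end WeakDerivatives

/-! ### Trajectories and accretivity of the time derivative -/

section Trajectories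

variable {V H : Type*} [NormedAddCommGroup V] [InnerProductSpace ℂ V] [CompleteSpace V]
  [NormedAddCommGroup H] [InnerProductSpace ℂ H] {T : ℝ} {N : V →L[ℂ] V}

/-- The evolution `(N u)' = v`, `(N u)(0) = 0`, in integrated form. Here `N` stands for the
embedding of `V` in `V^*`, followed by the Riesz isomorphism of `V^*` with `V`. -/
def Traj (T : ℝ) (N : V →L[ℂ] V) (u v : ℝ → V) : Prop :=
  ∀ᵐ t ∂(volJ T), N (u t) = ∫ s in 0..t, v s

theorem intervalIntegral_congr_volJ {v v' : ℝ → V} (h : v =ᵐ[volJ T] v') {t : ℝ}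
    (ht : t ∈ Ioo 0 T) : ∫ s in 0..t, v s = ∫ s in 0..t, v' s := by
  rw [intervalIntegral.integral_of_le ht.1.le, intervalIntegral.integral_of_le ht.1.le]
  refine integral_congr_ae (ae_restrict_of_ae_restrict_of_subset (s := Ioc 0 t) (t := Ioo 0 T)
    (fun s hs => ⟨hs.1, hs.2.trans_lt ht.2⟩) h)

theorem Traj.congr {u v u' v' : ℝ → V} (h : Traj T N u v) (hu : u =ᵐ[volJ T] u')
    (hv : v =ᵐ[volJ T] v') : Traj T N u' v' := by
  filter_upwards [h, hu, ae_restrict_mem measurableSet_Ioo] with t h1 h2 ht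
  rw [← h2, h1, intervalIntegral_congr_volJ hv ht]

theorem Traj.add {u v u' v' : ℝ → V} (h : Traj T N u v) (h' : Traj T N u' v')
    (hv : Integrable v (volJ T)) (hv' : Integrable v' (volJ T)) :
    Traj T N (u + u') (v + v') := by
  filter_upwards [h, h', ae_restrict_mem measurableSet_Ioo] with t h1 h2 ht
  have hI : ∀ g : ℝ → V, Integrable g (volJ T) → IntervalIntegrable g volume 0 t := fun g hg =>
    intervalIntegrable_of_volJ hg ⟨le_rfl, (ht.1.trans ht.2).le⟩ (Ioo_subset_Icc_self ht)
  simp only [Pi.add_apply, map_add, h1, h2]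
  exact (intervalIntegral.integral_add (hI v hv) (hI v' hv')).symm

theorem Traj.smul {u v : ℝ → V} (h : Traj T N u v) (a : ℂ) : Traj T N (a • u) (a • v) := by
  filter_upwards [h] with t h1
  simp only [Pi.smul_apply, map_smul, h1]
  exact (intervalIntegral.integral_smul a v).symm

theorem Traj.sub {u v u' v' : ℝ → V} (h : Traj T N u v) (h' : Traj T N u' v')
    (hv : Integrable v (volJ T)) (hv' : Integrable v' (volJ T)) :
    Traj T N (u - u') (v - v') := by
  simpa [sub_eq_add_neg] using h.add (h'.smul (-1)) hv (by simpa using hv'.neg)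

/-- The trajectories form a closed set in `L^p × L^p`. -/
theorem Traj.of_tendsto {p : ℝ≥0∞} [Fact (1 ≤ p)] {u v : ℕ → Lp V p (volJ T)}
    {u₀ v₀ : Lp V p (volJ T)} (h : ∀ n, Traj T N (u n) (v n))
    (hu : Filter.Tendsto u Filter.atTop (𝓝 u₀)) (hv : Filter.Tendsto v Filter.atTop (𝓝 v₀)) :
    Traj T N u₀ v₀ := by
  obtain ⟨ns, hns, hae⟩ := (tendstoInMeasure_of_tendsto_Lp hu).exists_seq_tendsto_ae
  have hI : ∀ w : Lp V p (volJ T), Integrable w (volJ T) := fun w =>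
    (Lp.memLp w).integrable Fact.out
  have hprim : ∀ t ∈ Ioo 0 T, Filter.Tendsto (fun n => ∫ s in 0..t, v n s) Filter.atTop
      (𝓝 (∫ s in 0..t, v₀ s)) := by
    intro t ht
    have hII : ∀ w : Lp V p (volJ T), IntegrableOn w (Ioc 0 t) := fun w => by
      have h := intervalIntegrable_of_volJ (hI w) ⟨le_rfl, (ht.1.trans ht.2).le⟩
        (Ioo_subset_Icc_self ht)
      exact (intervalIntegrable_iff_integrableOn_Ioc_of_le ht.1.le).mp h
    simp_rw [intervalIntegral.integral_of_le ht.1.le]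
    refine tendsto_integral_of_L1' _ (hII v₀).1 (Filter.Eventually.of_forall fun n => hII (v n)) ?_
    have h2 := Lp.tendsto_Lp_iff_tendsto_eLpNorm' v v₀ |>.mp hv
    have hfinite : volJ T univ ^ (1 / (1 : ℝ≥0∞).toReal - 1 / p.toReal) ≠ ⊤ := by
      refine (ENNReal.rpow_lt_top_of_nonneg ?_ (measure_ne_top _ _)).ne
      rcases eq_or_ne p ⊤ with rfl | hp
      · simp
      · have h1 : 1 ≤ p.toReal := by
          have := ENNReal.toReal_mono hp (Fact.out : 1 ≤ p)
          simpa using this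
        rw [ENNReal.toReal_one, sub_nonneg]
        exact one_div_le_one_div_of_le one_pos h1
    have h3 := ENNReal.Tendsto.mul_const h2 (b := _) (Or.inr hfinite)
    rw [zero_mul] at h3
    refine tendsto_of_tendsto_of_tendsto_of_le_of_le tendsto_const_nhds h3
      (fun n => zero_le) (fun n => ?_)
    refine le_trans ?_ (eLpNorm_le_eLpNorm_mul_rpow_measure_univ Fact.out
      ((Lp.aestronglyMeasurable (v n)).sub (Lp.aestronglyMeasurable v₀)))
    rw [eLpNorm_one_eq_lintegral_enorm, eLpNorm_one_eq_lintegral_enorm]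
    exact lintegral_mono_set (show Ioc 0 t ⊆ Ioo 0 T from fun s hs => ⟨hs.1, hs.2.trans_lt ht.2⟩)
  have hall : ∀ᵐ t ∂(volJ T), ∀ n, N (u n t) = ∫ s in 0..t, v n s := ae_all_iff.mpr h
  filter_upwards [hae, hall, ae_restrict_mem measurableSet_Ioo] with t h1 h2 ht
  have h3 := (N.continuous.tendsto _).comp h1
  refine tendsto_nhds_unique h3 (((hprim t ht).comp hns.tendsto_atTop).congr fun n => ?_)
  simp [h2]

end Trajectories

section Accretivity

variable {V H : Type*} [NormedAddCommGroup V] [InnerProductSpace ℂ V] [CompleteSpace V]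
  [NormedAddCommGroup H] [InnerProductSpace ℂ H] {T : ℝ} {N : V →L[ℂ] V} {j : V →L[ℂ] H}

theorem integrable_inner_of_memLp {E : Type*} [NormedAddCommGroup E] [InnerProductSpace ℂ E]
    {α : Type*} [MeasurableSpace α] {μ : Measure α} {f g : α → E} (hf : MemLp f 2 μ)
    (hg : MemLp g 2 μ) : Integrable (fun t => (inner ℂ (f t) (g t) : ℂ)) μ := by
  refine (L2.integrable_inner (𝕜 := ℂ) (hf.toLp f) (hg.toLp g)).congr ?_
  filter_upwards [hf.coeFn_toLp, hg.coeFn_toLp] with t h1 h2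
  rw [h1, h2]

/-- Translation is continuous in `L²(ℝ;V)`. -/
theorem continuous_integral_inner_translate {u v : ℝ → V} (hu : MemLp u 2 volume)
    (hv : MemLp v 2 volume) :
    Continuous fun s : ℝ => ∫ t, (inner ℂ (u t) (v (t - s)) : ℂ) := by
  let τ : ℝ → C(ℝ, ℝ) := fun s => ⟨fun t => t - s, by fun_prop⟩
  have hτ : Continuous τ := ContinuousMap.continuous_of_continuous_uncurry _ (by
    change Continuous fun p : ℝ × ℝ => p.2 - p.1
    fun_prop)
  have hτm : ∀ s, MeasurePreserving (τ s) volume volume := fun s =>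
    measurePreserving_sub_right volume s
  have h1 : Continuous fun s => Lp.compMeasurePreserving (τ s) (hτm s) (hv.toLp v) :=
    continuous_const.compMeasurePreservingLp hτ hτm (by simp)
  have h2 : Continuous fun s => (inner ℂ (hu.toLp u)
      (Lp.compMeasurePreserving (τ s) (hτm s) (hv.toLp v)) : ℂ) := continuous_const.inner h1
  convert h2 using 2 with s
  rw [L2.inner_def]
  refine integral_congr_ae ?_
  filter_upwards [hu.coeFn_toLp, Lp.coeFn_compMeasurePreserving (hv.toLp v) (hτm s),
    (hτm s).quasiMeasurePreserving.ae hv.coeFn_toLp] with t a b d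
  rw [a, b, Function.comp_apply, d]
  rfl

theorem integrable_inner_translate {u v : ℝ → V} (hu : MemLp u 2 volume)
    (hv : MemLp v 2 volume) (hv1 : Integrable v volume) (h : ℝ) :
    Integrable (fun p : ℝ × ℝ => (inner ℂ (u p.1) (v (p.1 - p.2)) : ℂ))
      (volume.prod (volume.restrict (Ioc 0 h))) := by
  have hone : Integrable (fun _ : ℝ => (1 : ℝ)) (volume.restrict (Ioc 0 h)) := integrable_const 1
  have h1 := (hone.convolution_integrand (ContinuousLinearMap.lsmul ℝ ℝ) hv1).aestronglyMeasurable
  have h2 := hone.convolution_integrand (ContinuousLinearMap.lsmul ℝ ℝ) hv.norm.integrable_sq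
  have h3 : Integrable (fun p : ℝ × ℝ => ‖u p.1‖ ^ 2)
      (volume.prod (volume.restrict (Ioc 0 h))) := hu.norm.integrable_sq.comp_fst _
  simp only [ContinuousLinearMap.lsmul_apply, one_smul] at h1 h2
  refine (h3.add h2).mono (hu.1.comp_fst.inner h1) (Filter.Eventually.of_forall fun p => ?_)
  refine (norm_inner_le_norm _ _).trans ?_
  have : 0 ≤ ‖u p.1‖ ^ 2 + ‖v (p.1 - p.2)‖ ^ 2 := by positivity
  simp only [Pi.add_apply, Real.norm_eq_abs]
  rw [abs_of_nonneg this]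
  nlinarith [sq_nonneg (‖u p.1‖ - ‖v (p.1 - p.2)‖), sq_nonneg ‖u p.1‖,
    sq_nonneg ‖v (p.1 - p.2)‖]

/-- The time derivative, with initial value zero, is accretive. For difference quotients instead of
the derivative this is the translation invariance of the norm of `L²(ℝ;H)`. -/
theorem Traj.re_integral_inner_nonneg
    (hN : ∀ φ ψ, (inner ℂ φ (N ψ) : ℂ) = inner ℂ (j φ) (j ψ)) {u v : ℝ → V}
    (hu : MemLp u 2 (volJ T)) (hv : MemLp v 2 (volJ T)) (h : Traj T N u v) :
    0 ≤ (∫ t in Ioo 0 T, (inner ℂ (u t) (v t) : ℂ)).re := by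
  set U : ℝ → V := (Ioo 0 T).indicator u with hU
  set W : ℝ → V := (Ioo 0 T).indicator v with hW
  have hU2 : MemLp U 2 volume := (memLp_indicator_iff_restrict measurableSet_Ioo).mpr hu
  have hW2 : MemLp W 2 volume := (memLp_indicator_iff_restrict measurableSet_Ioo).mpr hv
  have hW1 : Integrable W volume :=
    (integrable_indicator_iff measurableSet_Ioo).mpr (hv.integrable (by norm_num))
  have hprim : ∀ᵐ t ∂volume, t < T → ∫ s in 0..t, W s = N (U t) := by
    have h' := (ae_restrict_iff' measurableSet_Ioo).mp h
    filter_upwards [h'] with t ht htT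
    by_cases h0 : 0 < t
    · rw [hU, indicator_of_mem (show t ∈ Ioo 0 T from ⟨h0, htT⟩), ht ⟨h0, htT⟩,
        intervalIntegral.integral_of_le h0.le, intervalIntegral.integral_of_le h0.le]
      refine setIntegral_congr_fun measurableSet_Ioc fun s hs => ?_
      exact indicator_of_mem (show s ∈ Ioo 0 T from ⟨hs.1, hs.2.trans_lt htT⟩) v
    · push Not at h0
      rw [hU, indicator_of_notMem (fun hm => absurd hm.1 (not_lt.mpr h0)), map_zero]
      refine intervalIntegral.integral_zero_ae (Filter.Eventually.of_forall fun s hs => ?_)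
      rw [uIoc_of_ge h0] at hs
      exact indicator_of_notMem (fun hm => absurd hm.1 (not_lt.mpr hs.2)) v
  set κ : ℝ → ℂ := fun s => ∫ t, (inner ℂ (U t) (W (t - s)) : ℂ) with hκ
  have hκc : Continuous κ := continuous_integral_inner_translate hU2 hW2
  have hκ0 : κ 0 = ∫ t in Ioo 0 T, (inner ℂ (u t) (v t) : ℂ) := by
    rw [hκ, ← integral_indicator measurableSet_Ioo]
    refine integral_congr_ae (Filter.Eventually.of_forall fun t => ?_)
    simp only [sub_zero, hU, hW]
    by_cases ht : t ∈ Ioo 0 T <;> simp [ht]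
  have hpos : ∀ h > 0, 0 ≤ (∫ s in 0..h, κ s).re := by
    intro h hh
    have hint := integrable_inner_translate hU2 hW2 hW1 h
    have hswap := integral_integral_swap
      (f := fun t s => (inner ℂ (U t) (W (t - s)) : ℂ)) hint
    rw [intervalIntegral.integral_of_le hh.le, ← hswap]
    have hinner : ∀ᵐ t ∂volume, ∫ s in Ioc 0 h, (inner ℂ (U t) (W (t - s)) : ℂ) =
        inner ℂ (j (U t)) (j (U t)) - inner ℂ (j (U t)) (j (U (t - h))) := by
      filter_upwards [hprim, (measurePreserving_sub_right volume h).quasiMeasurePreserving.ae hprim]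
        with t ht hth
      by_cases htm : t ∈ Ioo 0 T
      · rw [integral_inner ((hW1.comp_sub_left t).restrict), ← intervalIntegral.integral_of_le hh.le,
          intervalIntegral.integral_comp_sub_left (fun s => W s) t, sub_zero]
        have e : ∫ s in (t - h)..t, W s = N (U t) - N (U (t - h)) := by
          rw [← ht htm.2, ← hth (by linarith [htm.2]),
            intervalIntegral.integral_interval_sub_left hW1.intervalIntegrable
              hW1.intervalIntegrable]
        rw [e, inner_sub_right, hN, hN]
      · have : U t = 0 := indicator_of_notMem htm u
        simp [this]
    rw [integral_congr_ae hinner]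
    have hjU : MemLp (fun t => j (U t)) 2 volume := hU2.continuousLinearMap_comp j
    have hjUh : MemLp (fun t => j (U (t - h))) 2 volume :=
      hjU.comp_measurePreserving (measurePreserving_sub_right volume h)
    have hi1 : Integrable (fun t => (inner ℂ (j (U t)) (j (U t)) : ℂ)) volume :=
      integrable_inner_of_memLp hjU hjU
    have hi2 : Integrable (fun t => (inner ℂ (j (U t)) (j (U (t - h))) : ℂ)) volume :=
      integrable_inner_of_memLp hjU hjUh
    have hre := integral_re (hi1.sub hi2)
    simp only [RCLike.re_to_complex, Pi.sub_apply] at hre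
    rw [← hre]
    have hle : ∫ t, (1 / 2 * ‖j (U t)‖ ^ 2 - 1 / 2 * ‖j (U (t - h))‖ ^ 2) ≤
        ∫ t, (inner ℂ (j (U t)) (j (U t)) - inner ℂ (j (U t)) (j (U (t - h))) : ℂ).re := by
      refine integral_mono ((hjU.norm.integrable_sq.const_mul _).sub
        (hjUh.norm.integrable_sq.const_mul _)) (hi1.sub hi2).re fun t => ?_
      have e1 : (inner ℂ (j (U t)) (j (U t)) : ℂ).re = ‖j (U t)‖ ^ 2 :=
        inner_self_eq_norm_sq (𝕜 := ℂ) _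
      have e2 : (inner ℂ (j (U t)) (j (U (t - h))) : ℂ).re ≤ ‖j (U t)‖ * ‖j (U (t - h))‖ :=
        re_inner_le_norm (𝕜 := ℂ) _ _
      simp only [Complex.sub_re, e1]
      nlinarith [sq_nonneg (‖j (U t)‖ - ‖j (U (t - h))‖)]
    refine le_trans ?_ hle
    rw [integral_sub (hjU.norm.integrable_sq.const_mul _) (hjUh.norm.integrable_sq.const_mul _),
      integral_sub_right_eq_self (fun t => 1 / 2 * ‖j (U t)‖ ^ 2) h, sub_self]
  rw [← hκ0]
  by_contra hneg
  push Not at hneg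
  have hre : Continuous fun s => (κ s).re := Complex.continuous_re.comp hκc
  obtain ⟨δ, hδ, hball⟩ := Metric.eventually_nhds_iff.mp
    ((hre.tendsto 0).eventually (gt_mem_nhds (show (κ 0).re < (κ 0).re / 2 by linarith)))
  have h1 := hpos (δ / 2) (half_pos hδ)
  have h2 : (∫ s in 0..(δ / 2), κ s).re = ∫ s in 0..(δ / 2), (κ s).re := by
    rw [intervalIntegral.integral_of_le (half_pos hδ).le,
      intervalIntegral.integral_of_le (half_pos hδ).le]
    exact (integral_re (hκc.integrableOn_Ioc)).symm
  have h3 : ∫ s in 0..(δ / 2), (κ s).re ≤ ∫ _ in 0..(δ / 2), (κ 0).re / 2 := by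
    refine intervalIntegral.integral_mono_on (half_pos hδ).le (hre.intervalIntegrable _ _)
      intervalIntegrable_const fun s hs => ?_
    refine (hball ?_).le
    rw [Real.dist_eq, sub_zero, abs_of_nonneg hs.1]
    linarith [hs.2]
  rw [intervalIntegral.integral_const, smul_eq_mul] at h3
  nlinarith

end Accretivity

/-! ### Lions' theorem at the exponent two -/

section LionsProjection

/-- Lions' projection lemma: the functional `P φ ↦ ⟨P φ, f⟩` factors through `K`, because of the lower
bound for `K`, and is extended and represented in `E`. -/
theorem exists_inner_eq_of_le {Φ E : Type*} [AddCommGroup Φ] [Module ℂ Φ] [NormedAddCommGroup E]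
    [InnerProductSpace ℂ E] [CompleteSpace E] (K P : Φ →ₗ[ℂ] E) {c : ℝ} (hc : 0 < c)
    (h : ∀ φ, c * ‖P φ‖ ≤ ‖K φ‖) (f : E) :
    ∃ u : E, ∀ φ, (inner ℂ (K φ) u : ℂ) = inner ℂ (P φ) f := by
  obtain ⟨σ, hσ⟩ := K.rangeRestrict.exists_rightInverse_of_surjective
    (LinearMap.range_eq_top.mpr K.surjective_rangeRestrict)
  have hKσ : ∀ y : LinearMap.range K, K (σ y) = y := fun y =>
    congrArg Subtype.val (LinearMap.congr_fun hσ y)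
  let l : LinearMap.range K →L[ℂ] ℂ :=
    LinearMap.mkContinuous ((innerₛₗ ℂ f).comp (P.comp σ)) (‖f‖ / c) fun y => by
      have h1 : ‖P (σ y)‖ ≤ ‖y‖ / c := by
        rw [le_div_iff₀ hc, mul_comm]
        have := h (σ y)
        rwa [hKσ] at this
      calc ‖(inner ℂ f (P (σ y)) : ℂ)‖ ≤ ‖f‖ * ‖P (σ y)‖ := norm_inner_le_norm _ _
        _ ≤ ‖f‖ * (‖y‖ / c) := by gcongr
        _ = ‖f‖ / c * ‖y‖ := by ring
  obtain ⟨g, hg, -⟩ := exists_extension_norm_eq (LinearMap.range K) l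
  refine ⟨(InnerProductSpace.toDual ℂ E).symm g, fun φ => ?_⟩
  have h1 : (inner ℂ ((InnerProductSpace.toDual ℂ E).symm g) (K φ) : ℂ) = inner ℂ f (P φ) := by
    rw [InnerProductSpace.toDual_symm_apply]
    have h2 := hg ⟨K φ, LinearMap.mem_range_self K φ⟩
    rw [h2]
    change (inner ℂ f (P (σ ⟨K φ, _⟩)) : ℂ) = _
    congr 1
    have h3 := h (σ ⟨K φ, LinearMap.mem_range_self K φ⟩ - φ)
    rw [map_sub, map_sub, hKσ, sub_self, norm_zero] at h3
    have h4 : ‖P (σ ⟨K φ, LinearMap.mem_range_self K φ⟩) - P φ‖ ≤ 0 := by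
      by_contra hn
      push Not at hn
      nlinarith
    exact sub_eq_zero.mp (norm_le_zero_iff.mp h4)
  rw [← inner_conj_symm, h1, inner_conj_symm]

end LionsProjection

section LTwo

variable {V H : Type*} [NormedAddCommGroup V] [InnerProductSpace ℂ V] [CompleteSpace V]
  [NormedAddCommGroup H] [InnerProductSpace ℂ H] {T : ℝ} {N : V →L[ℂ] V} {j : V →L[ℂ] H}

theorem memLp_of_continuous {φ : ℝ → V} (hφ : Continuous φ) (p : ℝ≥0∞) :
    MemLp φ p (volJ T) := by
  obtain ⟨C, hC⟩ := (isCompact_Icc (a := (0 : ℝ)) (b := T)).exists_bound_of_continuousOn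
    hφ.continuousOn
  refine MemLp.of_bound hφ.aestronglyMeasurable C ?_
  filter_upwards [ae_restrict_mem measurableSet_Ioo] with t ht
  exact hC t (Ioo_subset_Icc_self ht)

/-- The test functions for the weak formulation of the initial value problem: they vanish at the
final time only. -/
def finalZero (V : Type*) [NormedAddCommGroup V] [InnerProductSpace ℂ V] (T : ℝ) :
    Submodule ℂ (ℝ → V) where
  carrier := {φ | ContDiff ℝ 1 φ ∧ φ T = 0}
  add_mem' := fun ha hb => ⟨ha.1.add hb.1, by simp [ha.2, hb.2]⟩
  zero_mem' := ⟨contDiff_const, rfl⟩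
  smul_mem' := fun a _ hb => ⟨contDiff_const.smul hb.1, by simp [hb.2]⟩

theorem finalZero_continuous (φ : finalZero V T) : Continuous (φ : ℝ → V) := φ.2.1.continuous

theorem finalZero_continuous_deriv (φ : finalZero V T) : Continuous (deriv (φ : ℝ → V)) :=
  φ.2.1.continuous_deriv le_rfl

theorem finalZero_hasDerivAt (φ : finalZero V T) (t : ℝ) :
    HasDerivAt (φ : ℝ → V) (deriv (φ : ℝ → V) t) t :=
  (φ.2.1.differentiable one_ne_zero t).hasDerivAt

/-- The inclusion of the test functions in `L²(J;V)`. -/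
def finalZeroToLp : finalZero V T →ₗ[ℂ] Lp V 2 (volJ T) where
  toFun φ := (memLp_of_continuous (finalZero_continuous φ) 2).toLp φ
  map_add' _ _ := rfl
  map_smul' _ _ := rfl

/-- The derivatives of the test functions, in `L²(J;V)`. -/
def finalZeroDeriv : finalZero V T →ₗ[ℂ] Lp V 2 (volJ T) where
  toFun φ := (memLp_of_continuous (finalZero_continuous_deriv φ) 2).toLp _
  map_add' φ ψ := by
    rw [← MemLp.toLp_add]
    refine MemLp.toLp_congr _ _ (Filter.Eventually.of_forall fun t => ?_)
    exact ((finalZero_hasDerivAt φ t).add (finalZero_hasDerivAt ψ t)).deriv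
  map_smul' a φ := by
    rw [RingHom.id_apply, ← MemLp.toLp_const_smul]
    refine MemLp.toLp_congr _ _ (Filter.Eventually.of_forall fun t => ?_)
    exact ((finalZero_hasDerivAt φ t).const_smul a).deriv

theorem coeFn_finalZeroToLp (φ : finalZero V T) : finalZeroToLp φ =ᵐ[volJ T] (φ : ℝ → V) :=
  (memLp_of_continuous (finalZero_continuous φ) 2).coeFn_toLp

theorem coeFn_finalZeroDeriv (φ : finalZero V T) :
    finalZeroDeriv φ =ᵐ[volJ T] deriv (φ : ℝ → V) :=
  (memLp_of_continuous (finalZero_continuous_deriv φ) 2).coeFn_toLp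

/-- The backward counterpart of the accretivity of the time derivative: the real part is half the
increment of `‖j φ‖²` over `J`, which is `-‖j (φ 0)‖² / 2`. -/
theorem re_inner_finalZeroDeriv_nonpos (hT : 0 < T)
    (hN : ∀ φ ψ, (inner ℂ φ (N ψ) : ℂ) = inner ℂ (j φ) (j ψ)) (φ : finalZero V T) :
    (inner ℂ (finalZeroToLp φ) (N.compLp (finalZeroDeriv φ)) : ℂ).re ≤ 0 := by
  set g : ℝ → ℂ := fun t => inner ℂ (j ((φ : ℝ → V) t)) (j (deriv (φ : ℝ → V) t)) with hg
  have hgc : Continuous g := (j.continuous.comp (finalZero_continuous φ)).inner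
    (j.continuous.comp (finalZero_continuous_deriv φ))
  have e1 : (inner ℂ (finalZeroToLp φ) (N.compLp (finalZeroDeriv φ)) : ℂ) = ∫ t in 0..T, g t := by
    rw [L2.inner_def, intervalIntegral.integral_of_le hT.le, ← restrict_Ioo_eq_restrict_Ioc]
    refine integral_congr_ae ?_
    filter_upwards [coeFn_finalZeroToLp φ, coeFn_finalZeroDeriv φ,
      N.coeFn_compLp (finalZeroDeriv φ)] with t h1 h2 h3
    rw [h3, h1, h2, hN]
  have hj : ∀ t, HasDerivAt (fun t => j ((φ : ℝ → V) t)) (j (deriv (φ : ℝ → V) t)) t := fun t =>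
    (j.restrictScalars ℝ).hasFDerivAt.comp_hasDerivAt t (finalZero_hasDerivAt φ t)
  have hd : ∀ t, HasDerivAt (fun t => ‖j ((φ : ℝ → V) t)‖ ^ 2) (2 * (g t).re) t := by
    intro t
    have h1 := Complex.reCLM.hasFDerivAt.comp_hasDerivAt t ((hj t).inner ℂ (hj t))
    have e : (Complex.reCLM ∘ fun t => (inner ℂ (j ((φ : ℝ → V) t)) (j ((φ : ℝ → V) t)) : ℂ)) =
        fun t => ‖j ((φ : ℝ → V) t)‖ ^ 2 := by
      funext t
      exact inner_self_eq_norm_sq (𝕜 := ℂ) _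
    rw [e] at h1
    refine h1.congr_deriv ?_
    have h2 : (inner ℂ (j (deriv (φ : ℝ → V) t)) (j ((φ : ℝ → V) t)) : ℂ).re = (g t).re :=
      inner_re_symm (𝕜 := ℂ) _ _
    rw [Complex.reCLM_apply, Complex.add_re, h2]
    ring
  have hre : Continuous fun t => 2 * (g t).re :=
    continuous_const.mul (Complex.continuous_re.comp hgc)
  have hint := intervalIntegral.integral_eq_sub_of_hasDerivAt (a := 0) (b := T)
    (fun t _ => hd t) (hre.intervalIntegrable _ _)
  rw [φ.2.2, map_zero, norm_zero, intervalIntegral.integral_const_mul] at hint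
  have h2 : (∫ t in 0..T, g t).re = ∫ t in 0..T, (g t).re := by
    rw [intervalIntegral.integral_of_le hT.le, intervalIntegral.integral_of_le hT.le]
    exact (integral_re hgc.integrableOn_Ioc).symm
  rw [e1, h2]
  nlinarith [sq_nonneg ‖j ((φ : ℝ → V) 0)‖]

namespace CoerciveFamily

variable {A : ℝ → V →L[ℂ] V} {c C : ℝ}

/-- The weak formulation of the initial value problem for a test function `χ • ξ`, and integration
by parts, identify the solution of the weak problem as a trajectory. -/
theorem traj_of_weak (hT : 0 < T)
    (hN : ∀ φ ψ, (inner ℂ φ (N ψ) : ℂ) = inner ℂ (j φ) (j ψ)) {u v : Lp V 2 (volJ T)}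
    (h : ∀ φ : finalZero V T, (inner ℂ (finalZeroToLp φ) v : ℂ) +
      inner ℂ (N.compLp (finalZeroDeriv φ)) u = 0) : Traj T N u v := by
  have hui : Integrable u (volJ T) := (Lp.memLp u).integrable (by norm_num)
  have hvi : Integrable v (volJ T) := (Lp.memLp v).integrable (by norm_num)
  have hNui : Integrable (fun t => N (u t)) (volJ T) := N.integrable_comp hui
  have hNsymm : ∀ φ ψ, (inner ℂ (N φ) ψ : ℂ) = inner ℂ φ (N ψ) := fun φ ψ => by
    rw [← inner_conj_symm, hN, hN, inner_conj_symm]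
  have hGi := integrable_primitive hT hvi
  have key := isOpen_Ioo.ae_eq_zero_of_integral_contDiff_smul_eq_zero (μ := volume)
    (U := Ioo 0 T) (f := fun t => N (u t) - ∫ s in 0..t, v s) (hf := ?_) ?_
  · rw [Traj, ae_restrict_iff' measurableSet_Ioo]
    filter_upwards [key] with t ht hmem
    exact sub_eq_zero.mp (ht hmem)
  · have : IntegrableOn (fun t => N (u t) - ∫ s in 0..t, v s) (Ioo 0 T) := hNui.sub hGi
    exact this.locallyIntegrableOn
  · intro ψ hψ _ hψs
    have hψJ : ∀ t, t ∉ Ioo 0 T → ψ t = 0 := fun t ht =>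
      image_eq_zero_of_notMem_tsupport fun h1 => ht (hψs h1)
    rw [← setIntegral_eq_integral_of_forall_compl_eq_zero (s := Ioo 0 T)
      fun t ht => by rw [hψJ t ht, zero_smul]]
    set χ : ℝ → ℝ := fun t => ∫ s in T..t, ψ s with hχ
    have hχd : ∀ t, HasDerivAt χ (ψ t) t := fun t =>
      (hψ.continuous.integral_hasStrictDerivAt T t).hasDerivAt
    have hχs : ContDiff ℝ ∞ χ := contDiff_primitive hψ T
    have hχT : χ T = 0 := by simp [hχ]
    have hparts := integral_deriv_smul_primitive hvi hχd hψ.continuous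
    rw [hχT, zero_smul, zero_sub] at hparts
    simp only [smul_sub]
    rw [integral_sub (integrable_smul_of_continuous hψ.continuous hNui)
      (integrable_smul_of_continuous hψ.continuous hGi), hparts, sub_neg_eq_add]
    refine ext_inner_left ℂ fun ξ => ?_
    rw [inner_zero_right, inner_add_right,
      ← integral_inner (integrable_smul_of_continuous hψ.continuous hNui),
      ← integral_inner (integrable_smul_of_continuous hχs.continuous hvi)]
    let φ : finalZero V T := ⟨fun t => χ t • ξ, (hχs.of_le (by simp)).smul contDiff_const, by
      simp [hχT]⟩
    have hφd : deriv (φ : ℝ → V) = fun t => ψ t • ξ := by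
      funext t
      exact ((hχd t).smul_const ξ).deriv
    have hφ := h φ
    rw [add_comm, L2.inner_def, L2.inner_def] at hφ
    convert hφ using 2
    · refine integral_congr_ae ?_
      filter_upwards [N.coeFn_compLp (finalZeroDeriv φ), coeFn_finalZeroDeriv φ] with t h1 h2
      rw [h1, h2, hφd, hNsymm]
      beta_reduce
      rw [← Complex.coe_smul (ψ t) ξ, ← Complex.coe_smul (ψ t) (N (u t)),
        inner_smul_left, inner_smul_right, Complex.conj_ofReal]
    · refine integral_congr_ae ?_
      filter_upwards [coeFn_finalZeroToLp φ] with t h1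
      rw [h1]
      change _ = inner ℂ (χ t • ξ) _
      rw [← Complex.coe_smul (χ t) ξ, ← Complex.coe_smul (χ t) (v t),
        inner_smul_left, inner_smul_right, Complex.conj_ofReal]

/-- Existence in Lions' theorem on maximal `L²`-regularity. -/
theorem exists_traj (hA : CoerciveFamily (volJ T) A c C) (hT : 0 < T)
    (hN : ∀ φ ψ, (inner ℂ φ (N ψ) : ℂ) = inner ℂ (j φ) (j ψ)) (f : Lp V 2 (volJ T)) :
    ∃ u v : Lp V 2 (volJ T), Traj T N u v ∧ v + hA.mulOp u = f := by
  let K : finalZero V T →ₗ[ℂ] Lp V 2 (volJ T) :=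
    (ContinuousLinearMap.adjoint hA.mulOp).toLinearMap ∘ₗ finalZeroToLp -
      (N.compLpL 2 (volJ T)).toLinearMap ∘ₗ finalZeroDeriv
  have hK : ∀ φ, K φ = ContinuousLinearMap.adjoint hA.mulOp (finalZeroToLp φ) -
      N.compLp (finalZeroDeriv φ) := fun φ => rfl
  have hbound : ∀ φ, c * ‖finalZeroToLp φ‖ ≤ ‖K φ‖ := by
    intro φ
    have h1 : c * ‖finalZeroToLp φ‖ ^ 2 ≤ (inner ℂ (finalZeroToLp φ) (K φ) : ℂ).re := by
      rw [hK, inner_sub_right, ContinuousLinearMap.adjoint_inner_right, Complex.sub_re]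
      have h2 := hA.re_inner_mulOp (finalZeroToLp φ)
      have h3 := re_inner_finalZeroDeriv_nonpos hT hN φ
      have h4 : (inner ℂ (hA.mulOp (finalZeroToLp φ)) (finalZeroToLp φ) : ℂ).re =
        (inner ℂ (finalZeroToLp φ) (hA.mulOp (finalZeroToLp φ)) : ℂ).re :=
        inner_re_symm (𝕜 := ℂ) _ _
      linarith
    have h5 : (inner ℂ (finalZeroToLp φ) (K φ) : ℂ).re ≤ ‖finalZeroToLp φ‖ * ‖K φ‖ :=
      re_inner_le_norm (𝕜 := ℂ) _ _
    rcases (norm_nonneg (finalZeroToLp φ)).eq_or_lt with h0 | hpos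
    · rw [← h0, mul_zero]; exact norm_nonneg _
    · nlinarith
  obtain ⟨u, hu⟩ := exists_inner_eq_of_le K finalZeroToLp hA.c_pos hbound f
  refine ⟨u, f - hA.mulOp u, traj_of_weak hT hN fun φ => ?_, sub_add_cancel _ _⟩
  have h := hu φ
  rw [hK, inner_sub_left, ContinuousLinearMap.adjoint_inner_left] at h
  rw [inner_sub_right, ← h]
  ring

/-- The energy estimate. -/
theorem norm_le_of_traj (hA : CoerciveFamily (volJ T) A c C)
    (hN : ∀ φ ψ, (inner ℂ φ (N ψ) : ℂ) = inner ℂ (j φ) (j ψ)) {u v : Lp V 2 (volJ T)}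
    (h : Traj T N u v) : c * ‖u‖ ≤ ‖v + hA.mulOp u‖ := by
  have h1 := h.re_integral_inner_nonneg hN (Lp.memLp u) (Lp.memLp v)
  rw [← L2.inner_def] at h1
  have h2 := hA.re_inner_mulOp u
  have h3 : (inner ℂ u (v + hA.mulOp u) : ℂ).re ≤ ‖u‖ * ‖v + hA.mulOp u‖ :=
    re_inner_le_norm (𝕜 := ℂ) _ _
  rw [inner_add_right, Complex.add_re] at h3
  rcases (norm_nonneg u).eq_or_lt with h0 | hpos
  · rw [← h0, mul_zero]; exact norm_nonneg _
  · nlinarith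

theorem norm_sum_le_of_traj (hA : CoerciveFamily (volJ T) A c C)
    (hN : ∀ φ ψ, (inner ℂ φ (N ψ) : ℂ) = inner ℂ (j φ) (j ψ)) {u v : Lp V 2 (volJ T)}
    (h : Traj T N u v) : ‖v + u‖ ≤ (1 + (1 + C) / c) * ‖v + hA.mulOp u‖ := by
  have h1 := hA.norm_le_of_traj hN h
  have h2 : ‖u‖ ≤ ‖v + hA.mulOp u‖ / c := by
    rw [le_div_iff₀ hA.c_pos, mul_comm]; exact h1
  have h3 := hA.norm_mulOp_le u
  have hC := hA.C_pos
  calc ‖v + u‖ = ‖(v + hA.mulOp u) + (u - hA.mulOp u)‖ := by congr 1; abel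
    _ ≤ ‖v + hA.mulOp u‖ + (‖u‖ + C * ‖u‖) :=
      (norm_add_le _ _).trans (by gcongr; exact (norm_sub_le _ _).trans (by gcongr))
    _ = ‖v + hA.mulOp u‖ + (1 + C) * ‖u‖ := by ring
    _ ≤ ‖v + hA.mulOp u‖ + (1 + C) * (‖v + hA.mulOp u‖ / c) := by gcongr
    _ = (1 + (1 + C) / c) * ‖v + hA.mulOp u‖ := by ring

end CoerciveFamily

end LTwo

/-! ### Solution operators and the form of the quotient operator -/

section ClosedRange

/-- An operator that is bounded below, and whose range comes relatively close to each element of a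
dense set, is surjective: otherwise Riesz' lemma yields an element that is far from the range. -/
theorem surjective_of_near_preimage {X : Type*} [NormedAddCommGroup X] [NormedSpace ℂ X]
    [CompleteSpace X] (S : X →L[ℂ] X) {κ q : ℝ} (hκ : 0 < κ) (hq0 : 0 ≤ q) (hq : q < 1)
    (hS : ∀ x, κ * ‖x‖ ≤ ‖S x‖) {D : Set X} (hD : Dense D)
    (h : ∀ y ∈ D, ∃ x, ‖S x - y‖ ≤ q * ‖y‖) : Function.Surjective S := by
  have hanti : AntilipschitzWith (κ⁻¹).toNNReal S :=
    AddMonoidHomClass.antilipschitz_of_bound S fun x => by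
      rw [Real.coe_toNNReal _ (inv_nonneg.mpr hκ.le), inv_mul_eq_div, le_div_iff₀ hκ, mul_comm]
      exact hS x
  have hcl : IsClosed ((LinearMap.range S.toLinearMap : Submodule ℂ X) : Set X) := by
    have := hanti.isClosed_range S.uniformContinuous
    simpa [LinearMap.coe_range] using this
  by_contra hns
  have hne : ∃ x, x ∉ LinearMap.range S.toLinearMap := by
    by_contra hall
    push Not at hall
    exact hns hall
  obtain ⟨x₀, hx₀, hfar⟩ := riesz_lemma hcl hne (r := (1 + q) / 2) (by linarith)
  have hpos : 0 < ‖x₀‖ := by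
    rw [norm_pos_iff]
    rintro rfl
    exact hx₀ (Submodule.zero_mem _)
  set η := (1 - q) / 2 * ‖x₀‖ / 4 with hη
  have hηpos : 0 < η := by
    have : 0 < 1 - q := by linarith
    positivity
  obtain ⟨y, hyD, hy⟩ := Metric.dense_iff.mp hD x₀ η hηpos
  rw [mem_ball_iff_norm] at hyD
  obtain ⟨x, hx⟩ := h y hy
  have h1 := hfar (S x) ⟨x, rfl⟩
  have h2 : ‖x₀ - S x‖ ≤ ‖y - x₀‖ + ‖S x - y‖ := by
    rw [norm_sub_rev x₀]
    calc ‖S x - x₀‖ = ‖(S x - y) + (y - x₀)‖ := by congr 1; abel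
      _ ≤ _ := (norm_add_le _ _).trans (add_comm _ _).le
  have h3 : ‖y‖ ≤ ‖x₀‖ + ‖y - x₀‖ := norm_le_norm_add_norm_sub' y x₀
  nlinarith

end ClosedRange

section Combination

variable {V H : Type*} [NormedAddCommGroup V] [InnerProductSpace ℂ V] [CompleteSpace V]
  [NormedAddCommGroup H] [InnerProductSpace ℂ H] {T : ℝ} {N : V →L[ℂ] V} {j : V →L[ℂ] H}

theorem Traj.lp_sub {p : ℝ≥0∞} [Fact (1 ≤ p)] {u v u' v' : Lp V p (volJ T)} (h : Traj T N u v)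
    (h' : Traj T N u' v') : Traj T N (u - u' : Lp V p (volJ T)) (v - v' : Lp V p (volJ T)) :=
  (h.sub h' ((Lp.memLp v).integrable Fact.out) ((Lp.memLp v').integrable Fact.out)).congr
    (Lp.coeFn_sub u u').symm (Lp.coeFn_sub v v').symm

theorem Traj.lp_add {p : ℝ≥0∞} [Fact (1 ≤ p)] {u v u' v' : Lp V p (volJ T)} (h : Traj T N u v)
    (h' : Traj T N u' v') : Traj T N (u + u' : Lp V p (volJ T)) (v + v' : Lp V p (volJ T)) :=
  (h.add h' ((Lp.memLp v).integrable Fact.out) ((Lp.memLp v').integrable Fact.out)).congr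
    (Lp.coeFn_add u u').symm (Lp.coeFn_add v v').symm

theorem Traj.lp_smul {p : ℝ≥0∞} {u v : Lp V p (volJ T)} (h : Traj T N u v) (a : ℂ) :
    Traj T N (a • u : Lp V p (volJ T)) (a • v : Lp V p (volJ T)) :=
  (h.smul a).congr (Lp.coeFn_smul a u).symm (Lp.coeFn_smul a v).symm

namespace CoerciveFamily

variable {A : ℝ → V →L[ℂ] V} {c C : ℝ}

theorem eq_of_traj (hA : CoerciveFamily (volJ T) A c C)
    (hN : ∀ φ ψ, (inner ℂ φ (N ψ) : ℂ) = inner ℂ (j φ) (j ψ)) {u v u' v' : Lp V 2 (volJ T)}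
    (h : Traj T N u v) (h' : Traj T N u' v') (he : v + hA.mulOp u = v' + hA.mulOp u') :
    u = u' := by
  have h1 := hA.norm_le_of_traj hN (h.lp_sub h')
  have e : v - v' + hA.mulOp (u - u') = (v + hA.mulOp u) - (v' + hA.mulOp u') := by
    rw [map_sub]; abel
  rw [e, he, sub_self, norm_zero] at h1
  have hc := hA.c_pos
  have h2 : ‖u - u'‖ ≤ 0 := by
    by_contra hn
    push Not at hn
    nlinarith
  exact sub_eq_zero.mp (norm_le_zero_iff.mp h2)

/-- The solution operator of Lions' theorem, on `L²(J;V)`. -/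
def solve (hA : CoerciveFamily (volJ T) A c C) (hT : 0 < T)
    (hN : ∀ φ ψ, (inner ℂ φ (N ψ) : ℂ) = inner ℂ (j φ) (j ψ)) :
    Lp V 2 (volJ T) →L[ℂ] Lp V 2 (volJ T) :=
  LinearMap.mkContinuous
    { toFun := fun f => (hA.exists_traj hT hN f).choose
      map_add' := fun f g => by
        obtain ⟨v, h, e⟩ := (hA.exists_traj hT hN f).choose_spec
        obtain ⟨v', h', e'⟩ := (hA.exists_traj hT hN g).choose_spec
        obtain ⟨w, hw, ew⟩ := (hA.exists_traj hT hN (f + g)).choose_spec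
        refine hA.eq_of_traj hN hw (h.lp_add h') ?_
        rw [ew, map_add]
        nth_rw 1 [← e, ← e']
        abel
      map_smul' := fun a f => by
        obtain ⟨v, h, e⟩ := (hA.exists_traj hT hN f).choose_spec
        obtain ⟨w, hw, ew⟩ := (hA.exists_traj hT hN (a • f)).choose_spec
        refine hA.eq_of_traj hN hw (h.lp_smul a) ?_
        rw [RingHom.id_apply, ew, map_smul, ← smul_add, e] } c⁻¹
    fun f => by
      obtain ⟨v, h, e⟩ := (hA.exists_traj hT hN f).choose_spec
      have := hA.norm_le_of_traj hN h
      rw [e] at this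
      rw [inv_mul_eq_div, le_div_iff₀ hA.c_pos, mul_comm]
      exact this

theorem traj_solve (hA : CoerciveFamily (volJ T) A c C) (hT : 0 < T)
    (hN : ∀ φ ψ, (inner ℂ φ (N ψ) : ℂ) = inner ℂ (j φ) (j ψ)) (f : Lp V 2 (volJ T)) :
    Traj T N (hA.solve hT hN f)
      (f - hA.mulOp (hA.solve hT hN f) : Lp V 2 (volJ T)) := by
  obtain ⟨v, h, e⟩ := (hA.exists_traj hT hN f).choose_spec
  have e' : f - hA.mulOp (hA.solve hT hN f) = v := by
    rw [sub_eq_iff_eq_add]; exact e.symm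
  rw [e']; exact h

theorem solve_eq (hA : CoerciveFamily (volJ T) A c C) (hT : 0 < T)
    (hN : ∀ φ ψ, (inner ℂ φ (N ψ) : ℂ) = inner ℂ (j φ) (j ψ)) {u v : Lp V 2 (volJ T)}
    (h : Traj T N u v) : hA.solve hT hN (v + hA.mulOp u) = u :=
  hA.eq_of_traj hN (hA.traj_solve hT hN _) h (sub_add_cancel _ _)

theorem mulOp_one {p : ℝ≥0∞} [Fact (1 ≤ p)] (u : Lp V p (volJ T)) :
    (CoerciveFamily.one (V := V) (μ := volJ T)).mulOp u = u :=
  Lp.ext (coeFn_mulOp _ u)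

end CoerciveFamily

/-- The solution operator for the duality map, on `L²(J;V)`. -/
def dualitySolve (hT : 0 < T) (hN : ∀ φ ψ, (inner ℂ φ (N ψ) : ℂ) = inner ℂ (j φ) (j ψ)) :
    Lp V 2 (volJ T) →L[ℂ] Lp V 2 (volJ T) :=
  (CoerciveFamily.one (V := V) (μ := volJ T)).solve hT hN

theorem traj_dualitySolve (hT : 0 < T)
    (hN : ∀ φ ψ, (inner ℂ φ (N ψ) : ℂ) = inner ℂ (j φ) (j ψ)) (f : Lp V 2 (volJ T)) :
    Traj T N (dualitySolve hT hN f) (f - dualitySolve hT hN f : Lp V 2 (volJ T)) := by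
  have h := (CoerciveFamily.one (V := V) (μ := volJ T)).traj_solve hT hN f
  rwa [CoerciveFamily.mulOp_one] at h

theorem dualitySolve_eq (hT : 0 < T)
    (hN : ∀ φ ψ, (inner ℂ φ (N ψ) : ℂ) = inner ℂ (j φ) (j ψ)) {u v : Lp V 2 (volJ T)}
    (h : Traj T N u v) : dualitySolve hT hN (v + u) = u := by
  have h' := (CoerciveFamily.one (V := V) (μ := volJ T)).solve_eq hT hN h
  rwa [CoerciveFamily.mulOp_one] at h'

/-- Maximal `L^p`-regularity of the duality map, with bound `M`. -/
structure DualityReg (T : ℝ) (N : V →L[ℂ] V) (p : ℝ≥0∞) (M : ℝ) : Prop where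
  exists_traj : ∀ f : ℝ → V, MemLp f p (volJ T) →
    ∃ u v : ℝ → V, MemLp u p (volJ T) ∧ MemLp v p (volJ T) ∧ Traj T N u v ∧ v + u =ᵐ[volJ T] f
  bound : ∀ u v : ℝ → V, MemLp u p (volJ T) → MemLp v p (volJ T) → Traj T N u v →
    eLpNorm u p (volJ T) + eLpNorm v p (volJ T) ≤ ENNReal.ofReal M * eLpNorm (v + u) p (volJ T)

/-- The solution operators for different exponents are consistent. -/
theorem DualityReg.solve_simple {p : ℝ≥0∞} {M : ℝ} (D : DualityReg T N p M) (hT : 0 < T)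
    (hN : ∀ φ ψ, (inner ℂ φ (N ψ) : ℂ) = inner ℂ (j φ) (j ψ)) (x : SimpleFunc ℝ V) :
    eLpNorm (dualitySolve hT hN (toL2 (volJ T) x)) p (volJ T) +
      eLpNorm (toL2 (volJ T) x - dualitySolve hT hN (toL2 (volJ T) x) : Lp V 2 (volJ T)) p
        (volJ T) ≤ ENNReal.ofReal M * eLpNorm x p (volJ T) := by
  set f := toL2 (volJ T) x with hf
  set u := dualitySolve hT hN f with hu
  have htr := traj_dualitySolve hT hN f
  have hsum : ⇑(f - u : Lp V 2 (volJ T)) + ⇑u =ᵐ[volJ T] x := by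
    filter_upwards [Lp.coeFn_sub f u, coeFn_toL2 (μ := volJ T) x] with t h1 h2
    rw [Pi.add_apply, h1, Pi.sub_apply, sub_add_cancel, h2]
  rw [← eLpNorm_congr_ae hsum]
  suffices hm : MemLp u p (volJ T) ∧ MemLp (f - u : Lp V 2 (volJ T)) p (volJ T) from
    D.bound _ _ hm.1 hm.2 htr
  rcases le_total p 2 with hp | hp
  · exact ⟨(Lp.memLp u).mono_exponent hp, (Lp.memLp _).mono_exponent hp⟩
  · obtain ⟨u', v', hu', hv', htr', he⟩ := D.exists_traj x (x.memLp_of_isFiniteMeasure p _)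
    have hu2 := hu'.mono_exponent hp
    have hv2 := hv'.mono_exponent hp
    have h1 := dualitySolve_eq hT hN (htr'.congr hu2.coeFn_toLp.symm hv2.coeFn_toLp.symm)
    have h2 : hv2.toLp v' + hu2.toLp u' = f := by
      refine Lp.ext ?_
      filter_upwards [Lp.coeFn_add (hv2.toLp v') (hu2.toLp u'), hv2.coeFn_toLp, hu2.coeFn_toLp, he,
        coeFn_toL2 (μ := volJ T) x] with t a b d e g
      rw [a, Pi.add_apply, b, d, g, ← e, Pi.add_apply]
    have h3 : u = hu2.toLp u' := by rw [hu, ← h2]; exact h1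
    have h4 : f - u = hv2.toLp v' := by rw [h3, ← h2, add_sub_cancel_right]
    rw [h4, h3]
    exact ⟨hu'.ae_eq hu2.coeFn_toLp.symm, hv'.ae_eq hv2.coeFn_toLp.symm⟩

theorem dense_toL2 : DenseRange (toL2 (volJ T) : SimpleFunc ℝ V →ₗ[ℂ] Lp V 2 (volJ T)) := by
  refine Metric.denseRange_iff.mpr fun f ε hε => ?_
  obtain ⟨g, hg, -⟩ := (Lp.memLp f).exists_simpleFunc_eLpNorm_sub_lt (by simp)
    (ε := ENNReal.ofReal ε) (by simpa using hε)
  refine ⟨g, ?_⟩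
  rw [dist_eq_norm, Lp.norm_def]
  have h1 : (f - toL2 (volJ T) g : Lp V 2 (volJ T)) =ᵐ[volJ T] ⇑f - ⇑g := by
    filter_upwards [Lp.coeFn_sub f (toL2 (volJ T) g), coeFn_toL2 (μ := volJ T) g] with t h1 h2
    rw [h1, Pi.sub_apply, h2, Pi.sub_apply]
  rw [eLpNorm_congr_ae h1]
  exact (ENNReal.lt_ofReal_iff_toReal_lt hg.ne_top).mp hg

namespace CoerciveFamily

variable {A : ℝ → V →L[ℂ] V} {c C : ℝ}

/-- The operator `(∂_t + A) (∂_t + 𝒥)⁻¹` on `L²(J;V)`. -/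
def quotOp (hA : CoerciveFamily (volJ T) A c C) (hT : 0 < T)
    (hN : ∀ φ ψ, (inner ℂ φ (N ψ) : ℂ) = inner ℂ (j φ) (j ψ)) :
    Lp V 2 (volJ T) →L[ℂ] Lp V 2 (volJ T) :=
  ContinuousLinearMap.id ℂ _ - dualitySolve hT hN + hA.mulOp ∘L dualitySolve hT hN

theorem quotOp_apply (hA : CoerciveFamily (volJ T) A c C) (hT : 0 < T)
    (hN : ∀ φ ψ, (inner ℂ φ (N ψ) : ℂ) = inner ℂ (j φ) (j ψ)) (f : Lp V 2 (volJ T)) :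
    hA.quotOp hT hN f = (f - dualitySolve hT hN f) + hA.mulOp (dualitySolve hT hN f) := rfl

/-- The inverse `(∂_t + 𝒥) (∂_t + A)⁻¹` of `quotOp`. -/
def quotInv (hA : CoerciveFamily (volJ T) A c C) (hT : 0 < T)
    (hN : ∀ φ ψ, (inner ℂ φ (N ψ) : ℂ) = inner ℂ (j φ) (j ψ)) :
    Lp V 2 (volJ T) →L[ℂ] Lp V 2 (volJ T) :=
  ContinuousLinearMap.id ℂ _ - hA.mulOp ∘L hA.solve hT hN + hA.solve hT hN

theorem quotInv_apply (hA : CoerciveFamily (volJ T) A c C) (hT : 0 < T)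
    (hN : ∀ φ ψ, (inner ℂ φ (N ψ) : ℂ) = inner ℂ (j φ) (j ψ)) (f : Lp V 2 (volJ T)) :
    hA.quotInv hT hN f = (f - hA.mulOp (hA.solve hT hN f)) + hA.solve hT hN f := rfl

theorem quotInv_quotOp (hA : CoerciveFamily (volJ T) A c C) (hT : 0 < T)
    (hN : ∀ φ ψ, (inner ℂ φ (N ψ) : ℂ) = inner ℂ (j φ) (j ψ)) (f : Lp V 2 (volJ T)) :
    hA.quotInv hT hN (hA.quotOp hT hN f) = f := by
  have h := hA.solve_eq hT hN (traj_dualitySolve hT hN f)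
  rw [← quotOp_apply] at h
  rw [quotInv_apply, h, quotOp_apply]
  abel

theorem quotOp_quotInv (hA : CoerciveFamily (volJ T) A c C) (hT : 0 < T)
    (hN : ∀ φ ψ, (inner ℂ φ (N ψ) : ℂ) = inner ℂ (j φ) (j ψ)) (f : Lp V 2 (volJ T)) :
    hA.quotOp hT hN (hA.quotInv hT hN f) = f := by
  have h := dualitySolve_eq hT hN (hA.traj_solve hT hN f)
  rw [← quotInv_apply] at h
  rw [quotOp_apply, h, quotInv_apply]
  abel

theorem norm_quotInv_le (hA : CoerciveFamily (volJ T) A c C) (hT : 0 < T)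
    (hN : ∀ φ ψ, (inner ℂ φ (N ψ) : ℂ) = inner ℂ (j φ) (j ψ)) :
    ‖hA.quotInv hT hN‖ ≤ 1 + (1 + C) / c := by
  have hc := hA.c_pos
  have hC := hA.C_pos
  refine ContinuousLinearMap.opNorm_le_bound _ (by positivity) fun f => ?_
  rw [quotInv_apply]
  have h := hA.norm_sum_le_of_traj hN (hA.traj_solve hT hN f)
  rwa [sub_add_cancel] at h

theorem eLpNorm_quotOp_le (hA : CoerciveFamily (volJ T) A c C) (hT : 0 < T)
    (hN : ∀ φ ψ, (inner ℂ φ (N ψ) : ℂ) = inner ℂ (j φ) (j ψ)) {p : ℝ≥0∞} (hp : 1 ≤ p) {M : ℝ}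
    (D : DualityReg T N p M) (x : SimpleFunc ℝ V) :
    eLpNorm (hA.quotOp hT hN (toL2 (volJ T) x)) p (volJ T) ≤
      ENNReal.ofReal (max 1 C * M) * eLpNorm x p (volJ T) := by
  set f := toL2 (volJ T) x with hf
  set u := dualitySolve hT hN f with hu
  have hb := D.solve_simple hT hN x
  rw [← hf, ← hu] at hb
  have he : ⇑(hA.quotOp hT hN f) =ᵐ[volJ T]
      ⇑(f - u : Lp V 2 (volJ T)) + ⇑(hA.mulOp u) := by
    rw [quotOp_apply]
    exact Lp.coeFn_add _ _
  rw [eLpNorm_congr_ae he, ENNReal.ofReal_mul (by positivity), mul_assoc]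
  have hm : ENNReal.ofReal 1 ≤ ENNReal.ofReal (max 1 C) :=
    ENNReal.ofReal_le_ofReal (le_max_left _ _)
  have hm' : ENNReal.ofReal C ≤ ENNReal.ofReal (max 1 C) :=
    ENNReal.ofReal_le_ofReal (le_max_right _ _)
  rw [ENNReal.ofReal_one] at hm
  calc _ ≤ eLpNorm (f - u : Lp V 2 (volJ T)) p (volJ T) + eLpNorm (hA.mulOp u) p (volJ T) :=
        eLpNorm_add_le (Lp.aestronglyMeasurable _) (Lp.aestronglyMeasurable _) hp
    _ ≤ 1 * eLpNorm (f - u : Lp V 2 (volJ T)) p (volJ T) +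
        ENNReal.ofReal C * eLpNorm u p (volJ T) := by
      rw [one_mul, eLpNorm_congr_ae (hA.coeFn_mulOp u)]
      gcongr
      exact hA.eLpNorm_apply_le u p
    _ ≤ ENNReal.ofReal (max 1 C) * (eLpNorm u p (volJ T) +
        eLpNorm (f - u : Lp V 2 (volJ T)) p (volJ T)) := by
      rw [mul_add, add_comm]
      gcongr
    _ ≤ _ := by gcongr

theorem sneibergData (hA : CoerciveFamily (volJ T) A c C) (hT : 0 < T)
    (hN : ∀ φ ψ, (inner ℂ φ (N ψ) : ℂ) = inner ℂ (j φ) (j ψ)) {s₀ s₁ θ M : ℝ}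
    (h0 : s₀ ∈ Ioo (0 : ℝ) 1) (h1 : s₁ ∈ Ioo (0 : ℝ) 1) (hθ : θ ∈ Ioo (0 : ℝ) 1) (hM : 0 ≤ M)
    (half : s₀ + (s₁ - s₀) * θ = 1 / 2) (D0 : DualityReg T N (recipExp s₀) M)
    (D1 : DualityReg T N (recipExp s₁) M) :
    SneibergData ((hA.quotOp hT hN).toLinearMap ∘ₗ toL2 (volJ T)) (hA.quotInv hT hN) s₀ s₁ θ
      (max 1 C * M) (1 + (1 + C) / c) := by
  have one_le : ∀ s : ℝ, s ∈ Ioo (0 : ℝ) 1 → 1 ≤ recipExp s := fun s hs => by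
    rw [recipExp, ENNReal.one_le_ofReal, one_le_inv₀ hs.1]; exact hs.2.le
  have hc := hA.c_pos
  have hC := hA.C_pos
  exact
  { h0 := h0
    h1 := h1
    hθ := hθ
    hβ := by positivity
    hK := by positivity
    half := half
    bound0 := hA.eLpNorm_quotOp_le hT hN (one_le _ h0) D0
    bound1 := hA.eLpNorm_quotOp_le hT hN (one_le _ h1) D1
    leftInv := fun g => hA.quotInv_quotOp hT hN _
    dense := by
      have hs : Function.Surjective (hA.quotOp hT hN) := fun f => ⟨_, hA.quotOp_quotInv hT hN f⟩
      exact hs.denseRange.comp dense_toL2 (hA.quotOp hT hN).continuous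
    norm_le := hA.norm_quotInv_le hT hN }

end CoerciveFamily

end Combination

/-! ### Maximal regularity at intermediate exponents -/

section IntermediateExponents

variable {V H : Type*} [NormedAddCommGroup V] [InnerProductSpace ℂ V] [CompleteSpace V]
  [NormedAddCommGroup H] [InnerProductSpace ℂ H] {T : ℝ} {N : V →L[ℂ] V} {j : V →L[ℂ] H}

/-- Simple functions as elements of `L^p`. -/
def simpleToLp (T : ℝ) (p : ℝ≥0∞) : SimpleFunc ℝ V →ₗ[ℂ] Lp V p (volJ T) where
  toFun g := (g.memLp_of_isFiniteMeasure p (volJ T)).toLp g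
  map_add' _ _ := rfl
  map_smul' _ _ := rfl

theorem coeFn_simpleToLp (p : ℝ≥0∞) (g : SimpleFunc ℝ V) : simpleToLp T p g =ᵐ[volJ T] g :=
  (g.memLp_of_isFiniteMeasure p (volJ T)).coeFn_toLp

theorem norm_simpleToLp (p : ℝ≥0∞) (g : SimpleFunc ℝ V) :
    ‖simpleToLp T p g‖ = (eLpNorm g p (volJ T)).toReal := by
  rw [Lp.norm_def, eLpNorm_congr_ae (coeFn_simpleToLp p g)]

theorem dense_simpleToLp {p : ℝ≥0∞} [Fact (1 ≤ p)] (hp : p ≠ ⊤) :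
    DenseRange (simpleToLp T p : SimpleFunc ℝ V →ₗ[ℂ] Lp V p (volJ T)) := by
  refine Metric.denseRange_iff.mpr fun f ε hε => ?_
  obtain ⟨g, hg, -⟩ := (Lp.memLp f).exists_simpleFunc_eLpNorm_sub_lt hp
    (ε := ENNReal.ofReal ε) (by simpa using hε)
  refine ⟨g, ?_⟩
  rw [dist_eq_norm, Lp.norm_def]
  have h1 : (f - simpleToLp T p g : Lp V p (volJ T)) =ᵐ[volJ T] ⇑f - ⇑g := by
    filter_upwards [Lp.coeFn_sub f (simpleToLp T p g), coeFn_simpleToLp (T := T) p g] with t h1 h2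
    rw [h1, Pi.sub_apply, h2, Pi.sub_apply]
  rw [eLpNorm_congr_ae h1]
  exact (ENNReal.lt_ofReal_iff_toReal_lt hg.ne_top).mp hg

theorem eLpNorm_dualitySolve_le (hT : 0 < T)
    (hN : ∀ φ ψ, (inner ℂ φ (N ψ) : ℂ) = inner ℂ (j φ) (j ψ)) {s₀ s₁ τ M : ℝ}
    (h0 : s₀ ∈ Ioo (0 : ℝ) 1) (h1 : s₁ ∈ Ioo (0 : ℝ) 1) (hτ : τ ∈ Icc (0 : ℝ) 1) (hM : 0 ≤ M)
    (D0 : DualityReg T N (recipExp s₀) M) (D1 : DualityReg T N (recipExp s₁) M)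
    (x : SimpleFunc ℝ V) :
    eLpNorm (dualitySolve hT hN (toL2 (volJ T) x)) (recipExp (s₀ + (s₁ - s₀) * τ)) (volJ T) ≤
      ENNReal.ofReal M * eLpNorm x (recipExp (s₀ + (s₁ - s₀) * τ)) (volJ T) :=
  riesz_thorin (S := (dualitySolve hT hN).toLinearMap ∘ₗ toL2 (volJ T)) h0 h1 hτ hM
    (fun g => le_self_add.trans (D0.solve_simple hT hN g))
    (fun g => le_self_add.trans (D1.solve_simple hT hN g)) x

/-- The solution operator for the duality map on `L^p`, `p = 1 / s`, for an exponent between the two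
exponents for which maximal regularity is given. -/
theorem exists_dualitySolve_interp (hT : 0 < T)
    (hN : ∀ φ ψ, (inner ℂ φ (N ψ) : ℂ) = inner ℂ (j φ) (j ψ)) {s₀ s₁ τ M s : ℝ}
    (h0 : s₀ ∈ Ioo (0 : ℝ) 1) (h1 : s₁ ∈ Ioo (0 : ℝ) 1) (hτ : τ ∈ Icc (0 : ℝ) 1) (hM : 0 ≤ M)
    (D0 : DualityReg T N (recipExp s₀) M) (D1 : DualityReg T N (recipExp s₁) M)
    (hs : s = s₀ + (s₁ - s₀) * τ) [Fact (1 ≤ recipExp s)] :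
    ∃ R : Lp V (recipExp s) (volJ T) →L[ℂ] Lp V (recipExp s) (volJ T),
      (∀ x : SimpleFunc ℝ V, R (simpleToLp T (recipExp s) x) =ᵐ[volJ T]
        dualitySolve hT hN (toL2 (volJ T) x)) ∧
      (∀ f, Traj T N (R f) (f - R f : Lp V (recipExp s) (volJ T))) ∧
      ∀ u v : Lp V (recipExp s) (volJ T), Traj T N u v → R (v + u) = u := by
  have hbound := fun x => eLpNorm_dualitySolve_le hT hN h0 h1 hτ hM D0 D1 x
  rw [← hs] at hbound
  have hmem : ∀ x : SimpleFunc ℝ V,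
      MemLp (dualitySolve hT hN (toL2 (volJ T) x)) (recipExp s) (volJ T) := fun x =>
    ⟨Lp.aestronglyMeasurable _, (hbound x).trans_lt
      (ENNReal.mul_lt_top ENNReal.ofReal_lt_top (eLpNorm_simple_ne_top x _).lt_top)⟩
  let R₀ : SimpleFunc ℝ V →ₗ[ℂ] Lp V (recipExp s) (volJ T) :=
    { toFun := fun x => (hmem x).toLp _
      map_add' := fun x y => by
        rw [← MemLp.toLp_add]
        refine MemLp.toLp_congr _ _ ?_
        rw [map_add, map_add]
        exact Lp.coeFn_add _ _
      map_smul' := fun a x => by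
        rw [RingHom.id_apply, ← MemLp.toLp_const_smul]
        refine MemLp.toLp_congr _ _ ?_
        rw [map_smul, map_smul]
        exact Lp.coeFn_smul _ _ }
  have hR₀ : ∀ x, R₀ x =ᵐ[volJ T] dualitySolve hT hN (toL2 (volJ T) x) := fun x =>
    (hmem x).coeFn_toLp
  have hnorm : ∀ x, ‖R₀ x‖ ≤ M * ‖simpleToLp T (recipExp s) x‖ := by
    intro x
    rw [Lp.norm_def, eLpNorm_congr_ae (hR₀ x), norm_simpleToLp, ← ENNReal.toReal_ofReal hM,
      ← ENNReal.toReal_mul]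
    exact ENNReal.toReal_mono
      (ENNReal.mul_ne_top ENNReal.ofReal_ne_top (eLpNorm_simple_ne_top x _)) (by
        simpa [ENNReal.toReal_ofReal hM] using hbound x)
  have hdense := dense_simpleToLp (V := V) (T := T) (recipExp_ne_top s)
  set R := R₀.extendOfNorm (simpleToLp T (recipExp s)) with hR
  have hRx : ∀ x, R (simpleToLp T (recipExp s) x) = R₀ x := fun x =>
    LinearMap.extendOfNorm_eq hdense ⟨M, hnorm⟩ x
  have htraj : ∀ f, Traj T N (R f) (f - R f : Lp V (recipExp s) (volJ T)) := by
    intro f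
    have hmemcl : f ∈ closure (range (simpleToLp (V := V) T (recipExp s))) := hdense f
    obtain ⟨y, hy, hyf⟩ := mem_closure_iff_seq_limit.mp hmemcl
    choose x hx using hy
    have hRy : Filter.Tendsto (fun n => R (y n)) Filter.atTop (𝓝 (R f)) :=
      (R.continuous.tendsto f).comp hyf
    refine Traj.of_tendsto (fun n => ?_) hRy (hyf.sub hRy)
    have h2 := traj_dualitySolve hT hN (toL2 (volJ T) (x n))
    rw [← hx n, hRx]
    refine h2.congr (hR₀ (x n)).symm ?_
    filter_upwards [Lp.coeFn_sub (toL2 (volJ T) (x n)) (dualitySolve hT hN (toL2 (volJ T) (x n))),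
      Lp.coeFn_sub (simpleToLp T (recipExp s) (x n)) (R₀ (x n)),
      coeFn_toL2 (μ := volJ T) (x n), coeFn_simpleToLp (T := T) (recipExp s) (x n), hR₀ (x n)]
      with t a b d e g
    rw [a, b, Pi.sub_apply, Pi.sub_apply, d, e, g]
  refine ⟨R, fun x => by rw [hRx]; exact hR₀ x, htraj, fun u v huv => ?_⟩
  -- uniqueness is inherited from the smaller of the two end point exponents
  have hd := (htraj (v + u)).lp_sub huv
  set w := R (v + u) - u with hw
  have hzero : (v + u - R (v + u) - v : Lp V (recipExp s) (volJ T)) = -w := by rw [hw]; abel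
  rw [hzero] at hd
  suffices h : w =ᵐ[volJ T] 0 by
    exact sub_eq_zero.mp (Lp.ext (h.trans (Lp.coeFn_zero _ _ _).symm))
  have key : ∀ s' : ℝ, s' ∈ Ioo (0 : ℝ) 1 → s ≤ s' → DualityReg T N (recipExp s') M →
      w =ᵐ[volJ T] 0 := by
    intro s' hs' hle D
    have hspos : 0 < s := by rw [hs]; exact (affine_mem_Ioo h0 h1 hτ).1
    have hmono : recipExp s' ≤ recipExp s := ENNReal.ofReal_le_ofReal (inv_anti₀ hspos hle)
    have hb := D.bound _ _ ((Lp.memLp w).mono_exponent hmono)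
      ((Lp.memLp (-w)).mono_exponent hmono) hd
    have hz : ⇑(-w) + ⇑w =ᵐ[volJ T] 0 := by
      filter_upwards [Lp.coeFn_neg w] with t ht
      rw [Pi.add_apply, ht, Pi.neg_apply, neg_add_cancel, Pi.zero_apply]
    rw [eLpNorm_congr_ae hz, eLpNorm_zero, mul_zero] at hb
    have h3 : eLpNorm w (recipExp s') (volJ T) = 0 := le_antisymm (le_self_add.trans hb) zero_le
    exact (eLpNorm_eq_zero_iff (Lp.aestronglyMeasurable w) (recipExp_ne_zero hs'.1)).mp h3
  rcases le_total s₀ s₁ with h | h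
  · exact key s₁ h1 (by rw [hs]; nlinarith [mul_nonneg (sub_nonneg.mpr h) (sub_nonneg.mpr hτ.2)]) D1
  · exact key s₀ h0 (by rw [hs]; nlinarith [mul_nonneg (sub_nonneg.mpr h) hτ.1]) D0

/-- Maximal regularity, and the bound for the solution operator, at an exponent near `2`, in terms
of trajectories. -/
theorem CoerciveFamily.maxReg_interp {A : ℝ → V →L[ℂ] V} {c C : ℝ}
    (hA : CoerciveFamily (volJ T) A c C) (hT : 0 < T)
    (hN : ∀ φ ψ, (inner ℂ φ (N ψ) : ℂ) = inner ℂ (j φ) (j ψ)) {s₀ s₁ θ θ' M s q : ℝ}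
    {p : ℝ≥0∞} [Fact (1 ≤ p)] (hp : p = recipExp s)
    (h0 : s₀ ∈ Ioo (0 : ℝ) 1) (h1 : s₁ ∈ Ioo (0 : ℝ) 1) (hθ : θ ∈ Ioo (0 : ℝ) 1)
    (hθ' : θ' ∈ Icc (0 : ℝ) 1) (hM : 0 ≤ M)
    (half : s₀ + (s₁ - s₀) * θ = 1 / 2) (D0 : DualityReg T N (recipExp s₀) M)
    (D1 : DualityReg T N (recipExp s₁) M) (hs : s = s₀ + (s₁ - s₀) * θ')
    (hθθ : |θ' - θ| < min θ (1 - θ))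
    (hq : q = (1 + (1 + (1 + C) / c) * (max 1 C * M)) * (|θ' - θ| / min θ (1 - θ))) (hq1 : q < 1) :
    (∀ f : Lp V p (volJ T), ∃ u v : Lp V p (volJ T),
      Traj T N u v ∧ v + hA.mulOp u = f) ∧
    (∀ u v : Lp V p (volJ T), Traj T N u v →
      (1 - q) * ‖v + u‖ ≤ (1 + (1 + C) / c) * ‖v + hA.mulOp u‖) ∧
    ∀ u v : Lp V p (volJ T), Traj T N u v → v + u = 0 → u = 0 := by
  subst hp
  obtain ⟨R, hRx, hRt, hRu⟩ := exists_dualitySolve_interp hT hN h0 h1 hθ' hM D0 D1 hs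
  have D := hA.sneibergData hT hN h0 h1 hθ hM half D0 D1
  have hc := hA.c_pos
  have hC := hA.C_pos
  have hK : 0 < 1 + (1 + C) / c := by positivity
  have hq0 : 0 ≤ q := by
    have : 0 < min θ (1 - θ) := (abs_nonneg _).trans_lt hθθ
    rw [hq]; positivity
  set S : Lp V (recipExp s) (volJ T) →L[ℂ] Lp V (recipExp s) (volJ T) :=
    ContinuousLinearMap.id ℂ _ - R + hA.mulOp ∘L R with hS
  have hSa : ∀ f, S f = f - R f + hA.mulOp (R f) := fun f => rfl
  have hdense := dense_simpleToLp (V := V) (T := T) (recipExp_ne_top s)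
  have hSx : ∀ x : SimpleFunc ℝ V, S (simpleToLp T (recipExp s) x) =ᵐ[volJ T]
      hA.quotOp hT hN (toL2 (volJ T) x) := by
    intro x
    rw [hSa, hA.quotOp_apply]
    set f := simpleToLp T (recipExp s) x with hf
    set g := toL2 (volJ T) x with hg
    filter_upwards [Lp.coeFn_add (f - R f) (hA.mulOp (R f)), Lp.coeFn_sub f (R f),
      hA.coeFn_mulOp (R f), Lp.coeFn_add (g - dualitySolve hT hN g)
      (hA.mulOp (dualitySolve hT hN g)), Lp.coeFn_sub g (dualitySolve hT hN g),
      hA.coeFn_mulOp (dualitySolve hT hN g), hRx x, coeFn_toL2 (μ := volJ T) x,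
      coeFn_simpleToLp (T := T) (recipExp s) x] with t a1 a2 a3 a4 a5 a6 a7 a8 a9
    rw [a1, Pi.add_apply, a2, Pi.sub_apply, a3, a4, Pi.add_apply, a5, Pi.sub_apply, a6, a7, a8, a9]
  have hlow : ∀ f, (1 - q) * ‖f‖ ≤ (1 + (1 + C) / c) * ‖S f‖ := by
    intro f
    refine hdense.induction_on f (isClosed_le (by fun_prop) (by fun_prop)) fun x => ?_
    have h := D.lower_bound hθ' hθθ x
    rw [← hq, ← hs] at h
    have hfin : eLpNorm (hA.quotOp hT hN (toL2 (volJ T) x)) (recipExp s) (volJ T) ≠ ⊤ := by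
      rw [← eLpNorm_congr_ae (hSx x)]; exact Lp.eLpNorm_ne_top _
    have h' := ENNReal.toReal_mono (ENNReal.mul_ne_top ENNReal.ofReal_ne_top hfin) h
    rw [ENNReal.toReal_mul, ENNReal.toReal_mul, ENNReal.toReal_ofReal (by linarith),
      ENNReal.toReal_ofReal hK.le] at h'
    rw [norm_simpleToLp, Lp.norm_def, eLpNorm_congr_ae (hSx x)]
    exact h'
  have hsurj : Function.Surjective S := by
    refine surjective_of_near_preimage S (κ := (1 - q) / (1 + (1 + C) / c)) (q := (1 + q) / 2)
      (div_pos (by linarith) hK) (by linarith) (by linarith) (fun f => ?_) hdense ?_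
    · rw [div_mul_eq_mul_div, div_le_iff₀ hK, mul_comm ‖S f‖]
      exact hlow f
    · rintro _ ⟨y, rfl⟩
      obtain ⟨x, hx⟩ := D.exists_near_preimage hθ' hθθ y (δ := (1 - q) / 2) (by linarith)
      refine ⟨simpleToLp T (recipExp s) x, ?_⟩
      rw [← hq, ← hs] at hx
      have he : (S (simpleToLp T (recipExp s) x) - simpleToLp T (recipExp s) y :
          Lp V (recipExp s) (volJ T)) =ᵐ[volJ T]
          (hA.quotOp hT hN (toL2 (volJ T) x) - toL2 (volJ T) y : Lp V 2 (volJ T)) := by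
        filter_upwards [hSx x, Lp.coeFn_sub (S (simpleToLp T (recipExp s) x))
          (simpleToLp T (recipExp s) y), Lp.coeFn_sub (hA.quotOp hT hN (toL2 (volJ T) x))
          (toL2 (volJ T) y), coeFn_toL2 (μ := volJ T) y,
          coeFn_simpleToLp (T := T) (recipExp s) y] with t a1 a2 a3 a4 a5
        rw [a2, a3, Pi.sub_apply, Pi.sub_apply, a1, a4, a5]
      rw [Lp.norm_def, eLpNorm_congr_ae he, norm_simpleToLp]
      have h' := ENNReal.toReal_mono
        (ENNReal.mul_ne_top ENNReal.ofReal_ne_top (eLpNorm_simple_ne_top y _)) hx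
      rw [ENNReal.toReal_mul, ENNReal.toReal_ofReal (by linarith)] at h'
      refine h'.trans (le_of_eq ?_)
      ring
  refine ⟨fun f => ?_, fun u v huv => ?_, fun u v huv h => ?_⟩
  · obtain ⟨x, hx⟩ := hsurj f
    exact ⟨R x, x - R x, hRt x, hx⟩
  · have h := hlow (v + u)
    rwa [hSa, hRu u v huv, add_sub_cancel_right] at h
  · have h' := hRu u v huv
    rwa [h, map_zero, eq_comm] at h'

end IntermediateExponents

/-! ### Maximal regularity in the Gelfand triple -/

section RieszIdentification

variable {V H : Type*} [NormedAddCommGroup V] [InnerProductSpace ℂ V]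
  [NormedAddCommGroup H] [InnerProductSpace ℂ H]

theorem norm_dualityMap (ψ : V) : ‖dualityMap V ψ‖ = ‖ψ‖ := by
  refine le_antisymm (ContinuousLinearMap.opNorm_le_bound _ (norm_nonneg _) fun φ => ?_) ?_
  · rw [dualityMap_apply, mul_comm]
    exact norm_inner_le_norm _ _
  · rcases (norm_nonneg ψ).eq_or_lt with h | h
    · rw [← h]; exact norm_nonneg _
    · have h1 := (dualityMap V ψ).le_opNorm ψ
      rw [dualityMap_apply, inner_self_eq_norm_sq_to_K, norm_pow, sq] at h1
      simp only [Complex.coe_algebraMap, Complex.norm_real, norm_norm] at h1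
      exact le_of_mul_le_mul_right h1 h

variable [CompleteSpace V]

theorem dualityMap_surjective : Function.Surjective (dualityMap V) := by
  intro f
  let g : V →L[ℂ] ℂ := LinearMap.mkContinuous
    { toFun := fun φ => starRingEnd ℂ (f φ)
      map_add' := fun φ ψ => by rw [map_add, map_add]
      map_smul' := fun a φ => by
        rw [map_smulₛₗ, smul_eq_mul, map_mul, Complex.conj_conj, RingHom.id_apply, smul_eq_mul] }
    ‖f‖ fun φ => by
      have := f.le_opNorm φ
      simpa using this
  refine ⟨(InnerProductSpace.toDual ℂ V).symm g, ContinuousLinearMap.ext fun φ => ?_⟩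
  rw [dualityMap_apply, ← inner_conj_symm, InnerProductSpace.toDual_symm_apply]
  exact Complex.conj_conj _

/-- The Riesz isomorphism `V ≃ V^*`, which is the duality map. -/
def riesz (V : Type*) [NormedAddCommGroup V] [InnerProductSpace ℂ V] [CompleteSpace V] :
    V ≃ₗᵢ[ℂ] AntiDual V :=
  LinearIsometryEquiv.ofSurjective ⟨(dualityMap V).toLinearMap, norm_dualityMap⟩
    dualityMap_surjective

theorem riesz_apply (ψ : V) : riesz V ψ = dualityMap V ψ := rfl

theorem inner_riesz_symm (φ : V) (f : AntiDual V) : (inner ℂ φ ((riesz V).symm f) : ℂ) = f φ := by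
  rw [← dualityMap_apply, ← riesz_apply, LinearIsometryEquiv.apply_symm_apply]

/-- The embedding of `V` in `V^*`, followed by the Riesz isomorphism of `V^*` with `V`. -/
def gramOp (j : V →L[ℂ] H) : V →L[ℂ] V :=
  ((riesz V).symm.toContinuousLinearEquiv : AntiDual V →L[ℂ] V) ∘L gelfand j

theorem gramOp_apply (j : V →L[ℂ] H) (ψ : V) : gramOp j ψ = (riesz V).symm (gelfand j ψ) := rfl

theorem inner_gramOp (j : V →L[ℂ] H) (φ ψ : V) :
    (inner ℂ φ (gramOp j ψ) : ℂ) = inner ℂ (j φ) (j ψ) := by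
  rw [gramOp_apply, inner_riesz_symm, gelfand_apply]

/-- The operators `V → V^*` of a family, followed by the Riesz isomorphism of `V^*` with `V`. -/
def rieszFamily (B : ℝ → V →L[ℂ] AntiDual V) (t : ℝ) : V →L[ℂ] V :=
  ((riesz V).symm.toContinuousLinearEquiv : AntiDual V →L[ℂ] V) ∘L B t

theorem rieszFamily_apply (B : ℝ → V →L[ℂ] AntiDual V) (t : ℝ) (ψ : V) :
    rieszFamily B t ψ = (riesz V).symm (B t ψ) := rfl

theorem coerciveFamily_of_forms {T : ℝ} (s : ℝ → V →ₗ[ℂ] V →ₗ⋆[ℂ] ℂ) {c C : ℝ} (hc : 0 < c)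
    (hC : 0 < C)
    (hmeas : ∀ φ ψ : V, AEMeasurable (fun t => s t φ ψ) (volume.restrict (Ioo 0 T)))
    (hsep : ∀ ψ : V, TopologicalSpace.IsSeparable
      ((fun t => inducedOperator (s t) ψ) '' Ioo 0 T))
    (hcoer : ∀ t ∈ Ioo 0 T, ∀ ψ : V, c * ‖ψ‖ ^ 2 ≤ (s t ψ ψ).re)
    (hbdd : ∀ t ∈ Ioo 0 T, ∀ ψ φ : V, ‖s t ψ φ‖ ≤ C * ‖ψ‖ * ‖φ‖) :
    CoerciveFamily (volJ T) (rieszFamily fun t => inducedOperator (s t)) c C where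
  c_pos := hc
  C_pos := hC
  meas ψ := by
    refine aestronglyMeasurable_of_inner (s := Ioo 0 T) (ae_restrict_mem measurableSet_Ioo) ?_
      fun φ => ?_
    · have := (hsep ψ).image (riesz V).symm.continuous
      rwa [image_image] at this
    · refine (hmeas ψ φ).congr ?_
      filter_upwards [ae_restrict_mem measurableSet_Ioo] with t ht
      rw [rieszFamily_apply, inner_riesz_symm, inducedOperator_apply (hbdd t ht)]
  coer := by
    filter_upwards [ae_restrict_mem measurableSet_Ioo] with t ht ψ
    rw [rieszFamily_apply, inner_riesz_symm, inducedOperator_apply (hbdd t ht)]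
    exact hcoer t ht ψ
  bdd := by
    filter_upwards [ae_restrict_mem measurableSet_Ioo] with t ht ψ
    rw [rieszFamily_apply, LinearIsometryEquiv.norm_map]
    refine ContinuousLinearMap.opNorm_le_bound _ (by positivity) fun φ => ?_
    rw [inducedOperator_apply (hbdd t ht)]
    exact hbdd t ht ψ φ

end RieszIdentification

section Bridge

variable {V H : Type*} [NormedAddCommGroup V] [InnerProductSpace ℂ V] [CompleteSpace V]
  [NormedAddCommGroup H] [InnerProductSpace ℂ H] {T r : ℝ} {j : V →L[ℂ] H}

/-- The Riesz isomorphism on `L^p`. -/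
def rieszLp (p : ℝ≥0∞) (v : Lp V p (volJ T)) : Lp (AntiDual V) p (volJ T) :=
  ((riesz V).toContinuousLinearEquiv : V →L[ℂ] AntiDual V).compLp v

theorem coeFn_rieszLp (p : ℝ≥0∞) (v : Lp V p (volJ T)) :
    rieszLp p v =ᵐ[volJ T] fun t => riesz V (v t) :=
  ContinuousLinearMap.coeFn_compLp _ v

/-- The inverse of the Riesz isomorphism on `L^p`. -/
def rieszSymmLp (p : ℝ≥0∞) (g : Lp (AntiDual V) p (volJ T)) : Lp V p (volJ T) :=
  ((riesz V).symm.toContinuousLinearEquiv : AntiDual V →L[ℂ] V).compLp g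

theorem coeFn_rieszSymmLp (p : ℝ≥0∞) (g : Lp (AntiDual V) p (volJ T)) :
    rieszSymmLp p g =ᵐ[volJ T] fun t => (riesz V).symm (g t) :=
  ContinuousLinearMap.coeFn_compLp _ g

theorem enorm_rieszLp (p : ℝ≥0∞) (v : Lp V p (volJ T)) : ‖rieszLp p v‖ₑ = ‖v‖ₑ := by
  rw [Lp.enorm_def, Lp.enorm_def, eLpNorm_congr_ae (coeFn_rieszLp p v)]
  exact eLpNorm_congr_norm_ae (Filter.Eventually.of_forall fun t => (riesz V).norm_map _)

theorem rieszSymmLp_rieszLp (p : ℝ≥0∞) (v : Lp V p (volJ T)) :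
    rieszSymmLp p (rieszLp p v) = v := by
  refine Lp.ext ?_
  filter_upwards [coeFn_rieszSymmLp p (rieszLp p v), coeFn_rieszLp p v] with t h1 h2
  rw [h1, h2, LinearIsometryEquiv.symm_apply_apply]

theorem rieszLp_rieszSymmLp (p : ℝ≥0∞) (g : Lp (AntiDual V) p (volJ T)) :
    rieszLp p (rieszSymmLp p g) = g := by
  refine Lp.ext ?_
  filter_upwards [coeFn_rieszLp p (rieszSymmLp p g), coeFn_rieszSymmLp p g] with t h1 h2
  rw [h1, h2, LinearIsometryEquiv.apply_symm_apply]

variable [Fact (1 ≤ ENNReal.ofReal r)]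

theorem traj_iff_weakDeriv (hT : 0 < T) (u : LpJ T r V) (g : LpJ T r (AntiDual V)) :
    Traj T (gramOp j) u (rieszSymmLp _ g) ↔
      HasWeakDeriv T (fun t => gelfand j (u t)) g ∧ InitialZero T (fun t => gelfand j (u t)) := by
  have hu : Integrable u (volJ T) := (Lp.memLp u).integrable Fact.out
  have hg : Integrable g (volJ T) := (Lp.memLp g).integrable Fact.out
  rw [hasWeakDeriv_initialZero_iff hT ((gelfand j).integrable_comp hu) hg, Traj]
  refine Filter.eventually_congr ?_
  filter_upwards [ae_restrict_mem measurableSet_Ioo] with t ht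
  have e : ∫ s in 0..t, rieszSymmLp _ g s = (riesz V).symm (∫ s in 0..t, g s) := by
    rw [intervalIntegral_congr_volJ (coeFn_rieszSymmLp _ g) ht,
      intervalIntegral.integral_of_le ht.1.le, intervalIntegral.integral_of_le ht.1.le]
    exact (riesz V).symm.toContinuousLinearEquiv.integral_comp_comm _
  rw [e, gramOp_apply]
  exact (riesz V).symm.injective.eq_iff

/-- Trajectories are the elements of `MR^r_0(J;V,V^*)`. -/
def MR.ofTraj (hT : 0 < T) {u v : LpJ T r V} (h : Traj T (gramOp j) u v) :
    MR (gelfand j) T r where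
  fn := u
  dt := rieszLp _ v
  hasWeakDeriv := ((traj_iff_weakDeriv hT u _).mp (by rwa [rieszSymmLp_rieszLp])).1
  initialZero := ((traj_iff_weakDeriv hT u _).mp (by rwa [rieszSymmLp_rieszLp])).2

theorem MR.traj (hT : 0 < T) (u : MR (gelfand j) T r) :
    Traj T (gramOp j) u.fn (rieszSymmLp _ u.dt) :=
  (traj_iff_weakDeriv hT _ _).mpr ⟨u.hasWeakDeriv, u.initialZero⟩

theorem MR.solves_iff {u : MR (gelfand j) T r} {B : ℝ → V →L[ℂ] AntiDual V}
    {c C : ℝ} (hA : CoerciveFamily (volJ T) (rieszFamily B) c C)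
    {f : LpJ T r (AntiDual V)} :
    u.Solves B f ↔ rieszSymmLp _ u.dt + hA.mulOp u.fn = rieszSymmLp _ f := by
  rw [MR.Solves, Lp.ext_iff]
  refine Filter.eventually_congr ?_
  filter_upwards [Lp.coeFn_add (rieszSymmLp _ u.dt) (hA.mulOp u.fn), hA.coeFn_mulOp u.fn,
    coeFn_rieszSymmLp _ u.dt, coeFn_rieszSymmLp _ f] with t h1 h2 h3 h4
  rw [h1, Pi.add_apply, h2, h3, h4, rieszFamily_apply, ← map_add]
  exact (riesz V).symm.injective.eq_iff.symm

theorem MR.tildeEnorm_eq (u : MR (gelfand j) T r) :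
    u.tildeEnorm (dualityMap V) = ‖rieszSymmLp _ u.dt + u.fn‖ₑ := by
  rw [MR.tildeEnorm, ← enorm_rieszLp _ (rieszSymmLp _ u.dt + u.fn)]
  congr 1
  refine Lp.ext ?_
  filter_upwards [Lp.coeFn_add u.dt ((dualityMap V).compLp u.fn),
    (dualityMap V).coeFn_compLp u.fn, coeFn_rieszLp _ (rieszSymmLp _ u.dt + u.fn),
    Lp.coeFn_add (rieszSymmLp _ u.dt) u.fn, coeFn_rieszSymmLp _ u.dt] with t h1 h2 h3 h4 h5
  rw [h1, Pi.add_apply, h2, h3, h4, Pi.add_apply, h5, map_add,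
    LinearIsometryEquiv.apply_symm_apply, riesz_apply]

/-- Maximal regularity, and the bound for the solution operator, translated from trajectories to
`MR^r_0(J;V,V^*)`. -/
theorem maximalRegularity_of_traj (hT : 0 < T) {B : ℝ → V →L[ℂ] AntiDual V} {c C κ : ℝ}
    (hA : CoerciveFamily (volJ T) (rieszFamily B) c C) (hκ : 0 ≤ κ)
    (hex : ∀ f : LpJ T r V, ∃ u v : LpJ T r V, Traj T (gramOp j) u v ∧ v + hA.mulOp u = f)
    (hest : ∀ u v : LpJ T r V, Traj T (gramOp j) u v → ‖v + u‖ ≤ κ * ‖v + hA.mulOp u‖)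
    (huniq : ∀ u v : LpJ T r V, Traj T (gramOp j) u v → v + u = 0 → u = 0) :
    MaximalRegularity (gelfand j) B T r ∧
      inverseNorm (gelfand j) B T r (MR.tildeEnorm (dualityMap V)) ≤ ENNReal.ofReal κ := by
  have hMR : MaximalRegularity (gelfand j) B T r := by
    intro f
    obtain ⟨u, v, htr, he⟩ := hex (rieszSymmLp _ f)
    refine ⟨MR.ofTraj hT htr, (MR.solves_iff hA).mpr ?_, fun w hw => ?_⟩
    · change rieszSymmLp _ (rieszLp _ v) + hA.mulOp u = _
      rw [rieszSymmLp_rieszLp, he]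
    · have hw' := (MR.solves_iff hA).mp hw
      have hd := (MR.traj hT w).lp_sub htr
      have hz : rieszSymmLp _ w.dt - v + hA.mulOp (w.fn - u) = 0 := by
        rw [map_sub, ← sub_eq_zero.mpr (hw'.trans he.symm)]
        abel
      have h1 := hest _ _ hd
      rw [hz, norm_zero, mul_zero] at h1
      have h2 := huniq _ _ hd (norm_le_zero_iff.mp h1)
      rw [h2, map_zero, add_zero] at hz
      refine MR.ext (sub_eq_zero.mp h2) ?_
      change w.dt = rieszLp _ v
      rw [← sub_eq_zero.mp hz, rieszLp_rieszSymmLp]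
  refine ⟨hMR, sInf_le ⟨hMR, fun f u hu => ?_⟩⟩
  have h := hest _ _ (MR.traj hT u)
  rw [(MR.solves_iff hA).mp hu] at h
  rw [MR.tildeEnorm_eq, ← ofReal_norm]
  refine (ENNReal.ofReal_le_ofReal h).trans ?_
  rw [ENNReal.ofReal_mul hκ, ofReal_norm, ← enorm_rieszLp _ (rieszSymmLp _ f),
    rieszLp_rieszSymmLp]

/-- The infimum in the definition of the norm of the solution operator is itself a bound. -/
theorem inverseNorm_spec {D X : Type*} [NormedAddCommGroup D] [NormedSpace ℂ D]
    [NormedAddCommGroup X] [NormedSpace ℂ X] {ι : D →L[ℂ] X} {A : ℝ → D →L[ℂ] X} {T r : ℝ}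
    {n : MR ι T r → ℝ≥0∞} (h : inverseNorm ι A T r n ≠ ⊤) :
    MaximalRegularity ι A T r ∧ ∀ (f : LpJ T r X) (u : MR ι T r), u.Solves A f →
      n u ≤ inverseNorm ι A T r n * ‖f‖ₑ := by
  obtain ⟨K, hK, -⟩ := sInf_lt_iff.mp (lt_top_iff_ne_top.mpr h)
  refine ⟨hK.1, fun f u hu => ?_⟩
  have hf : ‖f‖ₑ ≠ ⊤ := enorm_ne_top
  refine ENNReal.le_of_forall_pos_le_add fun ε hε _ => ?_
  have hlt : inverseNorm ι A T r n < inverseNorm ι A T r n + ε / (‖f‖ₑ + 1) := by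
    refine ENNReal.lt_add_right h (ENNReal.div_ne_zero.mpr ⟨by simpa using hε.ne', ?_⟩)
    exact ENNReal.add_ne_top.mpr ⟨hf, ENNReal.one_ne_top⟩
  obtain ⟨K', hK', hlt'⟩ := sInf_lt_iff.mp hlt
  calc n u ≤ K' * ‖f‖ₑ := hK'.2 f u hu
    _ ≤ (inverseNorm ι A T r n + ε / (‖f‖ₑ + 1)) * ‖f‖ₑ := by gcongr
    _ = inverseNorm ι A T r n * ‖f‖ₑ + ε / (‖f‖ₑ + 1) * ‖f‖ₑ := add_mul _ _ _
    _ ≤ inverseNorm ι A T r n * ‖f‖ₑ + ε / (‖f‖ₑ + 1) * (‖f‖ₑ + 1) := by gcongr; exact le_self_add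
    _ = _ := by
      rw [ENNReal.div_mul_cancel (by simp) (ENNReal.add_ne_top.mpr ⟨hf, ENNReal.one_ne_top⟩)]

theorem rieszFamily_dualityMap :
    rieszFamily (fun _ : ℝ => dualityMap V) = fun _ => ContinuousLinearMap.id ℂ V := by
  funext t
  ext ψ
  rw [rieszFamily_apply, ← riesz_apply, LinearIsometryEquiv.symm_apply_apply]
  rfl

theorem solves_dualityMap_iff {u : MR (gelfand j) T r} {f : LpJ T r (AntiDual V)} :
    u.Solves (fun _ => dualityMap V) f ↔ rieszSymmLp _ u.dt + u.fn = rieszSymmLp _ f := by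
  have hA : CoerciveFamily (volJ T) (rieszFamily fun _ : ℝ => dualityMap V) 1 1 := by
    rw [rieszFamily_dualityMap]; exact CoerciveFamily.one
  have h : hA.mulOp u.fn = u.fn := by
    refine Lp.ext ((hA.coeFn_mulOp u.fn).trans ?_)
    rw [rieszFamily_dualityMap]
    rfl
  rw [MR.solves_iff hA, h]

theorem dualityReg_of_inverseNorm (hT : 0 < T) {M : ℝ≥0∞} (hM : M ≠ ⊤)
    (h : inverseNorm (gelfand j) (fun _ => dualityMap V) T r MR.enorm ≤ M) :
    DualityReg T (gramOp j) (ENNReal.ofReal r) M.toReal := by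
  obtain ⟨hMR, hb⟩ := inverseNorm_spec (h.trans_lt (lt_top_iff_ne_top.mpr hM)).ne
  constructor
  · intro f hf
    obtain ⟨u, hu, -⟩ := hMR (rieszLp _ (hf.toLp f))
    have hu' := solves_dualityMap_iff.mp hu
    rw [rieszSymmLp_rieszLp] at hu'
    refine ⟨u.fn, rieszSymmLp _ u.dt, Lp.memLp _, Lp.memLp _, MR.traj hT u, ?_⟩
    refine (Lp.coeFn_add _ _).symm.trans ?_
    rw [hu']
    exact hf.coeFn_toLp
  · intro u v hu hv htr
    have htr' : Traj T (gramOp j) (hu.toLp u) (hv.toLp v) :=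
      htr.congr hu.coeFn_toLp.symm hv.coeFn_toLp.symm
    have hsol : (MR.ofTraj hT htr').Solves (fun _ => dualityMap V)
        (rieszLp _ (hv.toLp v + hu.toLp u)) := by
      rw [solves_dualityMap_iff, rieszSymmLp_rieszLp]
      change rieszSymmLp _ (rieszLp _ (hv.toLp v)) + hu.toLp u = _
      rw [rieszSymmLp_rieszLp]
    have h1 := hb _ _ hsol
    rw [enorm_rieszLp, MR.enorm] at h1
    change ‖hu.toLp u‖ₑ + ‖rieszLp _ (hv.toLp v)‖ₑ ≤ _ at h1
    rw [enorm_rieszLp, ← MemLp.toLp_add, Lp.enorm_toLp, Lp.enorm_toLp, Lp.enorm_toLp] at h1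
    rw [ENNReal.ofReal_toReal hM]
    exact h1.trans (by gcongr)

/-- Lions' theorem: maximal regularity at the exponent `2`, in terms of trajectories. -/
theorem CoerciveFamily.maxReg_two {A : ℝ → V →L[ℂ] V} {c C : ℝ} {p : ℝ≥0∞} [Fact (1 ≤ p)]
    (hp : p = 2) (hA : CoerciveFamily (volJ T) A c C) (hT : 0 < T) :
    (∀ f : Lp V p (volJ T), ∃ u v : Lp V p (volJ T),
      Traj T (gramOp j) u v ∧ v + hA.mulOp u = f) ∧
    (∀ u v : Lp V p (volJ T), Traj T (gramOp j) u v →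
      ‖v + u‖ ≤ (1 + (1 + C) / c) * ‖v + hA.mulOp u‖) ∧
    ∀ u v : Lp V p (volJ T), Traj T (gramOp j) u v → v + u = 0 → u = 0 := by
  subst hp
  refine ⟨hA.exists_traj hT (inner_gramOp j), fun u v h => hA.norm_sum_le_of_traj (inner_gramOp j) h,
    fun u v h h0 => ?_⟩
  have h1 := dualitySolve_eq hT (inner_gramOp j) h
  rwa [h0, map_zero, eq_comm] at h1

end Bridge

end NonautMaxReg

end

theorem theorem4p2
    {V H : Type*} [NormedAddCommGroup V] [InnerProductSpace ℂ V] [CompleteSpace V]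
    [NormedAddCommGroup H] [InnerProductSpace ℂ H] [CompleteSpace H]
    -- the embedding of `V` in `H`
    (j : V →L[ℂ] H) (hj_inj : Function.Injective j) (hj_dense : DenseRange j)
    (T : ℝ) (hT : 0 < T)
    -- the forms `s_t`, `t ∈ J = (0,T)`, and their constants
    (s : ℝ → V →ₗ[ℂ] V →ₗ⋆[ℂ] ℂ) (c C : ℝ) (hc : 0 < c) (hC : 0 < C)
    (hmeas : ∀ φ ψ : V, AEMeasurable (fun t => s t φ ψ) (volume.restrict (Ioo 0 T)))
    -- holds automatically if `V` is separable
    (hsep : ∀ ψ : V, TopologicalSpace.IsSeparable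
      ((fun t => NonautMaxReg.inducedOperator (s t) ψ) '' Ioo 0 T))
    (hcoer : ∀ t ∈ Ioo 0 T, ∀ ψ : V, c * ‖ψ‖ ^ 2 ≤ (s t ψ ψ).re)
    (hbdd : ∀ t ∈ Ioo 0 T, ∀ ψ φ : V, ‖s t ψ φ‖ ≤ C * ‖ψ‖ * ‖φ‖)
    (r₀ r₁ θ : ℝ) (hr₀ : 2 < r₀) (hr₁ : r₁ ∈ Ioo 1 2) (hθ : θ ∈ Ioo 0 1)
    (hθr : 1 / 2 = (1 - θ) / r₀ + θ / r₁)
    (θ' r : ℝ) (hθ' : θ' ∈ Ioo 0 1) (hr : 1 < r)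
    (hθ'r : 1 / r = (1 - θ') / r₀ + θ' / r₁) :
    (ENNReal.ofReal |θ - θ'| <
        ENNReal.ofReal (min θ (1 - θ)) /
          (1 + ENNReal.ofReal ((1 + (1 + C) / c) * max 1 C) *
            NonautMaxReg.dualityConst j T r₀ r₁) →
      NonautMaxReg.MaximalRegularity (NonautMaxReg.gelfand j)
        (fun t => NonautMaxReg.inducedOperator (s t)) T r) ∧
    (ENNReal.ofReal |θ - θ'| ≤
        1 / 6 * (ENNReal.ofReal (min θ (1 - θ)) /
          (1 + 2 * ENNReal.ofReal ((1 + (1 + C) / c) * max 1 C) *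
            NonautMaxReg.dualityConst j T r₀ r₁)) →
      NonautMaxReg.MaximalRegularity (NonautMaxReg.gelfand j)
        (fun t => NonautMaxReg.inducedOperator (s t)) T r ∧
      NonautMaxReg.inverseNorm (NonautMaxReg.gelfand j)
        (fun t => NonautMaxReg.inducedOperator (s t)) T r
        (NonautMaxReg.MR.tildeEnorm (NonautMaxReg.dualityMap V)) ≤
          ENNReal.ofReal (8 * ((1 + c + C) / c))) := by
  open NonautMaxReg in
  have hA := coerciveFamily_of_forms s hc hC hmeas hsep hcoer hbdd
  have fact_of : ∀ ρ : ℝ, 1 < ρ → Fact (1 ≤ ENNReal.ofReal ρ) := fun ρ h =>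
    ⟨by rw [ENNReal.one_le_ofReal]; exact h.le⟩
  have := fact_of r hr
  have := fact_of r₀ (by linarith)
  have := fact_of r₁ hr₁.1
  set K := 1 + (1 + C) / c with hK
  have hKpos : 0 < K := by positivity
  have hKeq : (1 + c + C) / c = K := by rw [hK]; field_simp; ring
  rw [hKeq]
  set m := min θ (1 - θ) with hm
  have hmpos : 0 < m := lt_min hθ.1 (sub_pos.mpr hθ.2)
  have hexp : ∀ ρ : ℝ, ENNReal.ofReal ρ = recipExp ρ⁻¹ := fun ρ => by rw [recipExp, inv_inv]
  have hinv : ∀ ρ : ℝ, 1 < ρ → ρ⁻¹ ∈ Ioo (0 : ℝ) 1 := fun ρ h =>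
    ⟨inv_pos.mpr (by linarith), inv_lt_one_of_one_lt₀ h⟩
  have half : r₀⁻¹ + (r₁⁻¹ - r₀⁻¹) * θ = 1 / 2 := by rw [hθr]; ring
  have hrinv : r⁻¹ = r₀⁻¹ + (r₁⁻¹ - r₀⁻¹) * θ' := by rw [← one_div, hθ'r]; ring
  -- maximal regularity, when the constant of the duality map is finite
  have finite_case : dualityConst j T r₀ r₁ ≠ ⊤ → ∀ q κ : ℝ,
      q = (1 + K * (max 1 C * (dualityConst j T r₀ r₁).toReal)) * (|θ' - θ| / m) → q < 1 →
      K ≤ κ * (1 - q) →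
      MaximalRegularity (gelfand j) (fun t => inducedOperator (s t)) T r ∧
      inverseNorm (gelfand j) (fun t => inducedOperator (s t)) T r
        (MR.tildeEnorm (dualityMap V)) ≤ ENNReal.ofReal κ := by
    intro hfin q κ hq hq1 hκ
    have hM : 0 ≤ (dualityConst j T r₀ r₁).toReal := ENNReal.toReal_nonneg
    have D0 := dualityReg_of_inverseNorm (j := j) (r := r₀) hT hfin (le_max_left _ _)
    have D1 := dualityReg_of_inverseNorm (j := j) (r := r₁) hT hfin (le_max_right _ _)
    rw [hexp] at D0 D1
    have ht0 : 0 ≤ |θ' - θ| / m := by positivity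
    have hθθ : |θ' - θ| < m := by
      rw [← div_lt_one hmpos]
      have : 0 ≤ K * (max 1 C * (dualityConst j T r₀ r₁).toReal) * (|θ' - θ| / m) := by positivity
      rw [hq, add_mul, one_mul] at hq1
      linarith
    obtain ⟨hex, hest, huniq⟩ := hA.maxReg_interp hT (inner_gramOp j) (hexp r)
      (hinv r₀ (by linarith)) (hinv r₁ hr₁.1) hθ ⟨hθ'.1.le, hθ'.2.le⟩ hM half D0 D1 hrinv hθθ hq hq1
    have hκ0 : 0 ≤ κ := by
      by_contra hneg
      push Not at hneg
      nlinarith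
    refine maximalRegularity_of_traj hT hA hκ0 hex (fun u v h => ?_) huniq
    have h1 := hest u v h
    have h2 : (1 - q) * ‖v + u‖ ≤ (1 - q) * (κ * ‖v + hA.mulOp u‖) :=
      h1.trans (by nlinarith [norm_nonneg (v + hA.mulOp u)])
    exact le_of_mul_le_mul_left h2 (by linarith)
  have hmaxpos : 0 < K * max 1 C := by positivity
  constructor
  · intro h
    have hfin : dualityConst j T r₀ r₁ ≠ ⊤ := by
      intro htop
      rw [htop, ENNReal.mul_top (by simpa using hmaxpos)] at h
      simp at h
    set M := (dualityConst j T r₀ r₁).toReal with hMdef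
    have hM : 0 ≤ M := ENNReal.toReal_nonneg
    have hMe : dualityConst j T r₀ r₁ = ENNReal.ofReal M := (ENNReal.ofReal_toReal hfin).symm
    have hden : (1 : ℝ≥0∞) + ENNReal.ofReal (K * max 1 C) * dualityConst j T r₀ r₁ =
        ENNReal.ofReal (1 + K * max 1 C * M) := by
      rw [hMe, ← ENNReal.ofReal_mul hmaxpos.le, ← ENNReal.ofReal_one,
        ← ENNReal.ofReal_add zero_le_one (by positivity)]
    have hdpos : 0 < 1 + K * max 1 C * M := by positivity
    rw [hden, ← ENNReal.ofReal_div_of_pos hdpos, ENNReal.ofReal_lt_ofReal_iff (by positivity),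
      lt_div_iff₀ hdpos, abs_sub_comm] at h
    set q := (1 + K * (max 1 C * M)) * (|θ' - θ| / m) with hq
    have hq1 : q < 1 := by
      rw [hq, mul_div_assoc', div_lt_one hmpos]
      linarith
    exact (finite_case hfin q (K / (1 - q)) hq hq1
      (by rw [div_mul_cancel₀]; linarith)).1
  · intro h
    by_cases hfin : dualityConst j T r₀ r₁ = ⊤
    · -- here `θ' = θ`, so that the exponent is `2`
      rw [hfin, ENNReal.mul_top (by simpa using hmaxpos)] at h
      rw [add_top, ENNReal.div_top, mul_zero, nonpos_iff_eq_zero,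
        ENNReal.ofReal_eq_zero] at h
      have hθe : θ = θ' := sub_eq_zero.mp (abs_nonpos_iff.mp h)
      have hr2 : r = 2 := by
        rw [← inv_inj, hrinv, ← hθe, half, one_div]
      obtain ⟨hex, hest, huniq⟩ := hA.maxReg_two (j := j) (p := ENNReal.ofReal r)
        (by rw [hr2]; simp) hT
      obtain ⟨h1, h2⟩ := maximalRegularity_of_traj hT hA hKpos.le hex hest huniq
      exact ⟨h1, h2.trans (ENNReal.ofReal_le_ofReal (by linarith))⟩
    · set M := (dualityConst j T r₀ r₁).toReal with hMdef
      have hM : 0 ≤ M := ENNReal.toReal_nonneg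
      have hMe : dualityConst j T r₀ r₁ = ENNReal.ofReal M := (ENNReal.ofReal_toReal hfin).symm
      have hdpos : 0 < 1 + 2 * (K * max 1 C) * M := by positivity
      have hden : (1 : ℝ≥0∞) + 2 * ENNReal.ofReal (K * max 1 C) * dualityConst j T r₀ r₁ =
          ENNReal.ofReal (1 + 2 * (K * max 1 C) * M) := by
        rw [hMe, ENNReal.ofReal_add zero_le_one (by positivity), ENNReal.ofReal_one,
          ENNReal.ofReal_mul (p := 2 * (K * max 1 C)) (by positivity),
          ENNReal.ofReal_mul (q := K * max 1 C) zero_le_two, ENNReal.ofReal_ofNat]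
      have h6 : (1 / 6 : ℝ≥0∞) = ENNReal.ofReal (1 / 6) := by
        rw [ENNReal.ofReal_div_of_pos (by norm_num)]; simp
      rw [hden, ← ENNReal.ofReal_div_of_pos hdpos, h6, ← ENNReal.ofReal_mul (by norm_num),
        ENNReal.ofReal_le_ofReal_iff (by positivity), ← mul_div_assoc, le_div_iff₀ hdpos,
        abs_sub_comm] at h
      set q := (1 + K * (max 1 C * M)) * (|θ' - θ| / m) with hq
      have hq6 : q ≤ 1 / 6 := by
        rw [hq, mul_div_assoc', div_le_iff₀ hmpos]
        have : 0 ≤ |θ' - θ| * (K * max 1 C * M) := by positivity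
        nlinarith
      -- the norm of the inverse is at most `K / (1 - q) ≤ 6 * K / 5`, well below `8 * K`
      exact finite_case hfin q (8 * K) hq (by linarith) (by nlinarith)
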